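/- Logarithms are to base 2. For $N\ge 0$ and a finite-dimensional space $\mathcal K$, an $N$-partite state is a density operator (positive semidefinite, trace one) on $\mathcal K^{\otimes N}$, and $\mathrm{SEP}$ is the set of fully separable states, i.e. of finite convex mixtures of states $\sigma^1\otimes\cdots\otimes\sigma^N$ with $\sigma^1,\dots,\sigma^N$ density operators on $\mathcal K$. For an $N$-partite state $\rho$ define - the relative entropy of entanglement (REE) $E_{\mathrm R}(\rho)=\min_{\sigma\in\mathrm{SEP}}S(\rho\|\sigma)$, where $S(\rho\|\sigma)=\mathrm{tr}\,\rho(\log\rho-\log\sigma)$ if $\mathrm{supp}\,\rho\subseteq\mathrm{supp}\,\sigma$ and $S(\rho\|\sigma)=+\infty$ otherwise; - the geometric measure (GM) $G(\rho)=-2\log\Lambda(\rho)$, where $\Lambda(\rho)\ge 0$ and $\Lambda^2(\rho)=\max_{\sigma\in\mathrm{SEP}}\mathrm{tr}(\rho\sigma)$; - the logarithmic global robustness (LGR) $R_{\mathrm L}(\rho)=\log(1+R_{\mathrm g}(\rho))$, where $R_{\mathrm g}(\rho)=\min\{t\ge 0:\ (\rho+t\Delta)/(1+t)\in\mathrm{SEP}\text{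 for some state }\Delta\}$. The $n$-copy state $\rho^{\otimes n}$ is regarded as an $N$-partite state over $\mathcal K^{\otimes n}$ whose $j$-th party holds the $j$-th particles of all $n$ copies. For $E\in\{G,E_{\mathrm R},R_{\mathrm L}\}$ put $E^\infty(\rho)=\lim_{n\to\infty}\frac1n E(\rho^{\otimes n})$; $E$ of $\rho$ is additive if $E^\infty(\rho)=E(\rho)$ and non-additive if the limit $E^\infty(\rho)$ exists and $E^\infty(\rho)\neq E(\rho)$. **Proposition.** Let $N\le d$. For orthonormal $|a_1\rangle,\dots,|a_N\rangle\in\mathbb C^d$, the Slater determinant state is $$|a_1\rangle\wedge\cdots\wedge|a_N\rangle=\frac1{\sqrt{N!}}\sum_{\pi\in S_N}\mathrm{sgn}(\pi)\,|a_{\pi(1)}\rangle\otimes\cdots\otimes|a_{\pi(N)}\rangle .$$ Let $\rho_N=\sum_i p_i|\psi_i\rangle\langle\psi_i|$ be any finite convex mixture of such states $|\psi_i\rangle$ ($p_i\ge0$, $\sum_ip_i=1$). Then $$E_{\mathrm R}(\rho_N)=R_{\mathrm L}(\rho_N)=\log N!,$$ $$\log\frac{d^N\,N!\,(d-N)!}{d!}\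 \le\ E_{\mathrm R}(\rho_N^{\otimes2})\ \le\ R_{\mathrm L}(\rho_N^{\otimes2})\ \le\ N\log N$$ (with $0\log 0=0$). If moreover $N\ge3$, then GM, REE and LGR of $\rho_N$ are all non-additive, and already $E(\rho_N^{\otimes2})<2E(\rho_N)$ for each $E\in\{G,E_{\mathrm R},R_{\mathrm L}\}$. -/

import Mathlib

open Filter Topology
open scoped Nat ComplexOrder

/-! `N`-partite states whose parties all have single-particle Hilbert space `ℂ^α` are represented
by matrices indexed by the computational basis `Fin N → α` of `(ℂ^α)^{⊗N}`. -/

namespace MultipartiteEntanglement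

/-- A density matrix: positive semidefinite with unit trace. -/
def IsDensityMatrix {n : Type*} [Fintype n] (ρ : Matrix n n ℂ) : Prop :=
  ρ.PosSemidef ∧ ρ.trace = 1

/-- The rank-one operator `|ψ⟩⟨ψ|`. -/
def ketBra {n : Type*} (ψ : n → ℂ) : Matrix n n ℂ :=
  Matrix.vecMulVec ψ (star ψ)

/-- The tensor product `τ₁ ⊗ ⋯ ⊗ τ_N` of single-particle operators. -/
def productOperator {N : ℕ} {α : Type*} (τ : Fin N → Matrix α α ℂ) :
    Matrix (Fin N → α) (Fin N → α) ℂ :=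
  Matrix.of fun x y => ∏ j, τ j (x j) (y j)

/-- The set of fully separable `N`-partite states: convex mixtures of tensor products of
single-particle states. -/
def separableStates (N : ℕ) (α : Type*) [Fintype α] : Set (Matrix (Fin N → α) (Fin N → α) ℂ) :=
  convexHull ℝ {σ | ∃ τ : Fin N → Matrix α α ℂ,
    (∀ j, IsDensityMatrix (τ j)) ∧ σ = productOperator τ}

open Classical in
/-- Quantum relative entropy `S(ρ‖σ) = tr ρ (log ρ - log σ)` with base-2 logarithm, equal to `+∞`
unless the support of `ρ` is contained in that of `σ` (i.e. `ker σ ⊆ ker ρ`). The convention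
`Real.logb 2 0 = 0` implements `0 log 0 = 0`. -/
noncomputable def relativeEntropy {n : Type*} [Fintype n] [DecidableEq n] (ρ σ : Matrix n n ℂ) :
    EReal :=
  if ∀ v : n → ℂ, σ.mulVec v = 0 → ρ.mulVec v = 0 then
    (((ρ * (cfc (Real.logb 2) ρ - cfc (Real.logb 2) σ)).trace.re : ℝ) : EReal)
  else ⊤

/-- Relative entropy of entanglement (REE). -/
noncomputable def relEntropyEntanglement {N : ℕ} {α : Type*} [Fintype α] [DecidableEq α]
    (ρ : Matrix (Fin N → α) (Fin N → α) ℂ) : EReal :=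
  ⨅ σ ∈ separableStates N α, relativeEntropy ρ σ

/-- The maximal overlap `Λ²(ρ) = max_{σ ∈ SEP} tr(ρσ)`. -/
noncomputable def maxOverlapSq {N : ℕ} {α : Type*} [Fintype α]
    (ρ : Matrix (Fin N → α) (Fin N → α) ℂ) : ℝ :=
  sSup ((fun σ => (ρ * σ).trace.re) '' separableStates N α)

/-- Geometric measure of entanglement (GM), `G(ρ) = -2 log Λ(ρ)`. -/
noncomputable def geometricMeasure {N : ℕ} {α : Type*} [Fintype α]
    (ρ : Matrix (Fin N → α) (Fin N → α) ℂ) : ℝ :=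
  -2 * Real.logb 2 (Real.sqrt (maxOverlapSq ρ))

/-- Global robustness of entanglement. -/
noncomputable def globalRobustness {N : ℕ} {α : Type*} [Fintype α]
    (ρ : Matrix (Fin N → α) (Fin N → α) ℂ) : ℝ :=
  sInf {t : ℝ | 0 ≤ t ∧ ∃ Δ : Matrix (Fin N → α) (Fin N → α) ℂ,
    IsDensityMatrix Δ ∧ (1 + t)⁻¹ • (ρ + t • Δ) ∈ separableStates N α}

/-- Logarithmic global robustness of entanglement (LGR). -/
noncomputable def logGlobalRobustness {N : ℕ} {α : Type*} [Fintype α]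
    (ρ : Matrix (Fin N → α) (Fin N → α) ℂ) : ℝ :=
  Real.logb 2 (1 + globalRobustness ρ)

/-- The `n`-copy state `ρ^{⊗n}`, regarded as an `N`-partite state whose `j`-th party holds the
`j`-th particle of every copy. -/
def tensorPower {N : ℕ} {α : Type*} (ρ : Matrix (Fin N → α) (Fin N → α) ℂ) (n : ℕ) :
    Matrix (Fin N → (Fin n → α)) (Fin N → (Fin n → α)) ℂ :=
  Matrix.of fun x y => ∏ k, ρ (fun j => x j k) (fun j => y j k)

/-- The entanglement measure `E` of the state `ρ` is non-additive: the regularized measure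
`E^∞(ρ) = lim E(ρ^{⊗n}) / n` exists as a (finite) real number and differs from `E(ρ)`. -/
def IsNonadditive {N : ℕ}
    (E : ∀ (α : Type) [Fintype α] [DecidableEq α], Matrix (Fin N → α) (Fin N → α) ℂ → EReal)
    {α : Type} [Fintype α] [DecidableEq α] (ρ : Matrix (Fin N → α) (Fin N → α) ℂ) : Prop :=
  ∃ l : ℝ, Tendsto (fun n : ℕ => E (Fin n → α) (tensorPower ρ n) / (n : EReal)) atTop
    (𝓝 (l : EReal)) ∧ (l : EReal) ≠ E α ρ

/-- The wedge product
`|a₁⟩ ∧ ⋯ ∧ |a_N⟩ = (N!)^{-1/2} ∑_π sgn(π) |a_{π(1)}, …, a_{π(N)}⟩`; it is a Slater determinant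
state when `a₁, …, a_N` are orthonormal. -/
noncomputable def slaterKet {N : ℕ} {α : Type*} (a : Fin N → EuclideanSpace ℂ α) :
    (Fin N → α) → ℂ :=
  fun x => ((Real.sqrt (N ! : ℝ) : ℝ) : ℂ)⁻¹ *
    ∑ π : Equiv.Perm (Fin N), ((Equiv.Perm.sign π : ℤ) : ℂ) * ∏ j, a (π j) (x j)

end MultipartiteEntanglement

open MultipartiteEntanglement


/-! Let `P` be the projection onto the antisymmetric subspace of `(ℂ^d)^{⊗N}`; every mixture `ρ` of
Slater determinants satisfies `P ρ = ρ`.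

*Lower bounds on REE.* Concavity of the logarithm gives `S(ρ‖σ) ≥ -log tr(σP)`, so it suffices to
bound the overlap of `P`, resp. `P ⊗ P`, with product states. Up to the factor `N!`, resp. `(N!)²`,
that overlap is the squared norm of the vector obtained from the fermionic vacuum by applying `N`
creation operators, resp. `N` operators creating a pair of fermions of two different species, each
in a normalised state. A creation operator is a contraction; a pair creation operator acting on
states with `k` pairs has squared norm at most `(k + 1)(d - k) / d`.

*Upper bounds on LGR.* A Slater determinant is, up to a scalar, the average over signed
permutations of product states, and a product of two Slater determinants is the average over
permutations and signs of products of maximally entangled pairs. An average of kets is dominated by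
the average of their projections, which yields `ρ ≤ N! σ` and `ρ ⊗ ρ ≤ N^N σ` with `σ` separable.

*Geometric measure.* The projection `P ⊗ P` maps the product of `N` copies of the maximally
entangled pair `N^{-1/2} ∑ᵢ bᵢ ⊗ bᵢ` to `N^{-N/2}` times the doubled Slater determinant of `b`,
hence `(N! Λ²(ρ))² ≤ N^N Λ²(ρ ⊗ ρ)`.

As `N^N < (N!)²` for `N ≥ 3`, each measure of two copies is strictly smaller than twice that of
one copy. All three measures are subadditive, so Fekete's lemma provides the regularised limit and
bounds it by half the two-copy value. -/
namespace MultipartiteEntanglement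

open scoped Matrix Kronecker InnerProductSpace

section AnticommutationRelations

variable {R : Type*} [Ring R] [StarRing R] {ι κ : Type*}

/-- The canonical anticommutation relations for annihilation operators `c i`; the creation operators
are the elements `star (c i)`. -/
structure IsCAR [DecidableEq ι] (c : ι → R) : Prop where
  mul_add_mul : ∀ i j, c i * c j + c j * c i = 0
  mul_star_add_star_mul : ∀ i j, c i * star (c j) + star (c j) * c i = if i = j then 1 else 0

/-- Two species of fermions. Operators of different species are taken to commute rather than to
anticommute, which avoids signs. -/
structure IsCommutingCAR [DecidableEq ι] [DecidableEq κ] (c : ι → R) (d : κ → R) : Prop where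
  left : IsCAR c
  right : IsCAR d
  comm : ∀ i j, Commute (c i) (d j)
  comm_star : ∀ i j, Commute (c i) (star (d j))

lemma IsCommutingCAR.symm [DecidableEq ι] [DecidableEq κ] {c : ι → R} {d : κ → R}
    (h : IsCommutingCAR c d) : IsCommutingCAR d c where
  left := h.right
  right := h.left
  comm i j := (h.comm j i).symm
  comm_star i j := by simpa using (h.comm_star j i).star_star.symm

lemma IsCAR.map [DecidableEq ι] {S F : Type*} [Ring S] [StarRing S] [FunLike F R S]
    [RingHomClass F R S] [StarHomClass F R S] {c : ι → R} (h : IsCAR c) (f : F) :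
    IsCAR fun i => f (c i) where
  mul_add_mul i j := by rw [← map_mul, ← map_mul, ← map_add, h.mul_add_mul, map_zero]
  mul_star_add_star_mul i j := by
    rw [← map_star, ← map_mul, ← map_mul, ← map_add, h.mul_star_add_star_mul]
    split_ifs <;> simp

lemma IsCAR.comp_injective [DecidableEq ι] [DecidableEq κ] {c : ι → R} (h : IsCAR c) {f : κ → ι}
    (hf : Function.Injective f) : IsCAR fun i => c (f i) where
  mul_add_mul i j := h.mul_add_mul _ _
  mul_star_add_star_mul i j := by simp [h.mul_star_add_star_mul, hf.eq_iff]

/-- The Jordan–Wigner step: `Fin (n + 1)` fermionic modes act on two copies of the space of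
`Fin n` modes. -/
def jordanWignerStep {m : Type*} [DecidableEq m] {n : ℕ} (c : Fin n → Matrix m m ℂ) :
    Fin (n + 1) → Matrix (m ⊕ m) (m ⊕ m) ℂ :=
  Fin.cons (Matrix.fromBlocks 0 1 0 0) fun i => Matrix.fromBlocks (c i) 0 0 (-c i)

lemma IsCAR.jordanWignerStep {m : Type*} [Fintype m] [DecidableEq m] {n : ℕ}
    {c : Fin n → Matrix m m ℂ} (h : IsCAR c) : IsCAR (jordanWignerStep c) where
  mul_add_mul i j := by
    refine Fin.cases ?_ (fun i => ?_) i <;> refine Fin.cases ?_ (fun j => ?_) j <;>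
      simp [MultipartiteEntanglement.jordanWignerStep, Matrix.fromBlocks_multiply,
        Matrix.fromBlocks_add, h.mul_add_mul]
  mul_star_add_star_mul i j := by
    have h' := h.mul_star_add_star_mul
    simp only [Matrix.star_eq_conjTranspose] at h' ⊢
    refine Fin.cases ?_ (fun i => ?_) i <;> refine Fin.cases ?_ (fun j => ?_) j
    · simp [MultipartiteEntanglement.jordanWignerStep, Matrix.fromBlocks_multiply,
        Matrix.fromBlocks_add, Matrix.fromBlocks_conjTranspose]
    · simp [MultipartiteEntanglement.jordanWignerStep, Matrix.fromBlocks_multiply,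
        Matrix.fromBlocks_add, Matrix.fromBlocks_conjTranspose, (Fin.succ_ne_zero j).symm]
    · simp [MultipartiteEntanglement.jordanWignerStep, Matrix.fromBlocks_multiply,
        Matrix.fromBlocks_add, Matrix.fromBlocks_conjTranspose]
    · simp only [MultipartiteEntanglement.jordanWignerStep, Fin.cons_succ,
        Matrix.fromBlocks_conjTranspose, Matrix.fromBlocks_multiply, Matrix.fromBlocks_add]
      by_cases hij : i = j <;> simp [h', hij]

lemma exists_isCAR_matrix (n : ℕ) :
    ∃ (m : Type) (_ : Fintype m) (_ : DecidableEq m) (c : Fin n → Matrix m m ℂ) (s : m),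
      IsCAR c ∧ ∀ i t, c i t s = 0 := by
  induction n with
  | zero => exact ⟨Unit, _, inferInstance, Fin.elim0, (), ⟨Fin.rec0, Fin.rec0⟩, Fin.rec0⟩
  | succ n ih =>
    obtain ⟨m, _, _, c, s, hc, hs⟩ := ih
    refine ⟨m ⊕ m, _, inferInstance, jordanWignerStep c, Sum.inl s, hc.jordanWignerStep,
      fun i t => ?_⟩
    refine Fin.cases ?_ (fun i => ?_) i <;> cases t <;> simp [jordanWignerStep, hs]

lemma IsCAR.isCommutingCAR_kronecker [DecidableEq ι] {m : Type*} [Fintype m] [DecidableEq m]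
    {c : ι → Matrix m m ℂ} (h : IsCAR c) :
    IsCommutingCAR (fun i => c i ⊗ₖ (1 : Matrix m m ℂ)) (fun i => (1 : Matrix m m ℂ) ⊗ₖ c i) where
  left.mul_add_mul i j := by
    rw [← Matrix.mul_kronecker_mul, ← Matrix.mul_kronecker_mul, ← Matrix.add_kronecker,
      h.mul_add_mul, Matrix.zero_kronecker]
  left.mul_star_add_star_mul i j := by
    have := h.mul_star_add_star_mul i j
    simp only [Matrix.star_eq_conjTranspose, Matrix.conjTranspose_kronecker,
      Matrix.conjTranspose_one] at this ⊢
    rw [← Matrix.mul_kronecker_mul, ← Matrix.mul_kronecker_mul, mul_one, ← Matrix.add_kronecker,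
      this]
    split_ifs <;> simp
  right.mul_add_mul i j := by
    rw [← Matrix.mul_kronecker_mul, ← Matrix.mul_kronecker_mul, ← Matrix.kronecker_add,
      h.mul_add_mul, Matrix.kronecker_zero]
  right.mul_star_add_star_mul i j := by
    have := h.mul_star_add_star_mul i j
    simp only [Matrix.star_eq_conjTranspose, Matrix.conjTranspose_kronecker,
      Matrix.conjTranspose_one] at this ⊢
    rw [← Matrix.mul_kronecker_mul, ← Matrix.mul_kronecker_mul, mul_one, ← Matrix.kronecker_add,
      this]
    split_ifs <;> simp
  comm i j := by
    rw [Commute, SemiconjBy, ← Matrix.mul_kronecker_mul, ← Matrix.mul_kronecker_mul]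
    simp
  comm_star i j := by
    rw [Matrix.star_eq_conjTranspose, Matrix.conjTranspose_kronecker, Commute, SemiconjBy,
      ← Matrix.mul_kronecker_mul, ← Matrix.mul_kronecker_mul]
    simp

lemma IsCommutingCAR.map [DecidableEq ι] [DecidableEq κ] {S F : Type*} [Ring S] [StarRing S]
    [FunLike F R S] [RingHomClass F R S] [StarHomClass F R S] {c : ι → R} {d : κ → R}
    (h : IsCommutingCAR c d) (f : F) : IsCommutingCAR (fun i => f (c i)) (fun j => f (d j)) where
  left := h.left.map f
  right := h.right.map f
  comm i j := (h.comm i j).map f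
  comm_star i j := by simpa only [map_star] using (h.comm_star i j).map f

end AnticommutationRelations

section Vacuum

variable {E : Type*} [NormedAddCommGroup E] [NormedSpace ℂ E] {ι : Type*}

/-- A unit vector annihilated by all `c i`. -/
structure IsVacuum (c : ι → E →L[ℂ] E) (Ω : E) : Prop where
  norm_eq_one : ‖Ω‖ = 1
  apply_eq_zero : ∀ i, c i Ω = 0

lemma exists_isCommutingCAR (ι : Type*) [Finite ι] [DecidableEq ι] :
    ∃ (m : Type) (_ : Fintype m) (c d : ι → EuclideanSpace ℂ m →L[ℂ] EuclideanSpace ℂ m)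
      (Ω : EuclideanSpace ℂ m), IsCommutingCAR c d ∧ IsVacuum c Ω ∧ IsVacuum d Ω := by
  obtain ⟨m, _, _, c, s, hc, hs⟩ := exists_isCAR_matrix (Nat.card ι)
  have hcd := (hc.comp_injective (Finite.equivFin ι).injective).isCommutingCAR_kronecker
  refine ⟨m × m, inferInstance, _, _, EuclideanSpace.single (s, s) 1,
    hcd.map (Matrix.toEuclideanCLM (n := m × m) (𝕜 := ℂ)), ⟨by simp, fun i => ?_⟩,
    ⟨by simp, fun i => ?_⟩⟩ <;>
  · ext t
    simp [Matrix.ofLp_toEuclideanCLM, hs]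

end Vacuum

section CreationOperators

variable {E : Type*} [NormedAddCommGroup E] [InnerProductSpace ℂ E] [CompleteSpace E]
variable {ι κ : Type*} [Fintype ι]

lemma inner_star_apply_left (T : E →L[ℂ] E) (χ ψ : E) : ⟪star T χ, ψ⟫_ℂ = ⟪χ, T ψ⟫_ℂ :=
  T.adjoint_inner_left ψ χ

lemma inner_star_apply_right (T : E →L[ℂ] E) (χ ψ : E) : ⟪χ, star T ψ⟫_ℂ = ⟪T χ, ψ⟫_ℂ :=
  T.adjoint_inner_right χ ψ

lemma re_inner_star_mul_apply (T : E →L[ℂ] E) (ψ : E) :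
    RCLike.re ⟪ψ, (star T * T) ψ⟫_ℂ = ‖T ψ‖ ^ 2 := by
  rw [mul_apply_eq_comp, inner_star_apply_right, inner_self_eq_norm_sq]

/-- The operator creating a fermion with wave function `v`. Its adjoint, which annihilates such a
fermion, is conjugate linear in `v`. -/
noncomputable def creation (c : ι → E →L[ℂ] E) (v : ι → ℂ) : E →L[ℂ] E :=
  ∑ i, v i • star (c i)

lemma star_creation (c : ι → E →L[ℂ] E) (v : ι → ℂ) :
    star (creation c v) = ∑ i, star (v i) • c i := by
  simp [creation, star_sum, star_smul]

/-- The number operator of a family of fermions. -/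
noncomputable def numberOperator (c : ι → E →L[ℂ] E) : E →L[ℂ] E :=
  ∑ i, star (c i) * c i

section

variable {c : ι → E →L[ℂ] E} [DecidableEq ι]

lemma IsCAR.mul_creation (hc : IsCAR c) (i : ι) (v : ι → ℂ) :
    c i * creation c v = v i • 1 - creation c v * c i := by
  rw [eq_sub_iff_add_eq, creation, Finset.mul_sum, Finset.sum_mul, ← Finset.sum_add_distrib]
  simp [← smul_add, hc.mul_star_add_star_mul]

lemma IsCAR.star_creation_mul_creation (hc : IsCAR c) (v w : ι → ℂ) :
    star (creation c v) * creation c w =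
      (∑ i, star (v i) * w i) • 1 - creation c w * star (creation c v) := by
  simp only [star_creation, Finset.sum_mul, Finset.mul_sum, smul_mul_assoc, mul_smul_comm,
    hc.mul_creation, smul_sub, smul_smul, Finset.sum_sub_distrib, Finset.sum_smul]

lemma IsCAR.norm_creation_apply_sq (hc : IsCAR c) (v : ι → ℂ) (ψ : E) :
    ‖creation c v ψ‖ ^ 2 = (∑ i, ‖v i‖ ^ 2) * ‖ψ‖ ^ 2 - ‖star (creation c v) ψ‖ ^ 2 := by
  rw [← re_inner_star_mul_apply, ← re_inner_star_mul_apply (star _), star_star,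
    hc.star_creation_mul_creation]
  have hv : ∑ i, star (v i) * v i = ((∑ i, ‖v i‖ ^ 2 : ℝ) : ℂ) := by
    simp [Complex.conj_mul']
  rw [hv, sub_apply, inner_sub_right, map_sub, smul_apply,
    inner_smul_right, one_apply_eq_self, inner_self_eq_norm_sq_to_K]
  simp [← Complex.ofReal_pow]

lemma IsCAR.norm_creation_apply_le (hc : IsCAR c) {v : ι → ℂ} (hv : ∑ i, ‖v i‖ ^ 2 = 1) (ψ : E) :
    ‖creation c v ψ‖ ≤ ‖ψ‖ := by
  refine le_of_sq_le_sq ?_ (norm_nonneg ψ)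
  rw [hc.norm_creation_apply_sq, hv, one_mul]
  exact sub_le_self _ (sq_nonneg _)

lemma IsCAR.sum_norm_star_apply_sq (hc : IsCAR c) (ψ : E) :
    ∑ i, ‖star (c i) ψ‖ ^ 2 = Fintype.card ι * ‖ψ‖ ^ 2 - ∑ i, ‖c i ψ‖ ^ 2 := by
  have h i : ‖star (c i) ψ‖ ^ 2 = ‖ψ‖ ^ 2 - ‖c i ψ‖ ^ 2 := by
    have hi := hc.norm_creation_apply_sq (Pi.single i 1) ψ
    simpa [creation, Pi.single_apply, ite_smul, apply_ite norm, ite_pow] using hi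
  simp [h]

lemma IsCAR.numberOperator_mul_creation (hc : IsCAR c) (v : ι → ℂ) :
    numberOperator c * creation c v = creation c v * (numberOperator c + 1) := by
  have anticomm i : star (c i) * creation c v = -(creation c v * star (c i)) := by
    rw [eq_neg_iff_add_eq_zero, creation, Finset.mul_sum, Finset.sum_mul, ← Finset.sum_add_distrib]
    refine Finset.sum_eq_zero fun j _ => ?_
    have hij := congrArg star (hc.mul_add_mul j i)
    rw [star_add, star_mul, star_mul, star_zero] at hij
    rw [mul_smul_comm, smul_mul_assoc, ← smul_add, hij, smul_zero]
  calc numberOperator c * creation c v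
      = ∑ i, (v i • star (c i) + creation c v * (star (c i) * c i)) := by
        rw [numberOperator, Finset.sum_mul]
        refine Finset.sum_congr rfl fun i _ => ?_
        rw [mul_assoc, hc.mul_creation, mul_sub, mul_smul_comm, mul_one, ← mul_assoc, anticomm,
          neg_mul, sub_neg_eq_add, mul_assoc]
    _ = creation c v * (numberOperator c + 1) := by
        rw [Finset.sum_add_distrib, ← Finset.mul_sum, mul_add, mul_one, add_comm]
        rfl

end

lemma isSelfAdjoint_numberOperator (c : ι → E →L[ℂ] E) : IsSelfAdjoint (numberOperator c) :=
  isSelfAdjoint_sum _ fun i _ => IsSelfAdjoint.star_mul_self (c i)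

/-- The vectors with exactly `k` fermions. -/
def HasParticleNumber (c : ι → E →L[ℂ] E) (k : ℕ) (ψ : E) : Prop :=
  numberOperator c ψ = (k : ℂ) • ψ

namespace HasParticleNumber

variable {c : ι → E →L[ℂ] E} {k : ℕ} {ψ : E}

lemma sum_norm_apply_sq (h : HasParticleNumber c k ψ) : ∑ i, ‖c i ψ‖ ^ 2 = k * ‖ψ‖ ^ 2 := by
  have := congrArg (fun χ => RCLike.re ⟪ψ, χ⟫_ℂ) h
  simpa [numberOperator, inner_sum, inner_star_apply_right, inner_self_eq_norm_sq_to_K,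
    inner_smul_right, ← Complex.ofReal_pow] using this

lemma apply_eq_zero (h : HasParticleNumber c 0 ψ) (i : ι) : c i ψ = 0 := by
  have := h.sum_norm_apply_sq
  rw [Nat.cast_zero, zero_mul, Finset.sum_eq_zero_iff_of_nonneg fun _ _ => sq_nonneg _] at this
  simpa using this i (Finset.mem_univ i)

lemma creation_apply [DecidableEq ι] (h : HasParticleNumber c k ψ) (hc : IsCAR c) (v : ι → ℂ) :
    HasParticleNumber c (k + 1) (creation c v ψ) := by
  rw [HasParticleNumber, ← mul_apply_eq_comp, hc.numberOperator_mul_creation,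
    mul_apply_eq_comp, add_apply, h,
    one_apply_eq_self, map_add, map_smul, Nat.cast_succ, add_smul, one_smul]

lemma star_creation_apply [DecidableEq ι] (h : HasParticleNumber c (k + 1) ψ) (hc : IsCAR c)
    (v : ι → ℂ) : HasParticleNumber c k (star (creation c v) ψ) := by
  have hN := congrArg star (hc.numberOperator_mul_creation v)
  rw [star_mul, star_mul, star_add, star_one, (isSelfAdjoint_numberOperator c).star_eq] at hN
  have := congrArg (fun T : E →L[ℂ] E => T ψ) hN
  simp only [mul_apply_eq_comp, add_apply, one_apply_eq_self] at this
  rw [h, map_smul, Nat.cast_succ, add_smul, one_smul] at this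
  exact (add_right_cancel this).symm

lemma of_commute {T : E →L[ℂ] E} (h : HasParticleNumber c k ψ) (hT : ∀ i, Commute (c i) T)
    (hT' : ∀ i, Commute (star (c i)) T) : HasParticleNumber c k (T ψ) := by
  have hNT : Commute (numberOperator c) T :=
    Commute.sum_left _ _ _ fun i _ => (hT' i).mul_left (hT i)
  rw [HasParticleNumber, ← mul_apply_eq_comp, hNT.eq, mul_apply_eq_comp, h, map_smul]

lemma sum {s : Finset κ} {χ : κ → E} (h : ∀ i ∈ s, HasParticleNumber c k (χ i)) :
    HasParticleNumber c k (∑ i ∈ s, χ i) := by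
  rw [HasParticleNumber, map_sum, Finset.smul_sum]
  exact Finset.sum_congr rfl h

end HasParticleNumber

lemma IsVacuum.hasParticleNumber {c : ι → E →L[ℂ] E} {Ω : E} (h : IsVacuum c Ω) :
    HasParticleNumber c 0 Ω := by
  simp [HasParticleNumber, numberOperator, h.apply_eq_zero]

/-- Duality: if `u = ∑ c i (χ i)` then `‖u‖² = ∑ ⟪(c i)† u, χ i⟫`, while filling one of the `d - k`
empty modes gives `∑ ‖(c i)† u‖² = (d - k) ‖u‖²`. -/
lemma IsCAR.norm_sum_apply_sq_le [DecidableEq ι] {c : ι → E →L[ℂ] E} (hc : IsCAR c) {k : ℕ}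
    (hk : k ≤ Fintype.card ι) (χ : ι → E) (h : HasParticleNumber c k (∑ i, c i (χ i))) :
    ‖∑ i, c i (χ i)‖ ^ 2 ≤ (Fintype.card ι - k : ℝ) * ∑ i, ‖χ i‖ ^ 2 := by
  set u := ∑ i, c i (χ i) with hu
  have hfill : ∑ i, ‖star (c i) u‖ ^ 2 = (Fintype.card ι - k : ℝ) * ‖u‖ ^ 2 := by
    rw [hc.sum_norm_star_apply_sq, h.sum_norm_apply_sq, sub_mul]
  have hdual : ‖u‖ ^ 2 ≤ ∑ i, ‖star (c i) u‖ * ‖χ i‖ :=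
    calc ‖u‖ ^ 2 = RCLike.re ⟪u, ∑ i, c i (χ i)⟫_ℂ := by rw [← hu, inner_self_eq_norm_sq]
      _ = ∑ i, RCLike.re ⟪star (c i) u, χ i⟫_ℂ := by
          simp only [inner_sum, map_sum, inner_star_apply_left]
      _ ≤ _ := Finset.sum_le_sum fun i _ => re_inner_le_norm _ _
  have hcs : ‖u‖ ^ 2 * ‖u‖ ^ 2 ≤ ‖u‖ ^ 2 * ((Fintype.card ι - k : ℝ) * ∑ i, ‖χ i‖ ^ 2) :=
    calc ‖u‖ ^ 2 * ‖u‖ ^ 2 ≤ (∑ i, ‖star (c i) u‖ * ‖χ i‖) ^ 2 := by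
          rw [sq (Finset.sum _ _)]
          gcongr
      _ ≤ (∑ i, ‖star (c i) u‖ ^ 2) * ∑ i, ‖χ i‖ ^ 2 := Finset.sum_mul_sq_le_sq_mul_sq _ _ _
      _ = _ := by rw [hfill]; ring
  have hcard : (0 : ℝ) ≤ Fintype.card ι - k := sub_nonneg.mpr (by exact_mod_cast hk)
  rcases eq_or_ne u 0 with h0 | h0
  · rw [h0, norm_zero, zero_pow two_ne_zero]
    positivity
  · exact le_of_mul_le_mul_left hcs (by positivity)

end CreationOperators

section PairCreation

variable {E : Type*} [NormedAddCommGroup E] [InnerProductSpace ℂ E] [CompleteSpace E]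
variable {ι κ : Type*} [Fintype κ]

section

variable [Fintype ι]

/-- The operator creating a pair of fermions, one of each species, with joint wave function `A`. -/
noncomputable def pairCreation (c : ι → E →L[ℂ] E) (d : κ → E →L[ℂ] E) (A : ι → κ → ℂ) :
    E →L[ℂ] E :=
  ∑ i, star (c i) * creation d (A i)

lemma star_pairCreation (c : ι → E →L[ℂ] E) (d : κ → E →L[ℂ] E) (A : ι → κ → ℂ) :
    star (pairCreation c d A) = ∑ i, star (creation d (A i)) * c i := by
  simp [pairCreation, star_sum, star_mul]

lemma sum_star_mul_creation_swap (c : ι → E →L[ℂ] E) (A : ι → κ → ℂ) :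
    ∑ i, (∑ j, star (A i j) • creation c (Function.swap A j)) * c i =
      ∑ j, creation c (Function.swap A j) * star (creation c (Function.swap A j)) := by
  simp only [star_creation, Finset.sum_mul, Finset.mul_sum, smul_mul_assoc, mul_smul_comm,
    Function.swap]
  exact Finset.sum_comm

end

variable [DecidableEq ι] [DecidableEq κ] {c : ι → E →L[ℂ] E} {d : κ → E →L[ℂ] E}

lemma IsCommutingCAR.commute_creation (h : IsCommutingCAR c d) (i : ι) (v : κ → ℂ) :
    Commute (c i) (creation d v) :=
  Commute.sum_right _ _ _ fun j _ => (h.comm_star i j).smul_right _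

lemma IsCommutingCAR.commute_star_creation (h : IsCommutingCAR c d) (i : ι) (v : κ → ℂ) :
    Commute (c i) (star (creation d v)) := by
  rw [star_creation]
  exact Commute.sum_right _ _ _ fun j _ => (h.comm i j).smul_right _

variable [Fintype ι]

namespace IsCommutingCAR

lemma pairCreation_swap (h : IsCommutingCAR c d) (A : ι → κ → ℂ) :
    pairCreation d c (Function.swap A) = pairCreation c d A := by
  simp only [pairCreation, creation, Finset.mul_sum, mul_smul_comm, Function.swap]
  rw [Finset.sum_comm]
  simp only [(h.symm.comm _ _).star_star.eq]

lemma mul_pairCreation (h : IsCommutingCAR c d) (A : ι → κ → ℂ) (i : ι) :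
    c i * pairCreation c d A = creation d (A i) - pairCreation c d A * c i := by
  rw [eq_sub_iff_add_eq, pairCreation, Finset.mul_sum, Finset.sum_mul, ← Finset.sum_add_distrib]
  have hl l : c i * (star (c l) * creation d (A l)) + star (c l) * creation d (A l) * c i =
      (if i = l then 1 else 0) * creation d (A l) := by
    rw [mul_assoc (star (c l)), ← (h.commute_creation i _).eq, ← mul_assoc, ← mul_assoc, ← add_mul,
      h.left.mul_star_add_star_mul]
  simp [hl]

lemma star_creation_mul_pairCreation (h : IsCommutingCAR c d) (A : ι → κ → ℂ) (v : ι → ℂ) :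
    star (creation c v) * pairCreation c d A =
      ∑ i, star (v i) • creation d (A i) - pairCreation c d A * star (creation c v) := by
  simp only [star_creation, Finset.sum_mul, Finset.mul_sum, smul_mul_assoc, mul_smul_comm,
    h.mul_pairCreation, smul_sub, Finset.sum_sub_distrib]

lemma star_pairCreation_mul_pairCreation (h : IsCommutingCAR c d) (A : ι → κ → ℂ) :
    star (pairCreation c d A) * pairCreation c d A =
      pairCreation c d A * star (pairCreation c d A) + (∑ i, ∑ j, star (A i j) * A i j) • 1
        - ∑ i, creation d (A i) * star (creation d (A i))
        - ∑ j, creation c (Function.swap A j) * star (creation c (Function.swap A j)) := by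
  have hi i : star (creation d (A i)) * c i * pairCreation c d A =
      (∑ j, star (A i j) * A i j) • 1 - creation d (A i) * star (creation d (A i))
        - (∑ j, star (A i j) • creation c (Function.swap A j)) * c i
        + pairCreation c d A * (star (creation d (A i)) * c i) := by
    have hB := h.symm.star_creation_mul_pairCreation (Function.swap A) (A i)
    rw [h.pairCreation_swap] at hB
    rw [mul_assoc, h.mul_pairCreation, mul_sub, h.right.star_creation_mul_creation, ← mul_assoc,
      hB, sub_mul, mul_assoc]
    abel
  rw [star_pairCreation, Finset.sum_mul, Finset.sum_congr rfl fun i _ => hi i,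
    Finset.sum_add_distrib, Finset.sum_sub_distrib, Finset.sum_sub_distrib, ← Finset.mul_sum,
    ← Finset.sum_smul, sum_star_mul_creation_swap]
  abel

lemma norm_pairCreation_apply_sq (h : IsCommutingCAR c d) (A : ι → κ → ℂ) (ψ : E) :
    ‖pairCreation c d A ψ‖ ^ 2 =
      ‖star (pairCreation c d A) ψ‖ ^ 2 + (∑ i, ∑ j, ‖A i j‖ ^ 2) * ‖ψ‖ ^ 2
        - ∑ i, ‖star (creation d (A i)) ψ‖ ^ 2
        - ∑ j, ‖star (creation c (Function.swap A j)) ψ‖ ^ 2 := by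
  have hre (T : E →L[ℂ] E) : RCLike.re ⟪ψ, (T * star T) ψ⟫_ℂ = ‖star T ψ‖ ^ 2 := by
    simpa only [star_star] using re_inner_star_mul_apply (star T) ψ
  have hA : ∑ i, ∑ j, star (A i j) * A i j = ((∑ i, ∑ j, ‖A i j‖ ^ 2 : ℝ) : ℂ) := by
    simp [Complex.conj_mul']
  rw [← re_inner_star_mul_apply, h.star_pairCreation_mul_pairCreation, hA]
  simp only [sub_apply, add_apply, sum_apply, inner_sub_right, inner_add_right,
    inner_sum, map_sub, map_add, map_sum, hre, smul_apply, one_apply_eq_self, inner_smul_right,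
    inner_self_eq_norm_sq_to_K]
  simp [← Complex.ofReal_pow]

lemma star_pairCreation_apply (h : IsCommutingCAR c d) (A : ι → κ → ℂ) (ψ : E) :
    star (pairCreation c d A) ψ = ∑ i, c i (star (creation d (A i)) ψ) := by
  simp only [star_pairCreation, ← (h.commute_star_creation _ _).eq, sum_apply,
    mul_apply_eq_comp]

end IsCommutingCAR

namespace HasParticleNumber

variable {k : ℕ} {ψ : E}

lemma pairCreation_apply (hψ : HasParticleNumber c k ψ) (h : IsCommutingCAR c d)
    (A : ι → κ → ℂ) : HasParticleNumber c (k + 1) (pairCreation c d A ψ) := by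
  rw [← h.pairCreation_swap, pairCreation, sum_apply]
  refine sum fun j _ => ?_
  rw [mul_apply_eq_comp]
  exact (hψ.creation_apply h.left _).of_commute (fun i => h.comm_star i j)
    fun i => (h.comm i j).star_star

lemma star_pairCreation_apply (hψ : HasParticleNumber c (k + 1) ψ) (h : IsCommutingCAR c d)
    (A : ι → κ → ℂ) : HasParticleNumber c k (star (pairCreation c d A) ψ) := by
  rw [← h.pairCreation_swap, star_pairCreation, sum_apply]
  refine sum fun j _ => ?_
  rw [mul_apply_eq_comp, ← mul_apply_eq_comp, ← (h.symm.commute_star_creation j _).eq,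
    mul_apply_eq_comp]
  exact (hψ.star_creation_apply h.left _).of_commute (fun i => h.comm i j)
    fun i => ((h.symm.comm_star j i).symm)

end HasParticleNumber

lemma IsCommutingCAR.norm_star_pairCreation_apply_sq_le (h : IsCommutingCAR c d) (A : ι → κ → ℂ)
    {k : ℕ} {ψ : E} (hk : k ≤ Fintype.card ι) (hψ : HasParticleNumber c (k + 1) ψ) :
    ‖star (pairCreation c d A) ψ‖ ^ 2 ≤
      (Fintype.card ι - k : ℝ) * ∑ i, ‖star (creation d (A i)) ψ‖ ^ 2 := by
  have hB := hψ.star_pairCreation_apply h A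
  rw [h.star_pairCreation_apply] at hB ⊢
  exact h.left.norm_sum_apply_sq_le hk _ hB

lemma IsCommutingCAR.norm_pairCreation_apply_sq_le (h : IsCommutingCAR c d) (A : ι → κ → ℂ)
    {ψ : E} (hψ : star (pairCreation c d A) ψ = 0) :
    ‖pairCreation c d A ψ‖ ^ 2 ≤ (∑ i, ∑ j, ‖A i j‖ ^ 2) * ‖ψ‖ ^ 2 := by
  have hE := Finset.sum_nonneg fun i (_ : i ∈ Finset.univ) =>
    sq_nonneg ‖star (creation d (A i)) ψ‖
  have hF := Finset.sum_nonneg fun j (_ : j ∈ Finset.univ) =>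
    sq_nonneg ‖star (creation c (Function.swap A j)) ψ‖
  rw [h.norm_pairCreation_apply_sq, hψ, norm_zero]
  linarith

end PairCreation

section PairCreationBound

variable {E : Type*} [NormedAddCommGroup E] [InnerProductSpace ℂ E] [CompleteSpace E]
variable {ι : Type*} [Fintype ι] [DecidableEq ι] {c d : ι → E →L[ℂ] E}

lemma mul_norm_star_apply_sq_le {T : E →L[ℂ] E} {ψ : E} {a b : ℝ} (ha : 0 ≤ a) (hb : 0 ≤ b)
    (h : a * ‖T (star T ψ)‖ ^ 2 ≤ b * ‖star T ψ‖ ^ 2) :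
    a * ‖star T ψ‖ ^ 2 ≤ b * ‖ψ‖ ^ 2 := by
  rcases eq_or_ne (star T ψ) 0 with h0 | h0
  · rw [h0, norm_zero, zero_pow two_ne_zero, mul_zero]
    positivity
  have hcs : ‖star T ψ‖ ^ 2 ≤ ‖T (star T ψ)‖ * ‖ψ‖ := by
    rw [← inner_self_eq_norm_sq (𝕜 := ℂ), inner_star_apply_right]
    exact re_inner_le_norm _ _
  have : ‖star T ψ‖ ^ 2 * (a * ‖star T ψ‖ ^ 2) ≤ ‖star T ψ‖ ^ 2 * (b * ‖ψ‖ ^ 2) :=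
    calc ‖star T ψ‖ ^ 2 * (a * ‖star T ψ‖ ^ 2)
        = a * (‖star T ψ‖ ^ 2) ^ 2 := by ring
      _ ≤ a * (‖T (star T ψ)‖ * ‖ψ‖) ^ 2 := by gcongr
      _ = a * ‖T (star T ψ)‖ ^ 2 * ‖ψ‖ ^ 2 := by ring
      _ ≤ b * ‖star T ψ‖ ^ 2 * ‖ψ‖ ^ 2 := by gcongr
      _ = ‖star T ψ‖ ^ 2 * (b * ‖ψ‖ ^ 2) := by ring
  exact le_of_mul_le_mul_left this (by positivity)

lemma IsCommutingCAR.sub_mul_norm_pairCreation_apply_sq_le (h : IsCommutingCAR c d)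
    (A : ι → ι → ℂ) {k : ℕ} {ψ : E} (hk : k ≤ Fintype.card ι)
    (hc : HasParticleNumber c (k + 1) ψ) (hd : HasParticleNumber d (k + 1) ψ) :
    (Fintype.card ι - k : ℝ) * ‖pairCreation c d A ψ‖ ^ 2 ≤
      (Fintype.card ι - k - 2) * ‖star (pairCreation c d A) ψ‖ ^ 2 +
        (Fintype.card ι - k) * ((∑ i, ∑ j, ‖A i j‖ ^ 2) * ‖ψ‖ ^ 2) := by
  have hE := h.norm_star_pairCreation_apply_sq_le A hk hc
  have hF := h.symm.norm_star_pairCreation_apply_sq_le (Function.swap A) hk hd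
  rw [h.pairCreation_swap] at hF
  rw [h.norm_pairCreation_apply_sq]
  linarith

lemma IsCommutingCAR.card_mul_norm_pairCreation_apply_sq_le (h : IsCommutingCAR c d)
    (A : ι → ι → ℂ) {k : ℕ} (hk : k < Fintype.card ι) {ψ : E} (hc : HasParticleNumber c k ψ)
    (hd : HasParticleNumber d k ψ) :
    Fintype.card ι * ‖pairCreation c d A ψ‖ ^ 2 ≤
      (k + 1) * (Fintype.card ι - k) * (∑ i, ∑ j, ‖A i j‖ ^ 2) * ‖ψ‖ ^ 2 := by
  induction k generalizing ψ with
  | zero =>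
    have hle := h.norm_pairCreation_apply_sq_le A (ψ := ψ) (by
      simp [star_pairCreation, hc.apply_eq_zero])
    calc (Fintype.card ι : ℝ) * ‖pairCreation c d A ψ‖ ^ 2
        ≤ Fintype.card ι * ((∑ i, ∑ j, ‖A i j‖ ^ 2) * ‖ψ‖ ^ 2) := by gcongr
      _ = _ := by push_cast; ring
  | succ k ih =>
    have hkD : (k : ℝ) + 2 ≤ Fintype.card ι := by exact_mod_cast hk
    set D := (Fintype.card ι : ℝ)
    set B := star (pairCreation c d A) with hB
    set S := ∑ i, ∑ j, ‖A i j‖ ^ 2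
    have hBψ : D * ‖B ψ‖ ^ 2 ≤ (k + 1) * (D - k) * S * ‖ψ‖ ^ 2 := by
      have hBd : HasParticleNumber d k (B ψ) := by
        rw [hB, ← h.pairCreation_swap]
        exact hd.star_pairCreation_apply h.symm _
      have hDk : 0 ≤ D - k := by linarith
      exact mul_norm_star_apply_sq_le (by positivity) (by positivity)
        (ih (by lia) (hc.star_pairCreation_apply h A) hBd)
    have hrec : (D - k) * ‖pairCreation c d A ψ‖ ^ 2 ≤
        (D - k - 2) * ‖B ψ‖ ^ 2 + (D - k) * (S * ‖ψ‖ ^ 2) :=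
      h.sub_mul_norm_pairCreation_apply_sq_le A (by lia) hc hd
    refine le_of_mul_le_mul_left ?_ (show 0 < D - k by linarith)
    calc (D - k) * (D * ‖pairCreation c d A ψ‖ ^ 2)
        = D * ((D - k) * ‖pairCreation c d A ψ‖ ^ 2) := by ring
      _ ≤ D * ((D - k - 2) * ‖B ψ‖ ^ 2 + (D - k) * (S * ‖ψ‖ ^ 2)) := by gcongr
      _ = (D - k - 2) * (D * ‖B ψ‖ ^ 2) + D * (D - k) * (S * ‖ψ‖ ^ 2) := by ring
      _ ≤ (D - k - 2) * ((k + 1) * (D - k) * S * ‖ψ‖ ^ 2) + D * (D - k) * (S * ‖ψ‖ ^ 2) := by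
          gcongr
          linarith
      _ = _ := by push_cast; ring

end PairCreationBound

section Products

variable {E : Type*} [NormedAddCommGroup E] [InnerProductSpace ℂ E] {N : ℕ}

lemma prod_ofFn_sum_smul {K R ι : Type*} [CommSemiring K] [Semiring R] [Algebra K R] [Fintype ι]
    (v : Fin N → ι → K) (b : ι → R) :
    (List.ofFn fun j => ∑ i, v j i • b i).prod =
      ∑ x : Fin N → ι, (∏ j, v j (x j)) • (List.ofFn (b ∘ x)).prod := by
  classical
  rw [← MultilinearMap.mkPiAlgebraFin_apply (R := K), MultilinearMap.map_sum]
  exact Finset.sum_congr rfl fun x _ => MultilinearMap.map_smul_univ _ _ _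

lemma prod_ofFn_mul {M : Type*} [Monoid M] {a b : Fin N → M} (h : ∀ i j, Commute (a i) (b j)) :
    (List.ofFn fun j => a j * b j).prod = (List.ofFn a).prod * (List.ofFn b).prod := by
  induction N with
  | zero => simp
  | succ N ih =>
    have hcomm : Commute (List.ofFn fun j : Fin N => a j.succ).prod (b 0) :=
      Commute.list_prod_left _ _ (by simpa using fun j : Fin N => h j.succ 0)
    simp only [List.ofFn_succ, List.prod_cons, ih fun i j => h i.succ j.succ]
    rw [mul_assoc, ← mul_assoc (b 0), ← hcomm.eq, mul_assoc, mul_assoc]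

lemma apply_prod_ofFn {a : E →L[ℂ] E} {b : Fin (N + 1) → E →L[ℂ] E} {g : Fin (N + 1) → ℂ}
    (h : ∀ j, a * b j + b j * a = g j • 1) {ψ : E} (hψ : a ψ = 0) :
    a ((List.ofFn b).prod ψ) =
      ∑ p : Fin (N + 1), ((-1) ^ (p : ℕ) * g p) • (List.ofFn (b ∘ p.succAbove)).prod ψ := by
  have contract j (χ : E) : a (b j χ) = g j • χ - b j (a χ) := by
    rw [← mul_apply_eq_comp, eq_sub_of_add_eq (h j)]
    simp
  induction N with
  | zero => simp [contract, hψ]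
  | succ N ih =>
    have hofFn p : List.ofFn (b ∘ (Fin.succ p).succAbove) =
        b 0 :: List.ofFn ((b ∘ Fin.succ) ∘ p.succAbove) := by
      simp [List.ofFn_succ, Function.comp_def]
    have hb : List.ofFn b = b 0 :: List.ofFn (b ∘ Fin.succ) := List.ofFn_succ
    rw [hb, List.prod_cons, mul_apply_eq_comp, contract,
      ih (b := b ∘ Fin.succ) (g := g ∘ Fin.succ) (fun j => h j.succ) fun j => contract j.succ,
      Fin.sum_univ_succ (n := N + 1), sub_eq_add_neg, map_sum, ← Finset.sum_neg_distrib]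
    congr 1
    · simp [Function.comp_def]
    · refine Finset.sum_congr rfl fun p _ => ?_
      rw [hofFn, List.prod_cons, mul_apply_eq_comp, map_smul, ← neg_smul, Fin.val_succ, pow_succ]
      simp

variable [CompleteSpace E]

/-- Wick's theorem for a product of annihilators followed by a product of creators. -/
lemma inner_prod_ofFn_star_apply {a b : Fin N → E →L[ℂ] E} {G : Matrix (Fin N) (Fin N) ℂ}
    (h : ∀ i j, a i * b j + b j * a i = G i j • 1) (ψ : E) {χ : E} (hχ : ∀ i, a i χ = 0) :
    ⟪(List.ofFn fun i => star (a i)).prod ψ, (List.ofFn b).prod χ⟫_ℂ = G.det * ⟪ψ, χ⟫_ℂ := by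
  induction N with
  | zero => simp
  | succ N ih =>
    have ih p := ih (G := G.submatrix Fin.succ p.succAbove)
      (fun i j => h i.succ (Fin.succAbove p j)) fun i => hχ i.succ
    rw [List.ofFn_succ, List.prod_cons, mul_apply_eq_comp, inner_star_apply_left,
      apply_prod_ofFn (h 0) (hχ 0), inner_sum, G.det_succ_row_zero, Finset.sum_mul]
    refine Finset.sum_congr rfl fun p _ => ?_
    rw [inner_smul_right, mul_assoc ((-1) ^ (p : ℕ) * G 0 p), ← ih p]
    rfl

variable {ι : Type*} [DecidableEq ι] {c d : ι → E →L[ℂ] E}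

lemma IsCAR.inner_prod_ofFn_star_apply (hc : IsCAR c) (x y : Fin N → ι) (ψ : E) {χ : E}
    (hχ : ∀ i, c i χ = 0) :
    ⟪(List.ofFn fun j => star (c (x j))).prod ψ, (List.ofFn fun j => star (c (y j))).prod χ⟫_ℂ =
      ((1 : Matrix ι ι ℂ).submatrix x y).det * ⟪ψ, χ⟫_ℂ :=
  MultipartiteEntanglement.inner_prod_ofFn_star_apply
    (fun i j => by simp [hc.mul_star_add_star_mul, Matrix.one_apply, ite_smul]) ψ fun i => hχ (x i)

variable [Fintype ι]

lemma IsCAR.norm_prod_creation_apply_le (hc : IsCAR c) {v : Fin N → ι → ℂ}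
    (hv : ∀ j, ∑ i, ‖v j i‖ ^ 2 = 1) (ψ : E) :
    ‖(List.ofFn fun j => creation c (v j)).prod ψ‖ ≤ ‖ψ‖ := by
  induction N with
  | zero => simp
  | succ N ih =>
    rw [List.ofFn_succ, List.prod_cons, mul_apply_eq_comp]
    exact (hc.norm_creation_apply_le (hv 0) _).trans (ih fun j => hv j.succ)

lemma HasParticleNumber.prod_pairCreation_apply {ψ : E} (h : HasParticleNumber c 0 ψ)
    (hcd : IsCommutingCAR c d) (A : Fin N → ι → ι → ℂ) :
    HasParticleNumber c N ((List.ofFn fun j => pairCreation c d (A j)).prod ψ) := by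
  induction N with
  | zero => simpa using h
  | succ N ih =>
    rw [List.ofFn_succ, List.prod_cons, mul_apply_eq_comp]
    exact (ih fun j => A j.succ).pairCreation_apply hcd _

lemma IsCommutingCAR.card_pow_mul_norm_prod_pairCreation_apply_sq_le (hcd : IsCommutingCAR c d)
    {Ω : E} (hc : IsVacuum c Ω) (hd : IsVacuum d Ω) (hN : N ≤ Fintype.card ι)
    {A : Fin N → ι → ι → ℂ} (hA : ∀ j, ∑ a, ∑ b, ‖A j a b‖ ^ 2 = 1) :
    (Fintype.card ι : ℝ) ^ N * ‖(List.ofFn fun j => pairCreation c d (A j)).prod Ω‖ ^ 2 ≤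
      N ! * (Fintype.card ι).descFactorial N := by
  induction N with
  | zero => simp [hc.norm_eq_one]
  | succ N ih =>
    set D := Fintype.card ι
    set B := (List.ofFn fun j : Fin N => pairCreation c d (A j.succ)).prod Ω
    have hBc : HasParticleNumber c N B :=
      hc.hasParticleNumber.prod_pairCreation_apply hcd fun j => A j.succ
    have hBd : HasParticleNumber d N B := by
      simpa only [B, ← hcd.pairCreation_swap] using
        hd.hasParticleNumber.prod_pairCreation_apply hcd.symm fun j => Function.swap (A j.succ)
    have hstep := hcd.card_mul_norm_pairCreation_apply_sq_le (A 0) hN hBc hBd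
    rw [hA 0, mul_one] at hstep
    rw [List.ofFn_succ, List.prod_cons, mul_apply_eq_comp]
    calc (D : ℝ) ^ (N + 1) * ‖pairCreation c d (A 0) B‖ ^ 2
        = D ^ N * (D * ‖pairCreation c d (A 0) B‖ ^ 2) := by ring
      _ ≤ D ^ N * ((N + 1) * (D - N) * ‖B‖ ^ 2) := by gcongr
      _ = (N + 1) * (D - N) * (D ^ N * ‖B‖ ^ 2) := by ring
      _ ≤ (N + 1) * (D - N) * (N ! * D.descFactorial N) := by
        have hDN : (0 : ℝ) ≤ D - N := sub_nonneg.2 (by exact_mod_cast (Nat.le_succ N).trans hN)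
        exact mul_le_mul_of_nonneg_left (ih ((Nat.le_succ N).trans hN) fun j => hA j.succ)
          (by positivity)
      _ = (N + 1)! * D.descFactorial (N + 1) := by
        rw [Nat.factorial_succ, Nat.descFactorial_succ]
        push_cast [Nat.cast_sub ((Nat.le_succ N).trans hN)]
        ring

end Products

section Kets

variable {n : Type*}

/-- Unit vectors for the Euclidean norm; `n → ℂ` itself carries the supremum norm. -/
def IsUnitKet [Fintype n] (ψ : n → ℂ) : Prop := ∑ x, ‖ψ x‖ ^ 2 = 1

/-- Orthonormal bases of `ℂⁿ`, given by their vectors and the resolution of the identity. -/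
structure IsKetBasis {I : Type*} [Fintype I] [DecidableEq I] [Fintype n] [DecidableEq n]
    (e : I → n → ℂ) : Prop where
  orth : ∀ i j, star (e i) ⬝ᵥ e j = if i = j then 1 else 0
  complete : ∑ i, ketBra (e i) = 1

lemma ketBra_apply (ψ : n → ℂ) (x y : n) : ketBra ψ x y = ψ x * star (ψ y) := rfl

lemma posSemidef_ketBra [Finite n] (ψ : n → ℂ) : (ketBra ψ).PosSemidef :=
  Matrix.posSemidef_vecMulVec_self_star ψ

variable [Fintype n]

lemma star_dotProduct_self (ψ : n → ℂ) : star ψ ⬝ᵥ ψ = ((∑ x, ‖ψ x‖ ^ 2 : ℝ) : ℂ) := by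
  simp [dotProduct, Complex.conj_mul']

lemma isUnitKet_iff (ψ : n → ℂ) : IsUnitKet ψ ↔ star ψ ⬝ᵥ ψ = 1 := by
  rw [star_dotProduct_self, IsUnitKet]
  norm_cast

lemma trace_ketBra (ψ : n → ℂ) : (ketBra ψ).trace = star ψ ⬝ᵥ ψ := by
  rw [ketBra, Matrix.trace_vecMulVec, dotProduct_comm]

lemma trace_mul_ketBra (Q : Matrix n n ℂ) (ψ : n → ℂ) :
    (Q * ketBra ψ).trace = star ψ ⬝ᵥ Q.mulVec ψ := by
  rw [ketBra, Matrix.mul_vecMulVec, Matrix.trace_vecMulVec, dotProduct_comm]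

lemma ketBra_mulVec (ψ χ : n → ℂ) : (ketBra ψ).mulVec χ = (star ψ ⬝ᵥ χ) • ψ := by
  funext x
  simp only [Matrix.mulVec, dotProduct, ketBra_apply, Pi.smul_apply, smul_eq_mul, Pi.star_apply,
    Finset.sum_mul]
  exact Finset.sum_congr rfl fun _ _ => by ring

lemma isDensityMatrix_ketBra {ψ : n → ℂ} (h : IsUnitKet ψ) : IsDensityMatrix (ketBra ψ) :=
  ⟨posSemidef_ketBra ψ, by rw [trace_ketBra, (isUnitKet_iff ψ).1 h]⟩

lemma convex_isDensityMatrix : Convex ℝ {σ : Matrix n n ℂ | IsDensityMatrix σ} := by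
  rintro σ ⟨hσ, hσ_tr⟩ τ ⟨hτ, hτ_tr⟩ a b ha hb hab
  refine ⟨(hσ.smul ha).add (hτ.smul hb), ?_⟩
  rw [Matrix.trace_add, Matrix.trace_smul, Matrix.trace_smul, hσ_tr, hτ_tr, ← add_smul, hab,
    one_smul]

lemma trace_mul_ketBra_re_nonneg {Q : Matrix n n ℂ} (hQ : Q.PosSemidef) (ψ : n → ℂ) :
    0 ≤ (Q * ketBra ψ).trace.re := by
  rw [trace_mul_ketBra]
  exact (Complex.le_def.1 (hQ.dotProduct_mulVec_nonneg ψ)).1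

variable [DecidableEq n]

lemma IsKetBasis.isUnitKet {I : Type*} [Fintype I] [DecidableEq I] {e : I → n → ℂ}
    (he : IsKetBasis e) (i : I) : IsUnitKet (e i) := by
  rw [isUnitKet_iff, he.orth, if_pos rfl]

lemma exists_eigenbasis {ρ : Matrix n n ℂ} (hρ : ρ.IsHermitian) :
    ∃ (e : n → n → ℂ) (r : n → ℝ), IsKetBasis e ∧ ρ = ∑ i, r i • ketBra (e i) ∧
      (ρ.PosSemidef → ∀ i, 0 ≤ r i) := by
  set U : Matrix n n ℂ := (hρ.eigenvectorUnitary : Matrix n n ℂ) with hU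
  have star_mul_self : star U * U = 1 := Unitary.coe_star_mul_self _
  have mul_star_self : U * star U = 1 := Unitary.coe_mul_star_self _
  refine ⟨fun i x => U x i, hρ.eigenvalues, ⟨fun i j => ?_, ?_⟩, ?_,
    fun h => h.eigenvalues_nonneg⟩
  · exact congrFun (congrFun star_mul_self i) j
  · rw [← mul_star_self]
    ext x y
    rw [Matrix.sum_apply, Matrix.mul_apply]
    rfl
  · conv_lhs => rw [hρ.spectral_theorem]
    rw [Unitary.conjStarAlgAut_apply]
    ext x y
    rw [Matrix.sum_apply, Matrix.mul_apply]
    refine Finset.sum_congr rfl fun i _ => ?_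
    rw [Matrix.mul_diagonal]
    simp only [Matrix.smul_apply, ketBra_apply, Complex.real_smul]
    rw [Matrix.star_apply, ← hU, Function.comp_apply, RCLike.ofReal_eq_complex_ofReal]
    ring

lemma IsDensityMatrix.exists_eigenbasis {ρ : Matrix n n ℂ} (hρ : IsDensityMatrix ρ) :
    ∃ (e : n → n → ℂ) (r : n → ℝ), IsKetBasis e ∧ ρ = ∑ i, r i • ketBra (e i) ∧
      (∀ i, 0 ≤ r i) ∧ ∑ i, r i = 1 := by
  obtain ⟨e, r, he, h, hr⟩ := MultipartiteEntanglement.exists_eigenbasis hρ.1.isHermitian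
  refine ⟨e, r, he, h, hr hρ.1, ?_⟩
  have htr := hρ.2
  rw [h, Matrix.trace_sum] at htr
  simp only [Matrix.trace_smul, trace_ketBra, he.orth, if_true] at htr
  apply Complex.ofReal_injective
  simpa using htr

lemma IsDensityMatrix.one_sub_posSemidef {ρ : Matrix n n ℂ} (hρ : IsDensityMatrix ρ) :
    (1 - ρ).PosSemidef := by
  obtain ⟨e, r, he, h, hr, hr_sum⟩ := hρ.exists_eigenbasis
  have heigen : 1 - ρ = ∑ i, (1 - r i) • ketBra (e i) := by
    rw [h, ← he.complete, ← Finset.sum_sub_distrib]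
    simp [sub_smul]
  rw [heigen]
  refine Matrix.posSemidef_sum _ fun i _ => (posSemidef_ketBra _).smul ?_
  rw [sub_nonneg, ← hr_sum]
  exact Finset.single_le_sum (fun j _ => hr j) (Finset.mem_univ i)

lemma trace_mul_re_nonneg {m : Type*} [Fintype m] {Q σ : Matrix m m ℂ} (hQ : Q.PosSemidef)
    (hσ : σ.PosSemidef) : 0 ≤ (Q * σ).trace.re := by
  classical
  obtain ⟨e, r, -, h, hr⟩ := exists_eigenbasis hσ.isHermitian
  rw [h, Matrix.mul_sum, Matrix.trace_sum, Complex.re_sum]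
  refine Finset.sum_nonneg fun i _ => ?_
  rw [Matrix.mul_smul, Matrix.trace_smul, Complex.smul_re]
  exact mul_nonneg (hr hσ i) (trace_mul_ketBra_re_nonneg hQ _)

end Kets

section Separable

variable {N : ℕ} {α : Type*}

/-- The product vector `v₁ ⊗ ⋯ ⊗ v_N`. -/
def prodKet (v : Fin N → α → ℂ) (x : Fin N → α) : ℂ := ∏ j, v j (x j)

lemma ketBra_prodKet (v : Fin N → α → ℂ) :
    ketBra (prodKet v) = productOperator fun j => ketBra (v j) := by
  ext x y
  simp [ketBra_apply, prodKet, productOperator, Finset.prod_mul_distrib]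

lemma prod_sum_eq_sum_pi_prod {ι R : Type*} [CommSemiring R] [Fintype ι] (f : Fin N → ι → R) :
    ∏ j, ∑ i, f j i = ∑ x : Fin N → ι, ∏ j, f j (x j) := by
  rw [Finset.prod_univ_sum, Fintype.piFinset_univ]

lemma productOperator_sum_smul_ketBra {I : Type*} [Fintype I] (r : Fin N → I → ℝ)
    (e : Fin N → I → α → ℂ) :
    (productOperator fun j => ∑ i, r j i • ketBra (e j i)) =
      ∑ m : Fin N → I, (∏ j, r j (m j)) • ketBra (prodKet fun j => e j (m j)) := by
  ext x y
  simp only [productOperator, Matrix.of_apply, Matrix.sum_apply, prod_sum_eq_sum_pi_prod,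
    Matrix.smul_apply, ketBra_apply, Complex.real_smul, prodKet, Finset.prod_mul_distrib,
    Complex.ofReal_prod, star_prod]

variable [Fintype α]

lemma star_prodKet_dotProduct (v w : Fin N → α → ℂ) :
    star (prodKet v) ⬝ᵥ prodKet w = ∏ j, star (v j) ⬝ᵥ w j := by
  simp only [dotProduct, Pi.star_apply, prodKet, star_prod, prod_sum_eq_sum_pi_prod,
    Finset.prod_mul_distrib]

lemma IsUnitKet.prodKet {v : Fin N → α → ℂ} (hv : ∀ j, IsUnitKet (v j)) :
    IsUnitKet (prodKet v) := by
  rw [isUnitKet_iff, star_prodKet_dotProduct]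
  exact Finset.prod_eq_one fun j _ => (isUnitKet_iff (v j)).1 (hv j)

lemma ketBra_prodKet_mem_separableStates {v : Fin N → α → ℂ} (hv : ∀ j, IsUnitKet (v j)) :
    ketBra (prodKet v) ∈ separableStates N α :=
  subset_convexHull ℝ _ ⟨fun j => ketBra (v j), fun j => isDensityMatrix_ketBra (hv j),
    ketBra_prodKet v⟩

lemma convex_separableStates : Convex ℝ (separableStates N α) := convex_convexHull ℝ _

lemma separableStates_subset {S : Set (Matrix (Fin N → α) (Fin N → α) ℂ)} (hS : Convex ℝ S)
    (h : ∀ v : Fin N → α → ℂ, (∀ j, IsUnitKet (v j)) → ketBra (prodKet v) ∈ S) :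
    separableStates N α ⊆ S := by
  classical
  refine convexHull_min ?_ hS
  rintro _ ⟨τ, hτ, rfl⟩
  choose e r he hτe hr hr_sum using fun j => (hτ j).exists_eigenbasis
  rw [funext hτe, productOperator_sum_smul_ketBra]
  refine hS.sum_mem (fun m _ => Finset.prod_nonneg fun j _ => hr j _) ?_
    fun m _ => h _ fun j => (he j).isUnitKet _
  rw [← prod_sum_eq_sum_pi_prod]
  exact Finset.prod_eq_one fun j _ => hr_sum j

lemma isDensityMatrix_of_mem_separableStates {σ : Matrix (Fin N → α) (Fin N → α) ℂ}
    (hσ : σ ∈ separableStates N α) : IsDensityMatrix σ :=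
  separableStates_subset convex_isDensityMatrix
    (fun _ hv => isDensityMatrix_ketBra (IsUnitKet.prodKet hv)) hσ

lemma trace_mul_re_le_of_mem_separableStates {Q σ : Matrix (Fin N → α) (Fin N → α) ℂ} {c : ℝ}
    (hQ : ∀ v : Fin N → α → ℂ, (∀ j, IsUnitKet (v j)) →
      (star (prodKet v) ⬝ᵥ Q.mulVec (prodKet v)).re ≤ c)
    (hσ : σ ∈ separableStates N α) : (Q * σ).trace.re ≤ c := by
  refine separableStates_subset (S := {σ | (Q * σ).trace.re ≤ c}) ?_ (fun v hv => ?_) hσ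
  · intro σ hσ τ hτ a b ha hb hab
    simp only [Set.mem_ofPred_eq, mul_add, Matrix.mul_smul, Matrix.trace_add, Matrix.trace_smul,
      Complex.add_re, Complex.smul_re, smul_eq_mul] at *
    calc _ ≤ a * c + b * c := by gcongr
      _ = c := by rw [← add_mul, hab, one_mul]
  · rw [Set.mem_ofPred_eq, trace_mul_ketBra]
    exact hQ v hv

end Separable

section TensorProduct

/-- A factorization `γ ≃ α × β` of the local index set factorizes the `N`-tuples of indices. -/
def splitEquiv (N : ℕ) {α β γ : Type*} (e : γ ≃ α × β) :
    (Fin N → γ) ≃ (Fin N → α) × (Fin N → β) :=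
  (Equiv.arrowCongr (Equiv.refl _) e).trans (Equiv.arrowProdEquivProdArrow _ _ _)

variable {N : ℕ} {α β γ : Type*} (e : γ ≃ α × β)

/-- The tensor product of two `N`-partite operators as an `N`-partite operator, each party holding
one particle of either factor. -/
def joinOp (A : Matrix (Fin N → α) (Fin N → α) ℂ) (B : Matrix (Fin N → β) (Fin N → β) ℂ) :
    Matrix (Fin N → γ) (Fin N → γ) ℂ :=
  (A ⊗ₖ B).submatrix (splitEquiv N e) (splitEquiv N e)

/-- The tensor product of two vectors, its basis `γ` being identified with pairs through `e`. -/
def tensorKet (v : α → ℂ) (w : β → ℂ) (c : γ) : ℂ :=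
  v (e c).1 * w (e c).2

/-- The tensor product of two `N`-partite vectors as an `N`-partite vector, each party holding one
particle of either factor. -/
def joinKet (ψ : (Fin N → α) → ℂ) (χ : (Fin N → β) → ℂ) : (Fin N → γ) → ℂ :=
  tensorKet (splitEquiv N e) ψ χ

section

variable (A C : Matrix (Fin N → α) (Fin N → α) ℂ) (B D : Matrix (Fin N → β) (Fin N → β) ℂ)

lemma joinOp_apply (x y : Fin N → γ) :
    joinOp e A B x y = A (splitEquiv N e x).1 (splitEquiv N e y).1 *
      B (splitEquiv N e x).2 (splitEquiv N e y).2 := rfl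

lemma joinOp_add_left : joinOp e (A + C) B = joinOp e A B + joinOp e C B := by
  ext x y; simp [joinOp_apply, add_mul]

lemma joinOp_add_right : joinOp e A (B + D) = joinOp e A B + joinOp e A D := by
  ext x y; simp [joinOp_apply, mul_add]

lemma joinOp_smul_left (r : ℝ) : joinOp e (r • A) B = r • joinOp e A B := by
  ext x y; simp [joinOp_apply, mul_assoc]

lemma joinOp_smul_right (r : ℝ) : joinOp e A (r • B) = r • joinOp e A B := by
  ext x y; simp [joinOp_apply, mul_left_comm]

lemma joinOp_sum {I J : Type*} [Fintype I] [Fintype J] (A : I → Matrix (Fin N → α) (Fin N → α) ℂ)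
    (B : J → Matrix (Fin N → β) (Fin N → β) ℂ) :
    joinOp e (∑ i, A i) (∑ j, B j) = ∑ q : I × J, joinOp e (A q.1) (B q.2) := by
  ext x y
  simp only [joinOp_apply, Matrix.sum_apply, Finset.sum_mul_sum, Fintype.sum_prod_type]

lemma ketBra_joinKet (ψ : (Fin N → α) → ℂ) (χ : (Fin N → β) → ℂ) :
    ketBra (joinKet e ψ χ) = joinOp e (ketBra ψ) (ketBra χ) := by
  ext x y
  simp only [ketBra_apply, joinKet, tensorKet, joinOp_apply, star_mul']
  ring

lemma joinKet_prodKet (v : Fin N → α → ℂ) (w : Fin N → β → ℂ) :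
    joinKet e (prodKet v) (prodKet w) = prodKet fun j => tensorKet e (v j) (w j) := by
  funext x
  simp only [prodKet, joinKet, tensorKet, Finset.prod_mul_distrib]
  rfl

lemma joinOp_sum_smul_ketBra {I J : Type*} [Fintype I] [Fintype J] (u : I → (Fin N → α) → ℂ)
    (v : J → (Fin N → β) → ℂ) (r : I → ℝ) (s : J → ℝ) :
    joinOp e (∑ i, r i • ketBra (u i)) (∑ j, s j • ketBra (v j)) =
      ∑ q : I × J, (r q.1 * s q.2) • ketBra (joinKet e (u q.1) (v q.2)) := by
  rw [joinOp_sum]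
  refine Finset.sum_congr rfl fun q _ => ?_
  rw [joinOp_smul_left, joinOp_smul_right, smul_smul, ketBra_joinKet]

end

variable {A C : Matrix (Fin N → α) (Fin N → α) ℂ} {B D : Matrix (Fin N → β) (Fin N → β) ℂ}

lemma isHermitian_joinOp (hA : A.IsHermitian) (hB : B.IsHermitian) :
    (joinOp e A B).IsHermitian := by
  refine Matrix.IsHermitian.submatrix ?_ _
  rw [Matrix.IsHermitian, Matrix.conjTranspose_kronecker, hA.eq, hB.eq]

lemma joinOp_posSemidef [Finite α] [Finite β] (hA : A.PosSemidef) (hB : B.PosSemidef) :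
    (joinOp e A B).PosSemidef :=
  (hA.kronecker hB).submatrix _

variable [Fintype α] [Fintype β]

variable [Fintype γ]

lemma star_tensorKet_dotProduct (v v' : α → ℂ) (w w' : β → ℂ) :
    star (tensorKet e v w) ⬝ᵥ tensorKet e v' w' = (star v ⬝ᵥ v') * (star w ⬝ᵥ w') := by
  simp only [dotProduct, Pi.star_apply, tensorKet]
  rw [e.sum_comp fun q => star (v q.1 * w q.2) * (v' q.1 * w' q.2), Fintype.sum_prod_type,
    Finset.sum_mul_sum]
  refine Finset.sum_congr rfl fun _ _ => Finset.sum_congr rfl fun _ _ => ?_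
  rw [star_mul']
  ring

lemma IsUnitKet.tensorKet {v : α → ℂ} {w : β → ℂ} (hv : IsUnitKet v) (hw : IsUnitKet w) :
    IsUnitKet (tensorKet e v w) := by
  rw [isUnitKet_iff, star_tensorKet_dotProduct, (isUnitKet_iff v).1 hv, (isUnitKet_iff w).1 hw,
    one_mul]

lemma sum_splitEquiv {M : Type*} [AddCommMonoid M] (f : (Fin N → α) → (Fin N → β) → M) :
    ∑ x : Fin N → γ, f (splitEquiv N e x).1 (splitEquiv N e x).2 = ∑ x, ∑ y, f x y := by
  rw [(splitEquiv N e).sum_comp fun q => f q.1 q.2, Fintype.sum_prod_type]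

variable (A B C D) in
lemma joinOp_mul_joinOp : joinOp e A B * joinOp e C D = joinOp e (A * C) (B * D) := by
  rw [joinOp, joinOp, Matrix.submatrix_mul_equiv, ← Matrix.mul_kronecker_mul]
  rfl

variable (A B) in
lemma trace_joinOp : (joinOp e A B).trace = A.trace * B.trace := by
  simp only [Matrix.trace, Matrix.diag, joinOp_apply]
  rw [sum_splitEquiv e fun x y => A x x * B y y, Finset.sum_mul_sum]

variable (A B) in
lemma joinOp_mulVec_joinKet (ψ : (Fin N → α) → ℂ) (χ : (Fin N → β) → ℂ) :
    (joinOp e A B).mulVec (joinKet e ψ χ) = joinKet e (A.mulVec ψ) (B.mulVec χ) := by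
  funext x
  simp only [Matrix.mulVec, dotProduct, joinOp_apply, joinKet, tensorKet]
  rw [sum_splitEquiv e fun y y' => A (splitEquiv N e x).1 y * B (splitEquiv N e x).2 y' *
    (ψ y * χ y'), Finset.sum_mul_sum]
  exact Finset.sum_congr rfl fun _ _ => Finset.sum_congr rfl fun _ _ => by ring

lemma star_joinKet_dotProduct (ψ ψ' : (Fin N → α) → ℂ) (χ χ' : (Fin N → β) → ℂ) :
    star (joinKet e ψ χ) ⬝ᵥ joinKet e ψ' χ' = (star ψ ⬝ᵥ ψ') * (star χ ⬝ᵥ χ') :=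
  star_tensorKet_dotProduct (splitEquiv N e) ψ ψ' χ χ'

lemma IsDensityMatrix.joinOp (hA : IsDensityMatrix A) (hB : IsDensityMatrix B) :
    IsDensityMatrix (joinOp e A B) :=
  ⟨joinOp_posSemidef e hA.1 hB.1, by rw [trace_joinOp, hA.2, hB.2, one_mul]⟩

lemma joinOp_mem_separableStates (hA : A ∈ separableStates N α) (hB : B ∈ separableStates N β) :
    joinOp e A B ∈ separableStates N γ := by
  refine separableStates_subset (S := {A | joinOp e A B ∈ separableStates N γ}) ?_
    (fun v hv => ?_) hA
  · intro A hA A' hA' a b ha hb hab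
    rw [Set.mem_ofPred_eq, joinOp_add_left, joinOp_smul_left, joinOp_smul_left]
    exact convex_separableStates hA hA' ha hb hab
  refine separableStates_subset
    (S := {B | joinOp e (ketBra (prodKet v)) B ∈ separableStates N γ}) ?_ (fun w hw => ?_) hB
  · intro B hB B' hB' a b ha hb hab
    rw [Set.mem_ofPred_eq, joinOp_add_right, joinOp_smul_right, joinOp_smul_right]
    exact convex_separableStates hB hB' ha hb hab
  rw [Set.mem_ofPred_eq, ← ketBra_joinKet, joinKet_prodKet]
  exact ketBra_prodKet_mem_separableStates fun j => (hv j).tensorKet e (hw j)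

lemma IsKetBasis.joinKet [DecidableEq α] [DecidableEq β] [DecidableEq γ] {I J : Type*} [Fintype I]
    [DecidableEq I] [Fintype J] [DecidableEq J] {u : I → (Fin N → α) → ℂ}
    {v : J → (Fin N → β) → ℂ} (hu : IsKetBasis u) (hv : IsKetBasis v) :
    IsKetBasis fun q : I × J => joinKet e (u q.1) (v q.2) := by
  constructor
  · rintro ⟨i, j⟩ ⟨i', j'⟩
    rw [star_joinKet_dotProduct, hu.orth, hv.orth, ite_zero_mul_ite_zero, one_mul]
    simp only [Prod.mk.injEq]
  · simp only [ketBra_joinKet]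
    rw [← joinOp_sum e (fun i => ketBra (u i)) fun j => ketBra (v j), hu.complete, hv.complete,
      MultipartiteEntanglement.joinOp, Matrix.one_kronecker_one, Matrix.submatrix_one_equiv]

end TensorProduct

section TensorPower

variable {N : ℕ} {α : Type*} {ρ : Matrix (Fin N → α) (Fin N → α) ℂ}

lemma tensorPower_zero [DecidableEq α] : tensorPower ρ 0 = 1 := by
  ext x y
  rw [Subsingleton.elim x y]
  simp [tensorPower]

variable (ρ) in
lemma tensorPower_add (m n : ℕ) :
    tensorPower ρ (m + n) =
      joinOp (Fin.appendEquiv m n).symm (tensorPower ρ m) (tensorPower ρ n) := by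
  ext x y
  simp only [tensorPower, Matrix.of_apply, joinOp_apply, Fin.prod_univ_add]
  rfl

variable (ρ) in
lemma tensorPower_succ (n : ℕ) :
    tensorPower ρ (n + 1) =
      joinOp (Fin.consEquiv fun _ => α).symm ρ (tensorPower ρ n) := by
  ext x y
  simp only [tensorPower, Matrix.of_apply, joinOp_apply, Fin.prod_univ_succ]
  rfl

variable (ρ) in
lemma tensorPower_two : tensorPower ρ 2 = joinOp (finTwoArrowEquiv α) ρ ρ := by
  ext x y
  simp only [tensorPower, Matrix.of_apply, joinOp_apply, Fin.prod_univ_two]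
  rfl

lemma IsDensityMatrix.tensorPower [Fintype α] (hρ : IsDensityMatrix ρ) (n : ℕ) :
    IsDensityMatrix (tensorPower ρ n) := by
  classical
  induction n with
  | zero =>
    rw [tensorPower_zero]
    exact ⟨Matrix.PosSemidef.one, by simp⟩
  | succ n ih =>
    rw [tensorPower_succ]
    exact hρ.joinOp _ ih

end TensorPower

section Spectral

variable {n I J : Type*}

lemma isHermitian_sum_smul_ketBra [Fintype I] (e : I → n → ℂ) (r : I → ℝ) :
    (∑ i, r i • ketBra (e i)).IsHermitian := by
  rw [Matrix.IsHermitian, Matrix.conjTranspose_sum]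
  refine Finset.sum_congr rfl fun i _ => ?_
  rw [ketBra, Matrix.conjTranspose_smul, Matrix.conjTranspose_vecMulVec, star_star, star_trivial]

variable [Fintype n]

lemma star_star_dotProduct (v w : n → ℂ) : star (star v ⬝ᵥ w) = star w ⬝ᵥ v := by
  rw [Matrix.star_dotProduct, star_star, dotProduct_comm]

lemma norm_star_dotProduct_comm (v w : n → ℂ) : ‖star v ⬝ᵥ w‖ = ‖star w ⬝ᵥ v‖ := by
  rw [← star_star_dotProduct, norm_star]

lemma star_dotProduct_mul_star_dotProduct (v w : n → ℂ) :
    (star v ⬝ᵥ w) * (star w ⬝ᵥ v) = ((‖star v ⬝ᵥ w‖ ^ 2 : ℝ) : ℂ) := by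
  rw [← star_star_dotProduct v w, Complex.star_def, Complex.mul_conj', Complex.ofReal_pow]

lemma trace_ketBra_mul_ketBra (v w : n → ℂ) :
    (ketBra v * ketBra w).trace = ((‖star v ⬝ᵥ w‖ ^ 2 : ℝ) : ℂ) := by
  rw [trace_mul_ketBra, ketBra_mulVec, dotProduct_smul, smul_eq_mul,
    star_dotProduct_mul_star_dotProduct]

section

variable [Fintype I] (e : I → n → ℂ) (r : I → ℝ)

lemma sum_smul_ketBra_mulVec (v : n → ℂ) :
    (∑ i, r i • ketBra (e i)).mulVec v = ∑ i, ((r i : ℂ) * (star (e i) ⬝ᵥ v)) • e i := by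
  rw [Matrix.sum_mulVec]
  refine Finset.sum_congr rfl fun i _ => ?_
  rw [Matrix.smul_mulVec, ketBra_mulVec, mul_smul, Complex.coe_smul]

lemma star_dotProduct_sum_smul_ketBra_mulVec (v : n → ℂ) :
    star v ⬝ᵥ (∑ i, r i • ketBra (e i)).mulVec v =
      ((∑ i, r i * ‖star (e i) ⬝ᵥ v‖ ^ 2 : ℝ) : ℂ) := by
  rw [sum_smul_ketBra_mulVec, dotProduct_sum, Complex.ofReal_sum]
  refine Finset.sum_congr rfl fun i _ => ?_
  rw [dotProduct_smul, smul_eq_mul, mul_assoc, star_dotProduct_mul_star_dotProduct,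
    Complex.ofReal_mul]

end

variable [DecidableEq n] [Fintype I] [DecidableEq I] [Fintype J] [DecidableEq J]
  {e : I → n → ℂ} {f : J → n → ℂ}

namespace IsKetBasis

lemma ketBra_mul_ketBra (he : IsKetBasis e) (i j : I) :
    ketBra (e i) * ketBra (e j) = if i = j then ketBra (e i) else 0 := by
  rw [ketBra, ketBra, Matrix.vecMulVec_mul_vecMulVec, he.orth]
  split_ifs with h
  · rw [h, one_smul]
  · rw [zero_smul, Matrix.vecMulVec_zero]

lemma sum_smul_mul_sum_smul (he : IsKetBasis e) (r s : I → ℝ) :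
    (∑ i, r i • ketBra (e i)) * ∑ i, s i • ketBra (e i) = ∑ i, (r i * s i) • ketBra (e i) := by
  simp only [Finset.sum_mul_sum, smul_mul_smul_comm, he.ketBra_mul_ketBra, smul_ite, smul_zero,
    Finset.sum_ite_eq, Finset.mem_univ, if_true]

lemma aeval_sum_smul (he : IsKetBasis e) (r : I → ℝ) (q : Polynomial ℝ) :
    Polynomial.aeval (∑ i, r i • ketBra (e i)) q = ∑ i, q.eval (r i) • ketBra (e i) := by
  induction q using Polynomial.induction_on with
  | C a =>
    simp only [Polynomial.aeval_C, Polynomial.eval_C]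
    rw [← Finset.smul_sum, he.complete, Algebra.algebraMap_eq_smul_one]
  | add p q hp hq =>
    simp only [map_add, hp, hq, Polynomial.eval_add, add_smul, Finset.sum_add_distrib]
  | monomial k a ih =>
    rw [pow_succ, ← mul_assoc, map_mul, ih, Polynomial.aeval_X, he.sum_smul_mul_sum_smul]
    simp [mul_assoc]

lemma cfc_sum_smul (he : IsKetBasis e) (r : I → ℝ) (g : ℝ → ℝ) :
    cfc g (∑ i, r i • ketBra (e i)) = ∑ i, g (r i) • ketBra (e i) := by
  classical
  set ρ := ∑ i, r i • ketBra (e i) with hρ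
  have hself : IsSelfAdjoint ρ := isHermitian_sum_smul_ketBra e r
  have hfin : (spectrum ℝ ρ).Finite := Matrix.finite_real_spectrum
  set nodes : Finset ℝ := Finset.univ.image r ∪ hfin.toFinset with hnodes
  set q : Polynomial ℝ := Lagrange.interpolate nodes id g
  have eval_q : ∀ t ∈ nodes, q.eval t = g t := fun t ht =>
    Lagrange.eval_interpolate_at_node g (fun _ _ _ _ h => h) ht
  calc cfc g ρ = cfc q.eval ρ := cfc_congr fun t ht => (eval_q t (by simp [hnodes, ht])).symm
    _ = ∑ i, q.eval (r i) • ketBra (e i) := by rw [cfc_polynomial q ρ hself, hρ, he.aeval_sum_smul]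
    _ = ∑ i, g (r i) • ketBra (e i) :=
      Finset.sum_congr rfl fun i _ => by rw [eval_q (r i) (by simp [hnodes])]

lemma sum_smul_mulVec_apply (he : IsKetBasis e) (r : I → ℝ) (i : I) :
    (∑ i, r i • ketBra (e i)).mulVec (e i) = (r i : ℂ) • e i := by
  simp only [sum_smul_ketBra_mulVec, he.orth, mul_ite, mul_one, mul_zero, ite_smul, zero_smul,
    Finset.sum_ite_eq', Finset.mem_univ, if_true]

lemma star_dotProduct_sum_smul_mulVec (he : IsKetBasis e) (r : I → ℝ) (v : n → ℂ) (i : I) :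
    star (e i) ⬝ᵥ (∑ i, r i • ketBra (e i)).mulVec v = r i * (star (e i) ⬝ᵥ v) := by
  simp only [sum_smul_ketBra_mulVec, dotProduct_sum, dotProduct_smul, he.orth, smul_eq_mul,
    mul_ite, mul_one, mul_zero, Finset.sum_ite_eq, Finset.mem_univ, if_true]

lemma sum_dotProduct_smul (he : IsKetBasis e) (v : n → ℂ) :
    ∑ i, (star (e i) ⬝ᵥ v) • e i = v := by
  have h := sum_smul_ketBra_mulVec e (fun _ => 1) v
  simp only [one_smul, he.complete, Matrix.one_mulVec, Complex.ofReal_one, one_mul] at h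
  exact h.symm

lemma sum_norm_sq (he : IsKetBasis e) (v : n → ℂ) :
    ∑ i, ‖star (e i) ⬝ᵥ v‖ ^ 2 = ∑ x, ‖v x‖ ^ 2 := by
  have h := star_dotProduct_sum_smul_ketBra_mulVec e (fun _ => 1) v
  simp only [one_smul, he.complete, Matrix.one_mulVec, one_mul, star_dotProduct_self] at h
  exact_mod_cast h.symm

lemma sum_norm_sq_right (he : IsKetBasis e) (hf : IsKetBasis f) (i : I) :
    ∑ j, ‖star (e i) ⬝ᵥ f j‖ ^ 2 = 1 := by
  simp only [norm_star_dotProduct_comm (e i)]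
  rw [hf.sum_norm_sq]
  exact he.isUnitKet i

lemma support_iff (he : IsKetBasis e) (hf : IsKetBasis f) (r : I → ℝ) (s : J → ℝ) :
    (∀ v, (∑ j, s j • ketBra (f j)).mulVec v = 0 → (∑ i, r i • ketBra (e i)).mulVec v = 0) ↔
      ∀ i j, s j = 0 → r i ≠ 0 → star (e i) ⬝ᵥ f j = 0 := by
  constructor
  · intro hker i j hs hr
    have hfj := hker (f j) (by rw [hf.sum_smul_mulVec_apply, hs, Complex.ofReal_zero, zero_smul])
    have hij := he.star_dotProduct_sum_smul_mulVec r (f j) i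
    rw [hfj, dotProduct_zero] at hij
    exact (mul_eq_zero.1 hij.symm).resolve_left (by exact_mod_cast hr)
  · intro horth v hv
    have hfv (j : J) (hs : s j ≠ 0) : star (f j) ⬝ᵥ v = 0 := by
      have hj := hf.star_dotProduct_sum_smul_mulVec s v j
      rw [hv, dotProduct_zero] at hj
      exact (mul_eq_zero.1 hj.symm).resolve_left (by exact_mod_cast hs)
    have hev (i : I) (hr : r i ≠ 0) : star (e i) ⬝ᵥ v = 0 := by
      rw [← hf.sum_dotProduct_smul v, dotProduct_sum]
      refine Finset.sum_eq_zero fun j _ => ?_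
      rw [dotProduct_smul, smul_eq_mul]
      by_cases hs : s j = 0
      · rw [horth i j hs hr, mul_zero]
      · rw [hfv j hs, zero_mul]
    rw [sum_smul_ketBra_mulVec]
    refine Finset.sum_eq_zero fun i _ => ?_
    by_cases hr : r i = 0
    · rw [hr, Complex.ofReal_zero, zero_mul, zero_smul]
    · rw [hev i hr, mul_zero, zero_smul]

end IsKetBasis

open Classical in
lemma relativeEntropy_sum_smul_ketBra (he : IsKetBasis e) (hf : IsKetBasis f) (r : I → ℝ)
    (s : J → ℝ) :
    relativeEntropy (∑ i, r i • ketBra (e i)) (∑ j, s j • ketBra (f j)) =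
      if ∀ i j, s j = 0 → r i ≠ 0 → star (e i) ⬝ᵥ f j = 0 then
        ((∑ i, ∑ j, ‖star (e i) ⬝ᵥ f j‖ ^ 2 * (r i * (Real.logb 2 (r i) - Real.logb 2 (s j))) :
          ℝ) : EReal)
      else ⊤ := by
  rw [relativeEntropy]
  simp only [he.support_iff hf]
  split_ifs with h
  swap
  · rfl
  congr 1
  rw [he.cfc_sum_smul, hf.cfc_sum_smul, mul_sub, he.sum_smul_mul_sum_smul, Finset.sum_mul_sum,
    Matrix.trace_sub, Complex.sub_re, Matrix.trace_sum, Matrix.trace_sum, Complex.re_sum,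
    Complex.re_sum, ← Finset.sum_sub_distrib]
  refine Finset.sum_congr rfl fun i _ => ?_
  rw [Matrix.trace_smul, trace_ketBra, he.orth, if_pos rfl, Matrix.trace_sum, Complex.re_sum]
  simp only [mul_sub, Finset.sum_sub_distrib]
  rw [← Finset.sum_mul, he.sum_norm_sq_right hf, one_mul, Complex.smul_re, Complex.one_re,
    smul_eq_mul, mul_one]
  congr 1
  refine Finset.sum_congr rfl fun j _ => ?_
  rw [smul_mul_smul_comm, Matrix.trace_smul, trace_ketBra_mul_ketBra, Complex.smul_re,
    Complex.ofReal_re, smul_eq_mul]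
  ring

end Spectral

section RelativeEntropyBounds

lemma sum_mul_logb_le_logb {ι : Type*} [Fintype ι] {p x : ι → ℝ} {c : ℝ} (hp : ∀ i, 0 ≤ p i)
    (hp_sum : ∑ i, p i = 1) (hx : ∀ i, p i ≠ 0 → 0 < x i) (hc : 0 < c)
    (hle : ∑ i, p i * x i ≤ c) : ∑ i, p i * Real.logb 2 (x i) ≤ Real.logb 2 c := by
  have tangent : ∀ i, p i * Real.log (x i) ≤ p i * x i / c - p i + p i * Real.log c := by
    intro i
    rcases eq_or_ne (p i) 0 with h0 | h0
    · simp [h0]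
    have hlog := Real.log_le_sub_one_of_pos (div_pos (hx i h0) hc)
    rw [Real.log_div (hx i h0).ne' hc.ne'] at hlog
    calc p i * Real.log (x i) ≤ p i * (x i / c - 1 + Real.log c) :=
          mul_le_mul_of_nonneg_left (by linarith) (hp i)
      _ = _ := by ring
  have hsum : ∑ i, p i * Real.log (x i) ≤ Real.log c := by
    calc ∑ i, p i * Real.log (x i) ≤ (∑ i, p i * x i) / c - 1 + Real.log c := by
          refine (Finset.sum_le_sum fun i _ => tangent i).trans_eq ?_
          rw [Finset.sum_add_distrib, Finset.sum_sub_distrib, ← Finset.sum_div, ← Finset.sum_mul,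
            hp_sum, one_mul]
      _ ≤ Real.log c := by linarith [(div_le_one hc).2 hle]
  simp only [Real.logb, ← mul_div_assoc, ← Finset.sum_div]
  exact div_le_div_of_nonneg_right hsum (Real.log_pos one_lt_two).le

variable {n : Type*} [Fintype n]

lemma div_pos_of_support {I J : Type*} {e : I → n → ℂ} {f : J → n → ℂ} {r : I → ℝ}
    {s : J → ℝ} (hr : ∀ i, 0 ≤ r i) (hs : ∀ j, 0 ≤ s j)
    (hsupp : ∀ i j, s j = 0 → r i ≠ 0 → star (e i) ⬝ᵥ f j = 0) {i : I} {j : J}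
    (h : r i * ‖star (e i) ⬝ᵥ f j‖ ^ 2 ≠ 0) : 0 < r i / s j := by
  have hri : r i ≠ 0 := left_ne_zero_of_mul h
  have hsj : s j ≠ 0 := fun hsj => h (by simp [hsupp i j hsj hri])
  exact div_pos ((hr i).lt_of_ne' hri) ((hs j).lt_of_ne' hsj)

lemma star_mulVec_dotProduct_of_isHermitian {P : Matrix n n ℂ} (hP : P.IsHermitian) (v w : n → ℂ) :
    star (P.mulVec v) ⬝ᵥ w = star v ⬝ᵥ P.mulVec w := by
  rw [Matrix.star_mulVec, hP.eq, Matrix.dotProduct_mulVec]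

lemma star_dotProduct_mulVec_of_isProj {P : Matrix n n ℂ} (hP : P.IsHermitian)
    (hPP : P * P = P) (v : n → ℂ) :
    star v ⬝ᵥ P.mulVec v = ((∑ x, ‖P.mulVec v x‖ ^ 2 : ℝ) : ℂ) := by
  rw [← star_dotProduct_self, star_mulVec_dotProduct_of_isHermitian hP, Matrix.mulVec_mulVec, hPP]

variable [DecidableEq n]

lemma relativeEntropy_ne_bot (ρ σ : Matrix n n ℂ) : relativeEntropy ρ σ ≠ ⊥ := by
  rw [relativeEntropy]
  split_ifs
  · exact EReal.coe_ne_bot _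
  · exact top_ne_bot

variable {I J : Type*} [Fintype I] [DecidableEq I] [Fintype J] [DecidableEq J]
  {e : I → n → ℂ} {f : J → n → ℂ} {r : I → ℝ} {s : J → ℝ}

lemma relativeEntropy_eq_sum_mul_logb_div (he : IsKetBasis e) (hf : IsKetBasis f)
    (hsupp : ∀ i j, s j = 0 → r i ≠ 0 → star (e i) ⬝ᵥ f j = 0) :
    relativeEntropy (∑ i, r i • ketBra (e i)) (∑ j, s j • ketBra (f j)) =
      ((∑ q : I × J, r q.1 * ‖star (e q.1) ⬝ᵥ f q.2‖ ^ 2 * Real.logb 2 (r q.1 / s q.2) : ℝ) :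
        EReal) := by
  rw [relativeEntropy_sum_smul_ketBra he hf, if_pos hsupp, Fintype.sum_prod_type]
  congr 1
  refine Finset.sum_congr rfl fun i _ => Finset.sum_congr rfl fun j _ => ?_
  by_cases hr : r i = 0
  · simp [hr]
  by_cases hs : s j = 0
  · simp [hsupp i j hs hr]
  rw [Real.logb_div hr hs]
  ring

lemma IsKetBasis.sum_prod_mul_norm_sq (he : IsKetBasis e) (hf : IsKetBasis f)
    (hr : ∑ i, r i = 1) : ∑ q : I × J, r q.1 * ‖star (e q.1) ⬝ᵥ f q.2‖ ^ 2 = 1 := by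
  simp only [Fintype.sum_prod_type, ← Finset.mul_sum, he.sum_norm_sq_right hf, mul_one, hr]

section Projection

variable {P : Matrix n n ℂ}

lemma IsKetBasis.mulVec_eq_self_of_mul_sum_smul_eq (he : IsKetBasis e)
    (hPe : P * ∑ i, r i • ketBra (e i) = ∑ i, r i • ketBra (e i)) {i : I} (hi : r i ≠ 0) :
    P.mulVec (e i) = e i := by
  have h : (P * ∑ i, r i • ketBra (e i)).mulVec (e i) = (r i : ℂ) • e i := by
    rw [hPe, he.sum_smul_mulVec_apply]
  rw [← Matrix.mulVec_mulVec, he.sum_smul_mulVec_apply, Matrix.mulVec_smul] at h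
  exact smul_right_injective _ (Complex.ofReal_ne_zero.2 hi) h

lemma IsKetBasis.sum_div_self_mul_norm_sq_le (he : IsKetBasis e) (hP : P.IsHermitian)
    (hPP : P * P = P) (hPe : P * ∑ i, r i • ketBra (e i) = ∑ i, r i • ketBra (e i)) (v : n → ℂ) :
    ∑ i, r i / r i * ‖star (e i) ⬝ᵥ v‖ ^ 2 ≤ (star v ⬝ᵥ P.mulVec v).re := by
  rw [star_dotProduct_mulVec_of_isProj hP hPP, Complex.ofReal_re, ← he.sum_norm_sq]
  refine Finset.sum_le_sum fun i _ => ?_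
  rcases eq_or_ne (r i) 0 with hi | hi
  · rw [hi, zero_div, zero_mul]
    positivity
  · rw [div_self hi, one_mul, ← star_mulVec_dotProduct_of_isHermitian hP,
      he.mulVec_eq_self_of_mul_sum_smul_eq hPe hi]

/- With `p (i, j) = rᵢ |⟨eᵢ|fⱼ⟩|²`, concavity of the logarithm bounds `∑ p log (s / r)` by
`log ∑ p s / r`, and `∑ p s / r` is the overlap of `σ` with the support projection of `ρ`. -/
lemma neg_logb_le_relativeEntropy {ρ σ : Matrix n n ℂ} (hρ : IsDensityMatrix ρ)
    (hσ : σ.PosSemidef) (hP : P.IsHermitian) (hPP : P * P = P) (hPρ : P * ρ = ρ) {q : ℝ}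
    (hq : 0 < q) (hPσ : (P * σ).trace.re ≤ q) :
    ((-Real.logb 2 q : ℝ) : EReal) ≤ relativeEntropy ρ σ := by
  classical
  obtain ⟨e, r, he, rfl, hr, hr_sum⟩ := hρ.exists_eigenbasis
  obtain ⟨f, s, hf, rfl, hs⟩ := exists_eigenbasis hσ.isHermitian
  replace hs := hs hσ
  by_cases hsupp : ∀ i j, s j = 0 → r i ≠ 0 → star (e i) ⬝ᵥ f j = 0
  swap
  · rw [relativeEntropy_sum_smul_ketBra he hf, if_neg hsupp]
    exact le_top
  rw [relativeEntropy_eq_sum_mul_logb_div he hf hsupp, EReal.coe_le_coe_iff, neg_le,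
    ← Finset.sum_neg_distrib]
  simp only [← mul_neg, ← Real.logb_inv, inv_div]
  refine sum_mul_logb_le_logb (fun p => mul_nonneg (hr _) (by positivity))
    (he.sum_prod_mul_norm_sq hf hr_sum)
    (fun p hp => inv_div (r p.1) (s p.2) ▸ inv_pos.2 (div_pos_of_support hr hs hsupp hp)) hq ?_
  calc ∑ p : n × n, r p.1 * ‖star (e p.1) ⬝ᵥ f p.2‖ ^ 2 * (s p.2 / r p.1)
      = ∑ j, s j * ∑ i, r i / r i * ‖star (e i) ⬝ᵥ f j‖ ^ 2 := by
        simp only [Fintype.sum_prod_type_right, Finset.mul_sum]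
        exact Finset.sum_congr rfl fun j _ => Finset.sum_congr rfl fun i _ => by ring
    _ ≤ ∑ j, s j * (star (f j) ⬝ᵥ P.mulVec (f j)).re := Finset.sum_le_sum fun j _ =>
        mul_le_mul_of_nonneg_left (he.sum_div_self_mul_norm_sq_le hP hPP hPρ _) (hs j)
    _ = (P * ∑ j, s j • ketBra (f j)).trace.re := by
        simp only [Matrix.mul_sum, Matrix.mul_smul, Matrix.trace_sum, Matrix.trace_smul,
          trace_mul_ketBra, Complex.re_sum, Complex.smul_re, smul_eq_mul]
    _ ≤ q := hPσ

end Projection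

section MaxRelativeEntropy

variable {l : ℝ}

lemma mul_norm_sq_le_of_posSemidef_sub {n I J : Type*} [Fintype n] [Fintype I] [Fintype J]
    {e : I → n → ℂ} {f : J → n → ℂ} {r : I → ℝ} {s : J → ℝ} (hr : ∀ i, 0 ≤ r i)
    (h : (l • ∑ j, s j • ketBra (f j) - ∑ i, r i • ketBra (e i)).PosSemidef) (i : I) (v : n → ℂ) :
    r i * ‖star (e i) ⬝ᵥ v‖ ^ 2 ≤ l * ∑ j, s j * ‖star (f j) ⬝ᵥ v‖ ^ 2 := by
  have hv := (Complex.le_def.1 (h.dotProduct_mulVec_nonneg v)).1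
  rw [Matrix.sub_mulVec, dotProduct_sub, Matrix.smul_mulVec, dotProduct_smul,
    star_dotProduct_sum_smul_ketBra_mulVec, star_dotProduct_sum_smul_ketBra_mulVec,
    Complex.sub_re, Complex.smul_re, Complex.ofReal_re, Complex.ofReal_re, Complex.zero_re,
    smul_eq_mul, sub_nonneg] at hv
  exact (Finset.single_le_sum (f := fun i => r i * ‖star (e i) ⬝ᵥ v‖ ^ 2)
    (fun j _ => mul_nonneg (hr j) (by positivity)) (Finset.mem_univ i)).trans hv

lemma IsKetBasis.star_dotProduct_eq_zero_of_posSemidef_sub {I : Type*} [Fintype I]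
    {e : I → n → ℂ} {r : I → ℝ} (hf : IsKetBasis f) (hr : ∀ i, 0 ≤ r i)
    (h : (l • ∑ j, s j • ketBra (f j) - ∑ i, r i • ketBra (e i)).PosSemidef) {i : I} {j : J}
    (hs : s j = 0) (hri : r i ≠ 0) : star (e i) ⬝ᵥ f j = 0 := by
  have hle := mul_norm_sq_le_of_posSemidef_sub hr h i (f j)
  have hsum : ∑ k, s k * ‖star (f k) ⬝ᵥ f j‖ ^ 2 = 0 := by
    refine Finset.sum_eq_zero fun k _ => ?_
    rw [hf.orth]
    split_ifs with hk
    · rw [hk, hs, zero_mul]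
    · simp
  rw [hsum, mul_zero] at hle
  simpa using nonpos_of_mul_nonpos_right hle ((hr i).lt_of_ne' hri)

/- The inequality is the operator inequality evaluated at the vector `σ⁻¹ eᵢ`. -/
lemma IsKetBasis.mul_sum_norm_sq_div_le {I : Type*} [Fintype I] {e : I → n → ℂ} {r : I → ℝ}
    (hf : IsKetBasis f) (hr : ∀ i, 0 ≤ r i) (hs : ∀ j, 0 ≤ s j) (hl : 0 ≤ l)
    (h : (l • ∑ j, s j • ketBra (f j) - ∑ i, r i • ketBra (e i)).PosSemidef) (i : I) :
    r i * ∑ j, ‖star (e i) ⬝ᵥ f j‖ ^ 2 / s j ≤ l := by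
  set g : ℝ := ∑ j, ‖star (e i) ⬝ᵥ f j‖ ^ 2 / s j with hg
  set v : n → ℂ := (∑ j, (s j)⁻¹ • ketBra (f j)).mulVec (e i) with hv
  have hg0 : 0 ≤ g := Finset.sum_nonneg fun j _ => div_nonneg (by positivity) (hs j)
  have hev : star (e i) ⬝ᵥ v = g := by
    rw [hv, star_dotProduct_sum_smul_ketBra_mulVec, hg]
    simp only [norm_star_dotProduct_comm (e i), div_eq_inv_mul]
  have hfv : ∑ j, s j * ‖star (f j) ⬝ᵥ v‖ ^ 2 = g := by
    refine Finset.sum_congr rfl fun j _ => ?_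
    rw [hv, hf.star_dotProduct_sum_smul_mulVec, norm_mul, Complex.norm_real, mul_pow,
      Real.norm_eq_abs, sq_abs, norm_star_dotProduct_comm]
    rcases eq_or_ne (s j) 0 with h0 | h0
    · simp [h0]
    · field_simp
  have hle := mul_norm_sq_le_of_posSemidef_sub hr h i v
  rw [hev, hfv, Complex.norm_real, Real.norm_of_nonneg hg0, sq, ← mul_assoc] at hle
  rcases hg0.eq_or_lt with h0 | h0
  · rwa [← h0, mul_zero]
  · exact le_of_mul_le_mul_right hle h0

lemma relativeEntropy_le_logb {ρ σ : Matrix n n ℂ} (hρ : IsDensityMatrix ρ)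
    (hσ : σ.PosSemidef) (hl : 0 < l) (h : (l • σ - ρ).PosSemidef) :
    relativeEntropy ρ σ ≤ ((Real.logb 2 l : ℝ) : EReal) := by
  classical
  obtain ⟨e, r, he, rfl, hr, hr_sum⟩ := hρ.exists_eigenbasis
  obtain ⟨f, s, hf, rfl, hs⟩ := exists_eigenbasis hσ.isHermitian
  replace hs := hs hσ
  have hsupp : ∀ i j, s j = 0 → r i ≠ 0 → star (e i) ⬝ᵥ f j = 0 := fun i j =>
    hf.star_dotProduct_eq_zero_of_posSemidef_sub hr h
  rw [relativeEntropy_eq_sum_mul_logb_div he hf hsupp, EReal.coe_le_coe_iff]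
  refine sum_mul_logb_le_logb (fun p => mul_nonneg (hr _) (by positivity))
    (he.sum_prod_mul_norm_sq hf hr_sum) (fun p => div_pos_of_support hr hs hsupp) hl ?_
  calc ∑ p : n × n, r p.1 * ‖star (e p.1) ⬝ᵥ f p.2‖ ^ 2 * (r p.1 / s p.2)
      = ∑ i, r i * (r i * ∑ j, ‖star (e i) ⬝ᵥ f j‖ ^ 2 / s j) := by
        simp only [Fintype.sum_prod_type, Finset.mul_sum]
        exact Finset.sum_congr rfl fun i _ => Finset.sum_congr rfl fun j _ => by ring
    _ ≤ ∑ i, r i * l := Finset.sum_le_sum fun i _ =>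
        mul_le_mul_of_nonneg_left (hf.mul_sum_norm_sq_div_le hr hs hl.le h i) (hr i)
    _ = l := by rw [← Finset.sum_mul, hr_sum, one_mul]

end MaxRelativeEntropy

end RelativeEntropyBounds

section RelativeEntropyJoin

lemma sum_prod_mul_logb_mul {I J : Type*} [Fintype I] [Fintype J] {p x : I → ℝ} {q y : J → ℝ}
    (hp : ∑ i, p i = 1) (hq : ∑ j, q j = 1) (hx : ∀ i, p i ≠ 0 → x i ≠ 0)
    (hy : ∀ j, q j ≠ 0 → y j ≠ 0) :
    ∑ k : I × J, p k.1 * q k.2 * Real.logb 2 (x k.1 * y k.2) =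
      ∑ i, p i * Real.logb 2 (x i) + ∑ j, q j * Real.logb 2 (y j) := by
  have logb_mul (i : I) (j : J) : p i * q j * Real.logb 2 (x i * y j) =
      p i * Real.logb 2 (x i) * q j + p i * (q j * Real.logb 2 (y j)) := by
    rcases eq_or_ne (p i) 0 with hpi | hpi
    · simp [hpi]
    rcases eq_or_ne (q j) 0 with hqj | hqj
    · simp [hqj]
    rw [Real.logb_mul (hx i hpi) (hy j hqj)]
    ring
  simp only [Fintype.sum_prod_type, logb_mul, Finset.sum_add_distrib, ← Finset.mul_sum,
    ← Finset.sum_mul, hp, hq, mul_one, one_mul]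

variable {N : ℕ} {α β γ : Type*} [Fintype α] [Fintype β] [Fintype γ] [DecidableEq α]
  [DecidableEq β] [DecidableEq γ] (e : γ ≃ α × β)

lemma relativeEntropy_joinOp_le {ρ σ : Matrix (Fin N → α) (Fin N → α) ℂ}
    {ρ' σ' : Matrix (Fin N → β) (Fin N → β) ℂ} (hρ : IsDensityMatrix ρ) (hσ : IsDensityMatrix σ)
    (hρ' : IsDensityMatrix ρ') (hσ' : IsDensityMatrix σ') :
    relativeEntropy (joinOp e ρ ρ') (joinOp e σ σ') ≤
      relativeEntropy ρ σ + relativeEntropy ρ' σ' := by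
  classical
  obtain ⟨u, r, hu, rfl, hr, hr_sum⟩ := hρ.exists_eigenbasis
  obtain ⟨u', r', hu', rfl, hr', hr'_sum⟩ := hρ'.exists_eigenbasis
  obtain ⟨v, s, hv, rfl, hs, -⟩ := hσ.exists_eigenbasis
  obtain ⟨v', s', hv', rfl, hs', -⟩ := hσ'.exists_eigenbasis
  by_cases hsupp : ∀ i j, s j = 0 → r i ≠ 0 → star (u i) ⬝ᵥ v j = 0
  swap
  · rw [relativeEntropy_sum_smul_ketBra hu hv, if_neg hsupp,
      EReal.top_add_of_ne_bot (relativeEntropy_ne_bot _ _)]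
    exact le_top
  by_cases hsupp' : ∀ i j, s' j = 0 → r' i ≠ 0 → star (u' i) ⬝ᵥ v' j = 0
  swap
  · rw [relativeEntropy_sum_smul_ketBra hu' hv', if_neg hsupp',
      EReal.add_top_of_ne_bot (relativeEntropy_ne_bot _ _)]
    exact le_top
  have hsupp_join (i j : (Fin N → α) × (Fin N → β)) (hs : s j.1 * s' j.2 = 0)
      (hr : r i.1 * r' i.2 ≠ 0) :
      star (joinKet e (u i.1) (u' i.2)) ⬝ᵥ joinKet e (v j.1) (v' j.2) = 0 := by
    rw [star_joinKet_dotProduct]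
    rcases mul_eq_zero.1 hs with h | h
    · rw [hsupp _ _ h (left_ne_zero_of_mul hr), zero_mul]
    · rw [hsupp' _ _ h (right_ne_zero_of_mul hr), mul_zero]
  rw [joinOp_sum_smul_ketBra, joinOp_sum_smul_ketBra,
    relativeEntropy_eq_sum_mul_logb_div hu hv hsupp,
    relativeEntropy_eq_sum_mul_logb_div hu' hv' hsupp',
    relativeEntropy_eq_sum_mul_logb_div (hu.joinKet e hu') (hv.joinKet e hv') hsupp_join,
    ← EReal.coe_add, EReal.coe_le_coe_iff,
    ← sum_prod_mul_logb_mul (hu.sum_prod_mul_norm_sq hv hr_sum)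
      (hu'.sum_prod_mul_norm_sq hv' hr'_sum)
      (fun i hi => (div_pos_of_support hr hs hsupp hi).ne')
      fun i hi => (div_pos_of_support hr' hs' hsupp' hi).ne',
    ← (Equiv.prodProdProdComm _ _ _ _).sum_comp]
  refine (Finset.sum_congr rfl fun k _ => ?_).le
  simp only [Equiv.prodProdProdComm_apply, star_joinKet_dotProduct, norm_mul, mul_pow,
    mul_div_mul_comm]
  ring

end RelativeEntropyJoin

section EntanglementMeasures

lemma prodKet_single {N : ℕ} {α : Type*} [DecidableEq α] (x y : Fin N → α) :
    prodKet (fun j => Pi.single (x j) (1 : ℂ)) y = if y = x then 1 else 0 := by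
  simp only [prodKet, Pi.single_apply, Finset.prod_ite_zero, Finset.prod_const_one, funext_iff,
    Finset.mem_univ, true_imp_iff]

variable {N : ℕ} {α : Type*} [Fintype α]

/-- The weights `t` for which some state `Δ` makes `(ρ + t Δ) / (1 + t)` separable, expressed
through the operator inequality `ρ ≤ (1 + t) σ` for the resulting separable state `σ`. -/
def robustnessWeights (ρ : Matrix (Fin N → α) (Fin N → α) ℂ) : Set ℝ :=
  {t | 0 ≤ t ∧ ∃ σ ∈ separableStates N α, ((1 + t) • σ - ρ).PosSemidef}

lemma globalRobustness_nonneg (ρ : Matrix (Fin N → α) (Fin N → α) ℂ) : 0 ≤ globalRobustness ρ :=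
  Real.sInf_nonneg fun _ ht => ht.1

lemma logGlobalRobustness_nonneg (ρ : Matrix (Fin N → α) (Fin N → α) ℂ) :
    0 ≤ logGlobalRobustness ρ :=
  Real.logb_nonneg one_lt_two (by linarith [globalRobustness_nonneg ρ])

section

variable [DecidableEq α]

lemma isUnitKet_single (a : α) : IsUnitKet (Pi.single a (1 : ℂ)) := by
  simp [isUnitKet_iff]

lemma sum_ketBra_prodKet_single :
    ∑ x : Fin N → α, ketBra (prodKet fun j => Pi.single (x j) (1 : ℂ)) = 1 := by
  ext y z
  simp only [Matrix.sum_apply, ketBra_apply, prodKet_single, Matrix.one_apply]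
  rw [Finset.sum_eq_single y]
  · simp [eq_comm]
  · intro x _ hx
    simp [hx.symm]
  · simp

lemma inv_card_smul_one_mem_separableStates [Nonempty (Fin N → α)] :
    ((Fintype.card (Fin N → α) : ℝ)⁻¹ • (1 : Matrix (Fin N → α) (Fin N → α) ℂ)) ∈
      separableStates N α := by
  rw [← sum_ketBra_prodKet_single, Finset.smul_sum]
  refine convex_separableStates.sum_mem (fun _ _ => by positivity) ?_
    fun x _ => ketBra_prodKet_mem_separableStates fun j => isUnitKet_single _
  rw [Finset.sum_const, Finset.card_univ, nsmul_eq_mul]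
  exact mul_inv_cancel₀ (Nat.cast_ne_zero.2 Fintype.card_ne_zero)

end

namespace IsDensityMatrix

lemma nonempty {n : Type*} [Fintype n] {ρ : Matrix n n ℂ} (hρ : IsDensityMatrix ρ) :
    Nonempty n := by
  by_contra hempty
  rw [not_nonempty_iff] at hempty
  simpa [Matrix.trace] using hρ.2

variable {ρ : Matrix (Fin N → α) (Fin N → α) ℂ}

lemma exists_separable_mix_iff (hρ : IsDensityMatrix ρ) {t : ℝ} (ht : 0 ≤ t) :
    (∃ Δ : Matrix (Fin N → α) (Fin N → α) ℂ,
      IsDensityMatrix Δ ∧ (1 + t)⁻¹ • (ρ + t • Δ) ∈ separableStates N α) ↔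
    ∃ σ ∈ separableStates N α, ((1 + t) • σ - ρ).PosSemidef := by
  constructor
  · rintro ⟨Δ, hΔ, hmix⟩
    refine ⟨_, hmix, ?_⟩
    rw [smul_inv_smul₀ (by linarith), add_sub_cancel_left]
    exact hΔ.1.smul ht
  · rintro ⟨σ, hσ, hpsd⟩
    have htr : ((1 + t) • σ - ρ).trace = (t : ℂ) := by
      rw [Matrix.trace_sub, Matrix.trace_smul, (isDensityMatrix_of_mem_separableStates hσ).2, hρ.2,
        Complex.real_smul]
      push_cast
      ring
    rcases ht.eq_or_lt with rfl | hpos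
    · have hσρ : σ = ρ := by
        have hzero := hpsd.trace_eq_zero_iff.1 (by rw [htr, Complex.ofReal_zero])
        simpa [sub_eq_zero] using hzero
      exact ⟨ρ, hρ, by simpa [← hσρ] using hσ⟩
    · refine ⟨t⁻¹ • ((1 + t) • σ - ρ), ⟨hpsd.smul (by positivity), ?_⟩, ?_⟩
      · rw [Matrix.trace_smul, htr, Complex.real_smul, ← Complex.ofReal_mul,
          inv_mul_cancel₀ hpos.ne', Complex.ofReal_one]
      · rw [smul_inv_smul₀ hpos.ne', add_sub_cancel, inv_smul_smul₀ (by linarith)]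
        exact hσ

lemma globalRobustness_eq (hρ : IsDensityMatrix ρ) :
    globalRobustness ρ = sInf (robustnessWeights ρ) := by
  refine congrArg sInf (Set.ext fun t => ?_)
  exact and_congr_right fun ht => hρ.exists_separable_mix_iff ht

lemma robustnessWeights_nonempty (hρ : IsDensityMatrix ρ) : (robustnessWeights ρ).Nonempty := by
  classical
  have := hρ.nonempty
  have hcard : (1 : ℝ) ≤ Fintype.card (Fin N → α) := Nat.one_le_cast.2 Fintype.card_pos
  refine ⟨Fintype.card (Fin N → α) - 1, by linarith, _, inv_card_smul_one_mem_separableStates, ?_⟩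
  rw [add_sub_cancel, smul_inv_smul₀ (by linarith)]
  exact hρ.one_sub_posSemidef

lemma globalRobustness_le (hρ : IsDensityMatrix ρ) {l : ℝ} (hl : 1 ≤ l)
    {σ : Matrix (Fin N → α) (Fin N → α) ℂ} (hσ : σ ∈ separableStates N α)
    (h : (l • σ - ρ).PosSemidef) : 1 + globalRobustness ρ ≤ l := by
  rw [hρ.globalRobustness_eq, ← le_sub_iff_add_le']
  exact csInf_le ⟨0, fun t ht => ht.1⟩ ⟨by linarith, σ, hσ, by rwa [add_sub_cancel]⟩

lemma logGlobalRobustness_le (hρ : IsDensityMatrix ρ) {l : ℝ} (hl : 1 ≤ l)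
    {σ : Matrix (Fin N → α) (Fin N → α) ℂ} (hσ : σ ∈ separableStates N α)
    (h : (l • σ - ρ).PosSemidef) : logGlobalRobustness ρ ≤ Real.logb 2 l :=
  Real.logb_le_logb_of_le one_lt_two (by linarith [globalRobustness_nonneg ρ])
    (hρ.globalRobustness_le hl hσ h)

lemma trace_mul_re_le_one (hρ : IsDensityMatrix ρ) {σ : Matrix (Fin N → α) (Fin N → α) ℂ}
    (hσ : σ ∈ separableStates N α) : (ρ * σ).trace.re ≤ 1 := by
  classical
  have hσd := isDensityMatrix_of_mem_separableStates hσ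
  have hnonneg := trace_mul_re_nonneg hρ.one_sub_posSemidef hσd.1
  rwa [sub_mul, one_mul, Matrix.trace_sub, hσd.2, Complex.sub_re, Complex.one_re,
    sub_nonneg] at hnonneg

lemma le_maxOverlapSq (hρ : IsDensityMatrix ρ) {σ : Matrix (Fin N → α) (Fin N → α) ℂ}
    (hσ : σ ∈ separableStates N α) : (ρ * σ).trace.re ≤ maxOverlapSq ρ :=
  le_csSup ⟨1, by rintro _ ⟨σ, hσ, rfl⟩; exact hρ.trace_mul_re_le_one hσ⟩ ⟨σ, hσ, rfl⟩

lemma maxOverlapSq_pos (hρ : IsDensityMatrix ρ) : 0 < maxOverlapSq ρ := by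
  classical
  have := hρ.nonempty
  refine lt_of_lt_of_le ?_ (hρ.le_maxOverlapSq inv_card_smul_one_mem_separableStates)
  rw [Matrix.mul_smul, mul_one, Matrix.trace_smul, hρ.2, Complex.smul_re, Complex.one_re,
    smul_eq_mul, mul_one, inv_pos]
  exact_mod_cast Fintype.card_pos

lemma maxOverlapSq_le (hρ : IsDensityMatrix ρ) {c : ℝ}
    (h : ∀ v : Fin N → α → ℂ, (∀ j, IsUnitKet (v j)) →
      (star (prodKet v) ⬝ᵥ ρ.mulVec (prodKet v)).re ≤ c) : maxOverlapSq ρ ≤ c := by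
  classical
  have := hρ.nonempty
  refine csSup_le (Set.Nonempty.image _ ⟨_, inv_card_smul_one_mem_separableStates⟩) ?_
  rintro _ ⟨σ, hσ, rfl⟩
  exact trace_mul_re_le_of_mem_separableStates h hσ

lemma geometricMeasure_eq (hρ : IsDensityMatrix ρ) :
    geometricMeasure ρ = -Real.logb 2 (maxOverlapSq ρ) := by
  rw [geometricMeasure, Real.logb, Real.log_sqrt hρ.maxOverlapSq_pos.le, Real.logb]
  ring

lemma geometricMeasure_nonneg (hρ : IsDensityMatrix ρ) : 0 ≤ geometricMeasure ρ := by
  rw [hρ.geometricMeasure_eq, neg_nonneg]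
  refine Real.logb_nonpos one_lt_two hρ.maxOverlapSq_pos.le (hρ.maxOverlapSq_le fun v hv => ?_)
  rw [← trace_mul_ketBra]
  exact hρ.trace_mul_re_le_one (ketBra_prodKet_mem_separableStates hv)

variable [DecidableEq α]

lemma neg_logb_le_relEntropyEntanglement (hρ : IsDensityMatrix ρ)
    {P : Matrix (Fin N → α) (Fin N → α) ℂ} (hP : P.IsHermitian) (hPP : P * P = P)
    (hPρ : P * ρ = ρ) {q : ℝ} (hq : 0 < q)
    (h : ∀ v : Fin N → α → ℂ, (∀ j, IsUnitKet (v j)) →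
      (star (prodKet v) ⬝ᵥ P.mulVec (prodKet v)).re ≤ q) :
    ((-Real.logb 2 q : ℝ) : EReal) ≤ relEntropyEntanglement ρ :=
  le_iInf₂ fun _ hσ => neg_logb_le_relativeEntropy hρ
    (isDensityMatrix_of_mem_separableStates hσ).1 hP hPP hPρ hq
    (trace_mul_re_le_of_mem_separableStates h hσ)

lemma relEntropyEntanglement_nonneg (hρ : IsDensityMatrix ρ) : 0 ≤ relEntropyEntanglement ρ := by
  have h := hρ.neg_logb_le_relEntropyEntanglement (P := 1) (q := 1) Matrix.isHermitian_one
    (one_mul 1) (one_mul ρ) one_pos fun v hv => by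
      rw [Matrix.one_mulVec, (isUnitKet_iff _).1 (IsUnitKet.prodKet hv), Complex.one_re]
  simpa using h

lemma relEntropyEntanglement_le_logb (hρ : IsDensityMatrix ρ) {t : ℝ}
    (ht : t ∈ robustnessWeights ρ) :
    relEntropyEntanglement ρ ≤ ((Real.logb 2 (1 + t) : ℝ) : EReal) := by
  obtain ⟨ht0, σ, hσ, h⟩ := ht
  exact iInf₂_le_of_le σ hσ (relativeEntropy_le_logb hρ
    (isDensityMatrix_of_mem_separableStates hσ).1 (by linarith) h)

lemma coe_toReal_relEntropyEntanglement (hρ : IsDensityMatrix ρ) :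
    ((relEntropyEntanglement ρ).toReal : EReal) = relEntropyEntanglement ρ := by
  obtain ⟨t, ht⟩ := hρ.robustnessWeights_nonempty
  exact EReal.coe_toReal
    (ne_top_of_le_ne_top (EReal.coe_ne_top _) (hρ.relEntropyEntanglement_le_logb ht))
    (ne_bot_of_le_ne_bot EReal.zero_ne_bot hρ.relEntropyEntanglement_nonneg)

lemma relEntropyEntanglement_le_logGlobalRobustness (hρ : IsDensityMatrix ρ) :
    relEntropyEntanglement ρ ≤ ((logGlobalRobustness ρ : ℝ) : EReal) := by
  rw [← hρ.coe_toReal_relEntropyEntanglement, EReal.coe_le_coe_iff, logGlobalRobustness,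
    Real.le_logb_iff_rpow_le one_lt_two (by linarith [globalRobustness_nonneg ρ]),
    ← sub_le_iff_le_add', hρ.globalRobustness_eq]
  refine le_csInf hρ.robustnessWeights_nonempty fun t ht => ?_
  have hle := hρ.relEntropyEntanglement_le_logb ht
  rwa [← hρ.coe_toReal_relEntropyEntanglement, EReal.coe_le_coe_iff,
    Real.le_logb_iff_rpow_le one_lt_two (by linarith [ht.1]), ← sub_le_iff_le_add'] at hle

end IsDensityMatrix

end EntanglementMeasures

section Subadditivity

variable {N : ℕ} {α β γ : Type*} (e : γ ≃ α × β)
  {ρ σ : Matrix (Fin N → α) (Fin N → α) ℂ} {ρ' σ' : Matrix (Fin N → β) (Fin N → β) ℂ}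

lemma trace_mul_im_eq_zero {n : Type*} [Fintype n] {A B : Matrix n n ℂ} (hA : A.IsHermitian)
    (hB : B.IsHermitian) : (A * B).trace.im = 0 := by
  rw [← Complex.conj_eq_iff_im, starRingEnd_apply, ← Matrix.trace_conjTranspose,
    Matrix.conjTranspose_mul, hA.eq, hB.eq, Matrix.trace_mul_comm]

lemma joinOp_sub_posSemidef [Finite α] [Finite β] (hρ : ρ.PosSemidef) (hσ' : σ'.PosSemidef)
    {l l' : ℝ} (hl' : 0 ≤ l') (h : (l • σ - ρ).PosSemidef)
    (h' : (l' • σ' - ρ').PosSemidef) :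
    ((l * l') • joinOp e σ σ' - joinOp e ρ ρ').PosSemidef := by
  have htelescope : (l * l') • joinOp e σ σ' - joinOp e ρ ρ' =
      joinOp e (l • σ - ρ) (l' • σ') + joinOp e ρ (l' • σ' - ρ') := by
    ext x y
    simp only [joinOp_apply, Matrix.sub_apply, Matrix.smul_apply, Matrix.add_apply,
      Complex.real_smul]
    push_cast
    ring
  rw [htelescope]
  exact (joinOp_posSemidef e h (hσ'.smul hl')).add (joinOp_posSemidef e hρ h')

variable [Fintype α] [Fintype β] [Fintype γ]

lemma maxOverlapSq_mul_le_maxOverlapSq_joinOp (hρ : IsDensityMatrix ρ)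
    (hρ' : IsDensityMatrix ρ') :
    maxOverlapSq ρ * maxOverlapSq ρ' ≤ maxOverlapSq (joinOp e ρ ρ') := by
  classical
  have := hρ.nonempty
  have := hρ'.nonempty
  refine mul_le_of_forall_lt_of_nonneg hρ.maxOverlapSq_pos.le (hρ.joinOp e hρ').maxOverlapSq_pos.le
    fun a ha haρ b hb hbρ' => ?_
  obtain ⟨_, ⟨σ, hσ, rfl⟩, haσ⟩ :=
    exists_lt_of_lt_csSup (Set.Nonempty.image _ ⟨_, inv_card_smul_one_mem_separableStates⟩) haρ
  obtain ⟨_, ⟨σ', hσ', rfl⟩, hbσ'⟩ :=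
    exists_lt_of_lt_csSup (Set.Nonempty.image _ ⟨_, inv_card_smul_one_mem_separableStates⟩) hbρ'
  calc a * b ≤ (ρ * σ).trace.re * (ρ' * σ').trace.re :=
        mul_le_mul haσ.le hbσ'.le hb (ha.trans haσ.le)
    _ = (joinOp e ρ ρ' * joinOp e σ σ').trace.re := by
        rw [joinOp_mul_joinOp, trace_joinOp, Complex.mul_re, trace_mul_im_eq_zero hρ.1.1
          (isDensityMatrix_of_mem_separableStates hσ).1.1, zero_mul, sub_zero]
    _ ≤ maxOverlapSq (joinOp e ρ ρ') :=
        (hρ.joinOp e hρ').le_maxOverlapSq (joinOp_mem_separableStates e hσ hσ')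

lemma geometricMeasure_joinOp_le (hρ : IsDensityMatrix ρ) (hρ' : IsDensityMatrix ρ') :
    geometricMeasure (joinOp e ρ ρ') ≤ geometricMeasure ρ + geometricMeasure ρ' := by
  rw [hρ.geometricMeasure_eq, hρ'.geometricMeasure_eq, (hρ.joinOp e hρ').geometricMeasure_eq,
    ← neg_add, neg_le_neg_iff,
    ← Real.logb_mul hρ.maxOverlapSq_pos.ne' hρ'.maxOverlapSq_pos.ne']
  exact Real.logb_le_logb_of_le one_lt_two (mul_pos hρ.maxOverlapSq_pos hρ'.maxOverlapSq_pos)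
    (maxOverlapSq_mul_le_maxOverlapSq_joinOp e hρ hρ')

lemma one_add_globalRobustness_joinOp_le (hρ : IsDensityMatrix ρ) (hρ' : IsDensityMatrix ρ') :
    1 + globalRobustness (joinOp e ρ ρ') ≤
      (1 + globalRobustness ρ) * (1 + globalRobustness ρ') := by
  refine le_mul_of_forall_lt₀ fun a ha b hb => ?_
  rw [hρ.globalRobustness_eq, gt_iff_lt, ← lt_sub_iff_add_lt'] at ha
  rw [hρ'.globalRobustness_eq, gt_iff_lt, ← lt_sub_iff_add_lt'] at hb
  obtain ⟨t, ⟨ht, σ, hσ, h⟩, hta⟩ := exists_lt_of_csInf_lt hρ.robustnessWeights_nonempty ha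
  obtain ⟨t', ⟨ht', σ', hσ', h'⟩, htb⟩ := exists_lt_of_csInf_lt hρ'.robustnessWeights_nonempty hb
  have hσ'psd := (isDensityMatrix_of_mem_separableStates hσ').1
  calc 1 + globalRobustness (joinOp e ρ ρ') ≤ (1 + t) * (1 + t') :=
        (hρ.joinOp e hρ').globalRobustness_le (by nlinarith) (joinOp_mem_separableStates e hσ hσ')
          (joinOp_sub_posSemidef e hρ.1 hσ'psd (by linarith) h h')
    _ ≤ a * b := by gcongr <;> linarith

lemma logGlobalRobustness_joinOp_le (hρ : IsDensityMatrix ρ) (hρ' : IsDensityMatrix ρ') :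
    logGlobalRobustness (joinOp e ρ ρ') ≤ logGlobalRobustness ρ + logGlobalRobustness ρ' := by
  have hnonneg := globalRobustness_nonneg ρ
  have hnonneg' := globalRobustness_nonneg ρ'
  have hnonneg_join := globalRobustness_nonneg (joinOp e ρ ρ')
  rw [logGlobalRobustness, logGlobalRobustness, logGlobalRobustness,
    ← Real.logb_mul (by linarith) (by linarith)]
  exact Real.logb_le_logb_of_le one_lt_two (by linarith)
    (one_add_globalRobustness_joinOp_le e hρ hρ')

lemma relEntropyEntanglement_joinOp_le [DecidableEq α] [DecidableEq β] [DecidableEq γ]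
    (hρ : IsDensityMatrix ρ) (hρ' : IsDensityMatrix ρ') :
    relEntropyEntanglement (joinOp e ρ ρ') ≤
      relEntropyEntanglement ρ + relEntropyEntanglement ρ' := by
  have hbot := ne_bot_of_le_ne_bot EReal.zero_ne_bot hρ.relEntropyEntanglement_nonneg
  have hbot' := ne_bot_of_le_ne_bot EReal.zero_ne_bot hρ'.relEntropyEntanglement_nonneg
  refine EReal.le_add_of_forall_gt (.inl hbot) (.inr hbot') fun a ha b hb => ?_
  simp only [relEntropyEntanglement, gt_iff_lt, iInf_lt_iff, exists_prop] at ha hb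
  obtain ⟨σ, hσ, hσa⟩ := ha
  obtain ⟨σ', hσ', hσb⟩ := hb
  exact (iInf₂_le_of_le _ (joinOp_mem_separableStates e hσ hσ') (relativeEntropy_joinOp_le e hρ
    (isDensityMatrix_of_mem_separableStates hσ) hρ'
    (isDensityMatrix_of_mem_separableStates hσ'))).trans (add_le_add hσa.le hσb.le)

end Subadditivity

section Nonadditivity

variable {N : ℕ} {α : Type} [Fintype α] [DecidableEq α] {ρ : Matrix (Fin N → α) (Fin N → α) ℂ}

lemma isNonadditive_of_subadditive
    {E : ∀ (α : Type) [Fintype α] [DecidableEq α], Matrix (Fin N → α) (Fin N → α) ℂ → EReal}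
    (u : ℕ → ℝ) (hEu : ∀ n, E (Fin n → α) (tensorPower ρ n) = (u n : EReal))
    (hsub : ∀ m n, u (m + n) ≤ u m + u n) (hnonneg : ∀ n, 0 ≤ u n) {v : ℝ}
    (hEv : E α ρ = (v : EReal)) (hlt : u 2 < 2 * v) : IsNonadditive E ρ := by
  have hu : Subadditive u := hsub
  have hbdd : BddBelow (Set.range fun n : ℕ => u n / n) :=
    ⟨0, by rintro _ ⟨n, rfl⟩; exact div_nonneg (hnonneg n) (Nat.cast_nonneg n)⟩
  refine ⟨hu.lim, ?_, ?_⟩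
  · refine ((continuous_coe_real_ereal.tendsto hu.lim).comp
      (hu.tendsto_lim hbdd)).congr fun n => ?_
    rw [hEu, Function.comp_apply, EReal.coe_div]
    rfl
  · rw [hEv, Ne, EReal.coe_eq_coe_iff]
    have hle := hu.lim_le_div hbdd two_ne_zero
    rw [Nat.cast_ofNat, le_div_iff₀ two_pos] at hle
    exact fun heq => by linarith

lemma isNonadditive_geometricMeasure (hρ : IsDensityMatrix ρ)
    (h : geometricMeasure (tensorPower ρ 2) < 2 * geometricMeasure ρ) :
    IsNonadditive (fun _ _ _ τ => ((geometricMeasure τ : ℝ) : EReal)) ρ :=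
  isNonadditive_of_subadditive (fun n => geometricMeasure (tensorPower ρ n)) (fun _ => rfl)
    (fun m n => by
      rw [tensorPower_add]
      exact geometricMeasure_joinOp_le _ (hρ.tensorPower m) (hρ.tensorPower n))
    (fun n => (hρ.tensorPower n).geometricMeasure_nonneg) rfl h

lemma isNonadditive_logGlobalRobustness (hρ : IsDensityMatrix ρ)
    (h : logGlobalRobustness (tensorPower ρ 2) < 2 * logGlobalRobustness ρ) :
    IsNonadditive (fun _ _ _ τ => ((logGlobalRobustness τ : ℝ) : EReal)) ρ :=
  isNonadditive_of_subadditive (fun n => logGlobalRobustness (tensorPower ρ n)) (fun _ => rfl)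
    (fun m n => by
      rw [tensorPower_add]
      exact logGlobalRobustness_joinOp_le _ (hρ.tensorPower m) (hρ.tensorPower n))
    (fun n => logGlobalRobustness_nonneg _) rfl h

lemma isNonadditive_relEntropyEntanglement (hρ : IsDensityMatrix ρ)
    (h : relEntropyEntanglement (tensorPower ρ 2) < 2 * relEntropyEntanglement ρ) :
    IsNonadditive (fun _ _ _ τ => relEntropyEntanglement τ) ρ := by
  have hcoe := fun n => (hρ.tensorPower n).coe_toReal_relEntropyEntanglement
  refine isNonadditive_of_subadditive
    (fun n => (relEntropyEntanglement (tensorPower ρ n)).toReal) (fun n => (hcoe n).symm)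
    (fun m n => ?_) (fun n => ?_) hρ.coe_toReal_relEntropyEntanglement.symm ?_
  · rw [← EReal.coe_le_coe_iff, EReal.coe_add, hcoe, hcoe, hcoe, tensorPower_add]
    exact relEntropyEntanglement_joinOp_le _ (hρ.tensorPower m) (hρ.tensorPower n)
  · exact EReal.toReal_nonneg (hρ.tensorPower n).relEntropyEntanglement_nonneg
  · rw [← EReal.coe_lt_coe_iff, EReal.coe_mul, hcoe, hρ.coe_toReal_relEntropyEntanglement]
    exact h

end Nonadditivity

section Slater

lemma ofReal_sqrt_natCast_mul_self (n : ℕ) : ((√(n : ℝ) : ℝ) : ℂ) * ((√(n : ℝ) : ℝ) : ℂ) = n := by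
  rw [← Complex.ofReal_mul, Real.mul_self_sqrt n.cast_nonneg, Complex.ofReal_natCast]

lemma ofReal_sqrt_natCast_ne_zero {n : ℕ} (hn : n ≠ 0) : ((√(n : ℝ) : ℝ) : ℂ) ≠ 0 := by
  simpa using hn

lemma norm_ofReal_sqrt_natCast_sq (n : ℕ) : ‖((√(n : ℝ) : ℝ) : ℂ)‖ ^ 2 = n := by
  rw [Complex.norm_real, Real.norm_eq_abs, sq_abs, Real.sq_sqrt n.cast_nonneg]

lemma intUnit_mul_self (u : ℤˣ) : ((u : ℤ) : ℂ) * ((u : ℤ) : ℂ) = 1 :=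
  mod_cast Int.units_coe_mul_self u

lemma norm_intUnit (u : ℤˣ) : ‖((u : ℤ) : ℂ)‖ = 1 := by
  rcases Int.units_eq_one_or u with rfl | rfl <;> simp

variable {N : ℕ} {α : Type*}

lemma isUnitKet_ofLp_iff [Fintype α] (v : EuclideanSpace ℂ α) : IsUnitKet v.ofLp ↔ ‖v‖ = 1 := by
  rw [IsUnitKet, ← EuclideanSpace.norm_sq_eq, pow_eq_one_iff_of_nonneg (norm_nonneg v) two_ne_zero]

lemma slaterKet_apply (a : Fin N → EuclideanSpace ℂ α) (x : Fin N → α) :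
    slaterKet a x = ((√(N ! : ℝ) : ℝ) : ℂ)⁻¹ * (Matrix.of fun i j => a i (x j)).det := by
  rw [Matrix.det_apply']
  rfl

lemma sqrt_factorial_smul_slaterKet (a : Fin N → EuclideanSpace ℂ α) :
    ((√(N ! : ℝ) : ℝ) : ℂ) • slaterKet a =
      ∑ π : Equiv.Perm (Fin N),
        ((Equiv.Perm.sign π : ℤ) : ℂ) • prodKet fun j => (a (π j)).ofLp := by
  funext x
  rw [Pi.smul_apply, slaterKet, smul_eq_mul,
    mul_inv_cancel_left₀ (ofReal_sqrt_natCast_ne_zero N.factorial_ne_zero), Finset.sum_apply]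
  rfl

lemma slaterKet_comp_perm (a : Fin N → EuclideanSpace ℂ α) (π : Equiv.Perm (Fin N)) :
    slaterKet (a ∘ π) = ((Equiv.Perm.sign π : ℤ) : ℂ) • slaterKet a := by
  funext x
  rw [Pi.smul_apply, slaterKet_apply, slaterKet_apply, smul_eq_mul, mul_left_comm,
    ← Matrix.det_permute]
  rfl

lemma slaterKet_comp_eq_zero (a : Fin N → EuclideanSpace ℂ α) {f : Fin N → Fin N}
    (hf : ¬ Function.Injective f) : slaterKet (a ∘ f) = 0 := by
  obtain ⟨i, j, hfij, hij⟩ := Function.not_injective_iff.1 hf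
  funext x
  rw [slaterKet_apply, Matrix.det_zero_of_row_eq hij, mul_zero, Pi.zero_apply]
  simp [funext_iff, hfij]

lemma slaterKet_sum_smul (C : Matrix (Fin N) (Fin N) ℂ) (b : Fin N → EuclideanSpace ℂ α) :
    slaterKet (fun i => ∑ j, C i j • b j) = C.det • slaterKet b := by
  funext x
  rw [Pi.smul_apply, slaterKet_apply, slaterKet_apply, smul_eq_mul, mul_left_comm,
    ← Matrix.det_mul]
  congr 2
  ext i j
  simp [Matrix.mul_apply]

lemma slaterKet_eq_zero_of_not_linearIndependent {v : Fin N → EuclideanSpace ℂ α}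
    (hv : ¬ LinearIndependent ℂ v) : slaterKet v = 0 := by
  obtain ⟨g, hgv, i, hgi⟩ := Fintype.not_linearIndependent_iff.1 hv
  funext x
  have hdet : (Matrix.of fun i j => v i (x j)).det = 0 :=
    Matrix.exists_vecMul_eq_zero_iff.1 ⟨g, Function.ne_iff.2 ⟨i, hgi⟩, funext fun j => by
      simpa [Matrix.vecMul, dotProduct] using congrArg (fun w => w.ofLp (x j)) hgv⟩
  rw [slaterKet_apply, hdet, mul_zero, Pi.zero_apply]

lemma slaterKet_eq_zero_or_exists_orthonormal [Fintype α] (v : Fin N → EuclideanSpace ℂ α) :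
    slaterKet v = 0 ∨ ∃ (b : Fin N → EuclideanSpace ℂ α) (c : ℂ), Orthonormal ℂ b ∧
      slaterKet v = c • slaterKet b := by
  by_cases hv : LinearIndependent ℂ v
  · set W := Submodule.span ℂ (Set.range v)
    have hW : Module.finrank ℂ W = N := by
      rw [finrank_span_eq_card hv, Fintype.card_fin]
    let b : OrthonormalBasis (Fin N) ℂ W := (stdOrthonormalBasis ℂ W).reindex (finCongr hW)
    let w (i : Fin N) : W := ⟨v i, Submodule.subset_span ⟨i, rfl⟩⟩
    have hvb : v = fun i => ∑ j, ⟪b j, w i⟫_ℂ • (b j : EuclideanSpace ℂ α) := by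
      funext i
      simpa [w] using congrArg Subtype.val (b.sum_repr' (w i)).symm
    refine .inr ⟨fun j => b j, (Matrix.of fun i j => ⟪b j, w i⟫_ℂ).det,
      b.orthonormal.comp_linearIsometry W.subtypeₗᵢ, ?_⟩
    rw [← slaterKet_sum_smul]
    exact congrArg slaterKet hvb
  · exact .inl (slaterKet_eq_zero_of_not_linearIndependent hv)

/-- Vectors of `(ℂ^α)^{⊗N}` that change sign under odd permutations of the `N` particles. -/
def IsAntisymmetric (ψ : (Fin N → α) → ℂ) : Prop :=
  ∀ (π : Equiv.Perm (Fin N)) (x : Fin N → α),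
    ψ (x ∘ π) = ((Equiv.Perm.sign π : ℤ) : ℂ) * ψ x

lemma isAntisymmetric_slaterKet (a : Fin N → EuclideanSpace ℂ α) :
    IsAntisymmetric (slaterKet a) := fun π x => by
  rw [slaterKet_apply, slaterKet_apply, mul_left_comm, ← Matrix.det_permute']
  rfl

end Slater

section Antisymmetrizer

variable {N : ℕ} {α : Type*} [DecidableEq α]

/-- The projection of `(ℂ^α)^{⊗N}` onto its antisymmetric subspace. The determinant is
`∑_π sgn(π) [x ∘ π = y]`. -/
noncomputable def antisymProj (N : ℕ) (α : Type*) [DecidableEq α] :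
    Matrix (Fin N → α) (Fin N → α) ℂ :=
  Matrix.of fun x y => (N ! : ℂ)⁻¹ * ((1 : Matrix α α ℂ).submatrix x y).det

lemma isHermitian_antisymProj : (antisymProj N α).IsHermitian := by
  ext x y
  simp only [Matrix.conjTranspose_apply, antisymProj, Matrix.of_apply, star_mul', star_inv₀,
    star_natCast]
  rw [← Matrix.det_conjTranspose, Matrix.conjTranspose_submatrix, Matrix.conjTranspose_one]

variable [Fintype α]

lemma antisymProj_mulVec (ψ : (Fin N → α) → ℂ) (x : Fin N → α) :
    (antisymProj N α *ᵥ ψ) x =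
      (N ! : ℂ)⁻¹ * ∑ π : Equiv.Perm (Fin N), ((Equiv.Perm.sign π : ℤ) : ℂ) * ψ (x ∘ π) := by
  have hprod (π : Equiv.Perm (Fin N)) (y : Fin N → α) :
      ∏ j, (1 : Matrix α α ℂ) (x (π j)) (y j) = if x ∘ π = y then 1 else 0 := by
    simp [Matrix.one_apply, Finset.prod_ite_zero, funext_iff]
  simp only [Matrix.mulVec, dotProduct, antisymProj, Matrix.of_apply, mul_assoc,
    ← Finset.mul_sum, Matrix.det_apply', Matrix.submatrix_apply, hprod, Finset.sum_mul]
  rw [Finset.sum_comm]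
  simp

lemma isAntisymmetric_antisymProj_mulVec (ψ : (Fin N → α) → ℂ) :
    IsAntisymmetric (antisymProj N α *ᵥ ψ) := fun π x => by
  simp only [Matrix.mulVec, dotProduct, antisymProj, Matrix.of_apply, Finset.mul_sum]
  refine Finset.sum_congr rfl fun y _ => ?_
  rw [← mul_assoc, mul_left_comm, ← Matrix.det_permute]
  rfl

lemma IsAntisymmetric.antisymProj_mulVec {ψ : (Fin N → α) → ℂ} (hψ : IsAntisymmetric ψ) :
    antisymProj N α *ᵥ ψ = ψ := by
  have hfac : (N ! : ℂ) ≠ 0 := Nat.cast_ne_zero.2 N.factorial_ne_zero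
  funext x
  rw [MultipartiteEntanglement.antisymProj_mulVec]
  simp only [hψ _ x, ← mul_assoc, intUnit_mul_self, one_mul, Finset.sum_const, Finset.card_univ,
    Fintype.card_perm, Fintype.card_fin, nsmul_eq_mul]
  rw [inv_mul_cancel₀ hfac, one_mul]

lemma antisymProj_mul_self : antisymProj N α * antisymProj N α = antisymProj N α := by
  refine Matrix.ext_of_mulVec_single fun y => ?_
  rw [← Matrix.mulVec_mulVec]
  exact (isAntisymmetric_antisymProj_mulVec _).antisymProj_mulVec

lemma antisymProj_mulVec_prodKet (v : Fin N → α → ℂ) :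
    antisymProj N α *ᵥ prodKet v =
      ((√(N ! : ℝ) : ℝ) : ℂ)⁻¹ • slaterKet fun j => WithLp.toLp 2 (v j) := by
  funext x
  rw [antisymProj_mulVec, Pi.smul_apply, slaterKet_apply, smul_eq_mul, ← mul_assoc, ← mul_inv,
    ofReal_sqrt_natCast_mul_self, ← Matrix.det_transpose, Matrix.det_apply']
  rfl

end Antisymmetrizer

section SlaterOverlap

variable {N : ℕ} {α : Type*} [Fintype α]

lemma star_slaterKet_dotProduct (a b : Fin N → EuclideanSpace ℂ α) :
    star (slaterKet a) ⬝ᵥ slaterKet b = (Matrix.of fun i j => ⟪a i, b j⟫_ℂ).det := by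
  classical
  have hs := ofReal_sqrt_natCast_ne_zero N.factorial_ne_zero
  have ha : slaterKet a = ((√(N ! : ℝ) : ℝ) : ℂ) •
      antisymProj N α *ᵥ prodKet fun j => (a j).ofLp := by
    rw [antisymProj_mulVec_prodKet, smul_inv_smul₀ hs]
  rw [ha, star_smul, smul_dotProduct, star_mulVec_dotProduct_of_isHermitian isHermitian_antisymProj,
    (isAntisymmetric_slaterKet b).antisymProj_mulVec, Complex.star_def, Complex.conj_ofReal,
    ← dotProduct_smul, sqrt_factorial_smul_slaterKet, dotProduct_sum, ← Matrix.det_transpose,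
    Matrix.det_apply']
  refine Finset.sum_congr rfl fun π _ => ?_
  rw [dotProduct_smul, star_prodKet_dotProduct, smul_eq_mul]
  congr 1
  exact Finset.prod_congr rfl fun j _ => dotProduct_comm _ _

lemma isUnitKet_slaterKet {a : Fin N → EuclideanSpace ℂ α} (ha : Orthonormal ℂ a) :
    IsUnitKet (slaterKet a) := by
  rw [isUnitKet_iff, star_slaterKet_dotProduct, ← Matrix.det_one (n := Fin N) (R := ℂ)]
  congr 1
  ext i j
  rw [Matrix.of_apply, orthonormal_iff_ite.1 ha, Matrix.one_apply]

end SlaterOverlap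

section FermionicOverlap

variable {N : ℕ} {α γ : Type*} {E : Type*} [NormedAddCommGroup E] [InnerProductSpace ℂ E]

lemma prod_ofFn_sum_smul_apply [Fintype γ] (v : Fin N → γ → ℂ) (b : γ → E →L[ℂ] E) (ψ : E) :
    (List.ofFn fun j => ∑ i, v j i • b i).prod ψ =
      ∑ x : Fin N → γ, prodKet v x • (List.ofFn (b ∘ x)).prod ψ := by
  rw [prod_ofFn_sum_smul, sum_apply]
  rfl

lemma star_prodKet_dotProduct_gram_mulVec_prodKet [Fintype γ] (v : Fin N → γ → ℂ)
    (b : γ → E →L[ℂ] E) (ψ : E) :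
    (star (prodKet v) ⬝ᵥ
        Matrix.gram ℂ (fun x : Fin N → γ => (List.ofFn (b ∘ x)).prod ψ) *ᵥ prodKet v).re =
      ‖(List.ofFn fun j => ∑ i, v j i • b i).prod ψ‖ ^ 2 := by
  rw [Matrix.star_dotProduct_gram_mulVec, ← prod_ofFn_sum_smul_apply,
    ← inner_self_eq_norm_sq (𝕜 := ℂ)]
  rfl

variable {c d : α → E →L[ℂ] E} {Ω : E}

lemma IsVacuum.inner_self (hΩ : IsVacuum c Ω) : ⟪Ω, Ω⟫_ℂ = 1 := by
  rw [inner_self_eq_norm_sq_to_K, hΩ.norm_eq_one, RCLike.ofReal_one, one_pow]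

variable [CompleteSpace E] [DecidableEq α]

lemma IsCAR.gram_prod_ofFn_star_apply (hc : IsCAR c) (hΩ : IsVacuum c Ω) :
    Matrix.gram ℂ (fun x : Fin N → α => (List.ofFn ((star ∘ c) ∘ x)).prod Ω) =
      N ! • antisymProj N α := by
  ext x y
  rw [Matrix.gram_apply, Matrix.smul_apply, antisymProj, Matrix.of_apply, nsmul_eq_mul,
    mul_inv_cancel_left₀ (Nat.cast_ne_zero.2 N.factorial_ne_zero),
    ← mul_one (Matrix.det _), ← hΩ.inner_self]
  exact hc.inner_prod_ofFn_star_apply x y Ω hΩ.apply_eq_zero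

lemma IsCommutingCAR.apply_prod_ofFn_star_apply_eq_zero (hcd : IsCommutingCAR c d)
    (hc : IsVacuum c Ω) (x : Fin N → α) (i : α) :
    c i ((List.ofFn fun j => star (d (x j))).prod Ω) = 0 := by
  have hcomm : Commute (c i) (List.ofFn fun j => star (d (x j))).prod :=
    Commute.list_prod_right _ _ (by simpa using fun j => hcd.comm_star i (x j))
  rw [← mul_apply_eq_comp, hcomm.eq, mul_apply_eq_comp, hc.apply_eq_zero, map_zero]

lemma IsCommutingCAR.gram_prod_ofFn_star_mul_star_apply (e : γ ≃ α × α)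
    (hcd : IsCommutingCAR c d) (hc : IsVacuum c Ω) (hd : IsVacuum d Ω) :
    Matrix.gram ℂ (fun x : Fin N → γ =>
        (List.ofFn ((fun z => star (c (e z).1) * star (d (e z).2)) ∘ x)).prod Ω) =
      N ! ^ 2 • joinOp e (antisymProj N α) (antisymProj N α) := by
  have hprod (x : Fin N → γ) :
      (List.ofFn ((fun z => star (c (e z).1) * star (d (e z).2)) ∘ x)).prod Ω =
        (List.ofFn fun j => star (c (e (x j)).1)).prod
          ((List.ofFn fun j => star (d (e (x j)).2)).prod Ω) := by
    rw [← mul_apply_eq_comp, ← prod_ofFn_mul fun i j => (hcd.comm _ _).star_star]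
    rfl
  have hfac : (N ! : ℂ) ≠ 0 := Nat.cast_ne_zero.2 N.factorial_ne_zero
  ext x y
  rw [Matrix.gram_apply, hprod, hprod, hcd.left.inner_prod_ofFn_star_apply _ _ _
    (hcd.apply_prod_ofFn_star_apply_eq_zero hc _),
    hcd.right.inner_prod_ofFn_star_apply _ _ _ hd.apply_eq_zero, hd.inner_self, mul_one,
    Matrix.smul_apply, joinOp_apply, antisymProj, Matrix.of_apply, Matrix.of_apply, nsmul_eq_mul,
    Nat.cast_pow, mul_mul_mul_comm, ← mul_inv, ← pow_two, mul_inv_cancel_left₀ (pow_ne_zero 2 hfac)]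
  rfl

variable [Fintype α]

lemma antisymProj_overlap_le {v : Fin N → α → ℂ} (hv : ∀ j, IsUnitKet (v j)) :
    (star (prodKet v) ⬝ᵥ antisymProj N α *ᵥ prodKet v).re ≤ (N ! : ℝ)⁻¹ := by
  obtain ⟨m, _, c, d, Ω, hcd, hc, -⟩ := exists_isCommutingCAR α
  have hgram := star_prodKet_dotProduct_gram_mulVec_prodKet v (star ∘ c) Ω
  rw [hcd.left.gram_prod_ofFn_star_apply hc, Matrix.smul_mulVec, dotProduct_smul,
    Complex.smul_re, nsmul_eq_mul] at hgram
  rw [← one_div, le_div_iff₀' (mod_cast N.factorial_pos), hgram, sq_le_one_iff_abs_le_one,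
    abs_norm, ← hc.norm_eq_one]
  exact hcd.left.norm_prod_creation_apply_le hv Ω

lemma joinOp_antisymProj_overlap_le [Fintype γ] (e : γ ≃ α × α) (hN : N ≤ Fintype.card α)
    {v : Fin N → γ → ℂ} (hv : ∀ j, IsUnitKet (v j)) :
    N ! * (Fintype.card α : ℝ) ^ N *
        (star (prodKet v) ⬝ᵥ joinOp e (antisymProj N α) (antisymProj N α) *ᵥ prodKet v).re ≤
      (Fintype.card α).descFactorial N := by
  obtain ⟨m, _, c, d, Ω, hcd, hc, hd⟩ := exists_isCommutingCAR α
  have hgram := star_prodKet_dotProduct_gram_mulVec_prodKet v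
    (fun z => star (c (e z).1) * star (d (e z).2)) Ω
  have hpair (j : Fin N) : ∑ z, v j z • (star (c (e z).1) * star (d (e z).2)) =
      pairCreation c d fun a b => v j (e.symm (a, b)) := by
    rw [← e.symm.sum_comp, Fintype.sum_prod_type]
    simp only [e.apply_symm_apply, pairCreation, creation, Finset.mul_sum, mul_smul_comm]
  have hunit (j : Fin N) : ∑ a, ∑ b, ‖v j (e.symm (a, b))‖ ^ 2 = 1 := by
    rw [← Fintype.sum_prod_type', e.symm.sum_comp fun z => ‖v j z‖ ^ 2, hv j]
  have hbound := hcd.card_pow_mul_norm_prod_pairCreation_apply_sq_le hc hd hN hunit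
  simp only [hpair] at hgram
  rw [← hgram, hcd.gram_prod_ofFn_star_mul_star_apply e hc hd, Matrix.smul_mulVec,
    dotProduct_smul, Complex.smul_re, nsmul_eq_mul, Nat.cast_pow] at hbound
  refine le_of_mul_le_mul_left ?_ (Nat.cast_pos.2 N.factorial_pos : (0 : ℝ) < N !)
  linarith

end FermionicOverlap

section Domination

lemma ketBra_smul {n : Type*} (c : ℂ) (ψ : n → ℂ) : ketBra (c • ψ) = ‖c‖ ^ 2 • ketBra ψ := by
  ext x y
  rw [Matrix.smul_apply, ketBra_apply, ketBra_apply, Pi.smul_apply, Pi.smul_apply, smul_eq_mul,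
    smul_eq_mul, star_mul', Complex.real_smul, mul_mul_mul_comm, Complex.star_def,
    Complex.mul_conj', Complex.ofReal_pow]

lemma posSemidef_card_smul_sum_ketBra_sub {n K : Type*} [Finite n] [Fintype K]
    (χ : K → n → ℂ) :
    ((Fintype.card K : ℝ) • ∑ k, ketBra (χ k) - ketBra (∑ k, χ k)).PosSemidef := by
  have := Fintype.ofFinite n
  have hform (ψ w : n → ℂ) : star w ⬝ᵥ ketBra ψ *ᵥ w = ((‖star ψ ⬝ᵥ w‖ ^ 2 : ℝ) : ℂ) := by
    rw [ketBra_mulVec, dotProduct_smul, smul_eq_mul, mul_comm,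
      star_dotProduct_mul_star_dotProduct, norm_star_dotProduct_comm]
  refine .of_dotProduct_mulVec_nonneg (((Matrix.posSemidef_sum _ fun k _ =>
    posSemidef_ketBra (χ k)).smul (Nat.cast_nonneg _)).isHermitian.sub
      (posSemidef_ketBra _).isHermitian) fun w => ?_
  rw [Matrix.sub_mulVec, dotProduct_sub, Matrix.smul_mulVec, dotProduct_smul, Matrix.sum_mulVec,
    dotProduct_sum]
  simp only [hform]
  rw [Complex.real_smul, ← Complex.ofReal_sum, ← Complex.ofReal_mul, ← Complex.ofReal_sub,
    Complex.zero_le_real, sub_nonneg, star_sum, sum_dotProduct]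
  calc ‖∑ k, star (χ k) ⬝ᵥ w‖ ^ 2 ≤ (∑ k, ‖star (χ k) ⬝ᵥ w‖) ^ 2 := by
        gcongr
        exact norm_sum_le _ _
    _ ≤ Fintype.card K * ∑ k, ‖star (χ k) ⬝ᵥ w‖ ^ 2 := sq_sum_le_card_mul_sum_sq

variable {N : ℕ} {α : Type*} [Fintype α] {l : ℝ}

lemma exists_separable_of_average {K : Type*} [Fintype K] [Nonempty K] {ψ : (Fin N → α) → ℂ}
    {c : K → ℂ} {v : K → Fin N → α → ℂ} (hc : ∀ k, ‖c k‖ ^ 2 = l)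
    (hv : ∀ k j, IsUnitKet (v k j))
    (hψ : ψ = (Fintype.card K : ℂ)⁻¹ • ∑ k, c k • prodKet (v k)) :
    ∃ σ ∈ separableStates N α, (l • σ - ketBra ψ).PosSemidef := by
  set D : ℝ := (Fintype.card K : ℝ) with hcard
  have hD : 0 < D := Nat.cast_pos.2 Fintype.card_pos
  refine ⟨∑ k, D⁻¹ • ketBra (prodKet (v k)), convex_separableStates.sum_mem
    (fun _ _ => (inv_pos.2 hD).le) ?_ fun k _ => ketBra_prodKet_mem_separableStates (hv k), ?_⟩
  · rw [Finset.sum_const, Finset.card_univ, nsmul_eq_mul]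
    exact mul_inv_cancel₀ hD.ne'
  have hscale : l • ∑ k, D⁻¹ • ketBra (prodKet (v k)) - ketBra ψ =
      (D⁻¹ ^ 2) • (D • ∑ k, ketBra (c k • prodKet (v k)) - ketBra (∑ k, c k • prodKet (v k))) := by
    rw [hψ, ketBra_smul, norm_inv, Complex.norm_natCast, ← hcard, smul_sub, smul_smul, pow_two,
      mul_assoc, inv_mul_cancel₀ hD.ne', mul_one, Finset.smul_sum, Finset.smul_sum]
    simp only [ketBra_smul, hc, smul_comm l]
  rw [hscale]
  exact (posSemidef_card_smul_sum_ketBra_sub _).smul (by positivity)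

lemma exists_separable_of_mixture {ι : Type*} [Fintype ι] {p : ι → ℝ} (hp : ∀ i, 0 ≤ p i)
    (hp1 : ∑ i, p i = 1) {ψ : ι → (Fin N → α) → ℂ}
    (h : ∀ i, ∃ σ ∈ separableStates N α, (l • σ - ketBra (ψ i)).PosSemidef) :
    ∃ σ ∈ separableStates N α, (l • σ - ∑ i, p i • ketBra (ψ i)).PosSemidef := by
  choose σ hσ hpsd using h
  refine ⟨∑ i, p i • σ i, convex_separableStates.sum_mem (fun i _ => hp i) hp1 fun i _ => hσ i, ?_⟩
  simp only [Finset.smul_sum, ← Finset.sum_sub_distrib, smul_comm l, ← smul_sub]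
  exact Matrix.posSemidef_sum _ fun i _ => (hpsd i).smul (hp i)

end Domination

section Polarization

variable {N : ℕ}

lemma sum_eq_sum_perm_of_not_injective {M : Type*} [AddCommMonoid M] {g : (Fin N → Fin N) → M}
    (hg : ∀ f, ¬ Function.Injective f → g f = 0) :
    ∑ f, g f = ∑ π : Equiv.Perm (Fin N), g π := by
  refine (Fintype.sum_of_injective (fun π : Equiv.Perm (Fin N) => ⇑π) DFunLike.coe_injective _ _
    (fun f hf => hg f fun hinj => hf ⟨Equiv.ofBijective f ?_, rfl⟩) fun π => rfl).symm
  exact Finite.injective_iff_bijective.1 hinj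

lemma prodKet_smul_sum {κ γ : Type*} [Fintype κ] (c : ℂ) (u : κ → γ → ℂ) :
    prodKet (fun _ : Fin N => c • ∑ m, u m) =
      c ^ N • ∑ f : Fin N → κ, prodKet (u ∘ f) := by
  funext x
  simp only [prodKet, Pi.smul_apply, Finset.sum_apply, smul_eq_mul, Finset.prod_mul_distrib,
    Finset.prod_const, Finset.card_univ, Fintype.card_fin, prod_sum_eq_sum_pi_prod,
    Function.comp_apply]

lemma prodKet_smul {γ : Type*} (c : Fin N → ℂ) (v : Fin N → γ → ℂ) :
    prodKet (fun j => c j • v j) = (∏ j, c j) • prodKet v := by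
  funext x
  simp only [prodKet, Pi.smul_apply, smul_eq_mul, Finset.prod_mul_distrib]

lemma sum_prod_sign_mul_prod_sign_comp (f : Fin N → Fin N) :
    ∑ w : Fin N → ℤˣ, (∏ j, ((w j : ℤ) : ℂ)) * ∏ j, ((w (f j) : ℤ) : ℂ) =
      if Function.Injective f then (Fintype.card (Fin N → ℤˣ) : ℂ) else 0 := by
  split_ifs with hf
  · have hone (w : Fin N → ℤˣ) : (∏ j, ((w j : ℤ) : ℂ)) * ∏ j, ((w (f j) : ℤ) : ℂ) = 1 := by
      rw [(Finite.injective_iff_bijective.1 hf).prod_comp fun j => ((w j : ℤ) : ℂ),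
        ← Finset.prod_mul_distrib]
      exact Finset.prod_eq_one fun j _ => intUnit_mul_self (w j)
    simp only [hone, Finset.sum_const, Finset.card_univ, nsmul_eq_mul, mul_one]
  · obtain ⟨i, hi⟩ := not_forall.1 (mt Finite.injective_iff_surjective.2 hf)
    -- flipping the sign at an index outside the range of `f` negates every summand
    set flip : Fin N → ℤˣ := Pi.mulSingle i (-1)
    have hflip : ∏ j, ((flip j : ℤ) : ℂ) = -1 := by
      rw [← Int.cast_prod, ← Units.coe_prod, Finset.prod_pi_mulSingle']
      norm_num
    have hrange (j : Fin N) : flip (f j) = 1 := Pi.mulSingle_eq_of_ne (fun h => hi ⟨j, h⟩) _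
    have hneg := Equiv.sum_comp (Equiv.mulRight flip) fun w : Fin N → ℤˣ =>
      (∏ j, ((w j : ℤ) : ℂ)) * ∏ j, ((w (f j) : ℤ) : ℂ)
    simp only [Equiv.coe_mulRight, Pi.mul_apply, hrange, mul_one, Units.val_mul, Int.cast_mul,
      Finset.prod_mul_distrib, hflip, mul_neg_one, neg_mul, Finset.sum_neg_distrib] at hneg
    exact self_eq_neg.1 hneg.symm

lemma sum_prod_sign_smul_prodKet_sum {γ : Type*} (c : ℂ) (u : Fin N → γ → ℂ) :
    ∑ w : Fin N → ℤˣ, (∏ j, ((w j : ℤ) : ℂ)) •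
        prodKet (fun _ : Fin N => c • ∑ m, ((w m : ℤ) : ℂ) • u m) =
      (Fintype.card (Fin N → ℤˣ) * c ^ N) • ∑ π : Equiv.Perm (Fin N), prodKet (u ∘ π) := by
  have hexpand (w : Fin N → ℤˣ) : (∏ j, ((w j : ℤ) : ℂ)) •
        prodKet (fun _ : Fin N => c • ∑ m, ((w m : ℤ) : ℂ) • u m) =
      c ^ N • ∑ f : Fin N → Fin N,
        ((∏ j, ((w j : ℤ) : ℂ)) * ∏ j, ((w (f j) : ℤ) : ℂ)) • prodKet (u ∘ f) := by
    rw [prodKet_smul_sum, smul_comm, Finset.smul_sum]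
    congr 1
    refine Finset.sum_congr rfl fun f _ => ?_
    rw [mul_smul]
    congr 1
    exact prodKet_smul (fun j => ((w (f j) : ℤ) : ℂ)) (u ∘ f)
  simp only [hexpand]
  rw [← Finset.smul_sum, Finset.sum_comm, mul_comm, mul_smul]
  congr 1
  simp only [← Finset.sum_smul, sum_prod_sign_mul_prod_sign_comp]
  rw [sum_eq_sum_perm_of_not_injective fun f hf => by rw [if_neg hf, zero_smul], Finset.smul_sum]
  exact Finset.sum_congr rfl fun π _ => by rw [if_pos π.injective]

end Polarization

section JoinKet

variable {N : ℕ} {α β γ : Type*} (e : γ ≃ α × β)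

lemma joinKet_smul_left (c : ℂ) (ψ : (Fin N → α) → ℂ) (χ : (Fin N → β) → ℂ) :
    joinKet e (c • ψ) χ = c • joinKet e ψ χ :=
  funext fun _ => mul_assoc _ _ _

lemma joinKet_smul_right (c : ℂ) (ψ : (Fin N → α) → ℂ) (χ : (Fin N → β) → ℂ) :
    joinKet e ψ (c • χ) = c • joinKet e ψ χ :=
  funext fun _ => mul_left_comm _ _ _

lemma joinKet_sum_left {I : Type*} [Fintype I] (ψ : I → (Fin N → α) → ℂ) (χ : (Fin N → β) → ℂ) :
    joinKet e (∑ i, ψ i) χ = ∑ i, joinKet e (ψ i) χ := by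
  funext x
  simp only [joinKet, tensorKet, Finset.sum_apply, Finset.sum_mul]

lemma joinKet_sum_right {I : Type*} [Fintype I] (ψ : (Fin N → α) → ℂ) (χ : I → (Fin N → β) → ℂ) :
    joinKet e ψ (∑ i, χ i) = ∑ i, joinKet e ψ (χ i) := by
  funext x
  simp only [joinKet, tensorKet, Finset.sum_apply, Finset.mul_sum]

end JoinKet

section PairKet

variable {N : ℕ} {α γ : Type*} (e : γ ≃ α × α) (a b : Fin N → EuclideanSpace ℂ α)

/-- The maximally entangled vector `N^{-1/2} ∑ₘ |aₘ⟩ ⊗ |bₘ⟩` of two particles. -/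
noncomputable def pairKet : γ → ℂ :=
  ((√(N : ℝ) : ℝ) : ℂ)⁻¹ • ∑ m, tensorKet e (a m).ofLp (b m).ofLp

lemma prodKet_pairKet :
    prodKet (fun _ : Fin N => pairKet e a b) =
      ((√(N : ℝ) : ℝ) : ℂ)⁻¹ ^ N • ∑ f : Fin N → Fin N,
        joinKet e (prodKet fun j => (a (f j)).ofLp) (prodKet fun j => (b (f j)).ofLp) := by
  simp only [pairKet, prodKet_smul_sum, joinKet_prodKet]
  rfl

lemma factorial_smul_joinKet_slaterKet :
    (N ! : ℂ) • joinKet e (slaterKet a) (slaterKet b) =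
      ∑ τ : Equiv.Perm (Fin N), ((Equiv.Perm.sign τ : ℤ) : ℂ) • ∑ π : Equiv.Perm (Fin N),
        joinKet e (prodKet fun j => (a (τ (π j))).ofLp) (prodKet fun j => (b (π j)).ofLp) := by
  have hleft (π : Equiv.Perm (Fin N)) :
      ∑ τ : Equiv.Perm (Fin N), ((Equiv.Perm.sign τ : ℤ) : ℂ) • joinKet e
          (prodKet fun j => (a (τ (π j))).ofLp) (prodKet fun j => (b (π j)).ofLp) =
        ((√(N ! : ℝ) : ℝ) : ℂ) • ((Equiv.Perm.sign π : ℤ) : ℂ) •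
          joinKet e (slaterKet a) (prodKet fun j => (b (π j)).ofLp) := by
    rw [← Equiv.sum_comp (Equiv.mulRight π⁻¹), ← joinKet_smul_left, ← joinKet_smul_left,
      smul_comm, sqrt_factorial_smul_slaterKet, Finset.smul_sum, joinKet_sum_left]
    refine Finset.sum_congr rfl fun τ _ => ?_
    rw [joinKet_smul_left, joinKet_smul_left, smul_smul, Equiv.coe_mulRight,
      Equiv.Perm.sign_mul, Equiv.Perm.sign_inv, Units.val_mul, Int.cast_mul, mul_comm]
    simp only [Equiv.Perm.mul_apply, Equiv.Perm.coe_inv, Equiv.symm_apply_apply]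
  calc (N ! : ℂ) • joinKet e (slaterKet a) (slaterKet b)
      = ((√(N ! : ℝ) : ℝ) : ℂ) • ∑ π : Equiv.Perm (Fin N), ((Equiv.Perm.sign π : ℤ) : ℂ) •
          joinKet e (slaterKet a) (prodKet fun j => (b (π j)).ofLp) := by
        simp only [← joinKet_smul_right, ← joinKet_sum_right, ← sqrt_factorial_smul_slaterKet]
        rw [smul_smul, ofReal_sqrt_natCast_mul_self]
    _ = _ := by
        simp only [Finset.smul_sum, ← hleft]
        exact Finset.sum_comm

lemma sum_prod_sign_smul_prodKet_pairKet :
    ∑ w : Fin N → ℤˣ, (∏ j, ((w j : ℤ) : ℂ)) •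
        prodKet (fun _ : Fin N => pairKet e (fun m => ((w m : ℤ) : ℂ) • a m) b) =
      (Fintype.card (Fin N → ℤˣ) * ((√(N : ℝ) : ℝ) : ℂ)⁻¹ ^ N) •
        ∑ π : Equiv.Perm (Fin N),
          joinKet e (prodKet fun j => (a (π j)).ofLp) (prodKet fun j => (b (π j)).ofLp) := by
  have hsmul (c : ℂ) (m : Fin N) : tensorKet e (c • a m).ofLp (b m).ofLp =
      c • tensorKet e (a m).ofLp (b m).ofLp := funext fun _ => mul_assoc _ _ _
  simp only [pairKet, hsmul, sum_prod_sign_smul_prodKet_sum, joinKet_prodKet]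
  rfl

lemma joinKet_slaterKet_eq_average :
    joinKet e (slaterKet a) (slaterKet b) =
      (Fintype.card (Equiv.Perm (Fin N) × (Fin N → ℤˣ)) : ℂ)⁻¹ •
        ∑ q : Equiv.Perm (Fin N) × (Fin N → ℤˣ),
          (((√(N : ℝ) : ℝ) : ℂ) ^ N *
              (((Equiv.Perm.sign q.1 : ℤ) : ℂ) * ∏ j, ((q.2 j : ℤ) : ℂ))) •
            prodKet fun _ => pairKet e (fun m => ((q.2 m : ℤ) : ℂ) • a (q.1 m)) b := by
  have hroot : ((√(N : ℝ) : ℝ) : ℂ) ^ N * ((√(N : ℝ) : ℝ) : ℂ)⁻¹ ^ N = 1 := by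
    rcases eq_or_ne N 0 with rfl | hN
    · rw [pow_zero, pow_zero, one_mul]
    · rw [← mul_pow, mul_inv_cancel₀ (ofReal_sqrt_natCast_ne_zero hN), one_pow]
  have hsigns : (Fintype.card (Fin N → ℤˣ) : ℂ) ≠ 0 := Nat.cast_ne_zero.2 Fintype.card_ne_zero
  have hfac : (N ! : ℂ) ≠ 0 := Nat.cast_ne_zero.2 N.factorial_ne_zero
  rw [Fintype.sum_prod_type, Fintype.card_prod, Fintype.card_perm, Fintype.card_fin, Nat.cast_mul,
    eq_inv_smul_iff₀ (mul_ne_zero hfac hsigns), mul_comm, mul_smul,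
    factorial_smul_joinKet_slaterKet, Finset.smul_sum]
  refine Finset.sum_congr rfl fun τ _ => ?_
  simp only [mul_smul, ← Finset.smul_sum]
  rw [sum_prod_sign_smul_prodKet_pairKet e (fun m => a (τ m)) b, mul_comm (Fintype.card _ : ℂ),
    mul_smul, smul_comm (_ ^ N), smul_smul (_ ^ N), hroot, one_smul, smul_comm]

variable {a b} [Fintype α] [Fintype γ]

lemma isUnitKet_pairKet (hN : N ≠ 0) (ha : Orthonormal ℂ a) (hb : Orthonormal ℂ b) :
    IsUnitKet (pairKet e a b) := by
  have horth {v : Fin N → EuclideanSpace ℂ α} (hv : Orthonormal ℂ v) (i j : Fin N) :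
      star (v i).ofLp ⬝ᵥ (v j).ofLp = if i = j then 1 else 0 := by
    rw [dotProduct_comm, ← EuclideanSpace.inner_eq_star_dotProduct, orthonormal_iff_ite.1 hv]
  have hroot : star ((√(N : ℝ) : ℝ) : ℂ)⁻¹ = ((√(N : ℝ) : ℝ) : ℂ)⁻¹ := by
    rw [star_inv₀, Complex.star_def, Complex.conj_ofReal]
  rw [isUnitKet_iff, pairKet, star_smul, smul_dotProduct, dotProduct_smul, star_sum,
    sum_dotProduct, hroot, smul_smul, ← mul_inv, ofReal_sqrt_natCast_mul_self]
  simp only [dotProduct_sum, star_tensorKet_dotProduct, horth ha, horth hb, mul_ite, mul_one,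
    mul_zero, Finset.sum_ite_eq, Finset.mem_univ, if_true, Finset.sum_const,
    Finset.card_univ, Fintype.card_fin, nsmul_eq_mul, smul_eq_mul]
  exact inv_mul_cancel₀ (Nat.cast_ne_zero.2 hN)

lemma exists_separable_slaterKet (ha : Orthonormal ℂ a) :
    ∃ σ ∈ separableStates N α, ((N ! : ℝ) • σ - ketBra (slaterKet a)).PosSemidef := by
  refine exists_separable_of_average
    (c := fun π : Equiv.Perm (Fin N) => ((√(N ! : ℝ) : ℝ) : ℂ) * ((Equiv.Perm.sign π : ℤ) : ℂ))
    (v := fun π j => (a (π j)).ofLp) (fun π => ?_)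
    (fun π j => (isUnitKet_ofLp_iff _).2 (ha.1 _)) ?_
  · rw [norm_mul, norm_intUnit, mul_one, norm_ofReal_sqrt_natCast_sq]
  · simp only [mul_smul, ← Finset.smul_sum]
    rw [← sqrt_factorial_smul_slaterKet, smul_smul, smul_smul, mul_assoc,
      ofReal_sqrt_natCast_mul_self, Fintype.card_perm, Fintype.card_fin,
      inv_mul_cancel₀ (Nat.cast_ne_zero.2 N.factorial_ne_zero), one_smul]

lemma exists_separable_joinKet_slaterKet (ha : Orthonormal ℂ a) (hb : Orthonormal ℂ b) :
    ∃ σ ∈ separableStates N γ,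
      ((N : ℝ) ^ N • σ - ketBra (joinKet e (slaterKet a) (slaterKet b))).PosSemidef := by
  refine exists_separable_of_average (fun q => ?_) (fun q j => ?_)
    (joinKet_slaterKet_eq_average e a b)
  · rw [norm_mul, norm_mul, norm_prod, norm_intUnit, one_mul,
      Finset.prod_eq_one fun j _ => norm_intUnit (q.2 j), mul_one, norm_pow, pow_right_comm,
      norm_ofReal_sqrt_natCast_sq]
  · refine isUnitKet_pairKet e j.pos.ne' ⟨fun m => ?_, fun m m' h => ?_⟩ hb
    · rw [norm_smul, norm_intUnit, one_mul, ha.1]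
    · simp only [inner_smul_left, inner_smul_right, ha.2 (q.1.injective.ne h), mul_zero, mul_zero]

end PairKet

section GeometricMeasure

lemma star_dotProduct_mulVec_of_mul_eq {n : Type*} [Fintype n] {P ρ : Matrix n n ℂ}
    (hP : P.IsHermitian) (hρ : ρ.IsHermitian) (hPρ : P * ρ = ρ) (v : n → ℂ) :
    star v ⬝ᵥ ρ *ᵥ v = star (P *ᵥ v) ⬝ᵥ ρ *ᵥ (P *ᵥ v) := by
  have hρP : ρ * P = ρ := by
    rw [← hρ.eq, ← hP.eq, ← Matrix.conjTranspose_mul, hPρ]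
  rw [Matrix.mulVec_mulVec, hρP, star_mulVec_dotProduct_of_isHermitian hP, Matrix.mulVec_mulVec,
    hPρ]

lemma star_smul_dotProduct_mulVec_smul {n : Type*} [Fintype n] (ρ : Matrix n n ℂ) (c : ℂ)
    (v : n → ℂ) :
    star (c • v) ⬝ᵥ ρ *ᵥ (c • v) = ((‖c‖ ^ 2 : ℝ) : ℂ) * (star v ⬝ᵥ ρ *ᵥ v) := by
  rw [Matrix.mulVec_smul, star_smul, smul_dotProduct, dotProduct_smul, smul_eq_mul, smul_eq_mul,
    ← mul_assoc, Complex.star_def, Complex.conj_mul', Complex.ofReal_pow]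

variable {N : ℕ} {α γ : Type*} [Fintype γ] (e : γ ≃ α × α)

lemma joinOp_antisymProj_mulVec_prodKet_pairKet [Finite α] [DecidableEq α]
    (b : Fin N → EuclideanSpace ℂ α) :
    joinOp e (antisymProj N α) (antisymProj N α) *ᵥ prodKet (fun _ => pairKet e b b) =
      ((√(N : ℝ) : ℝ) : ℂ)⁻¹ ^ N • joinKet e (slaterKet b) (slaterKet b) := by
  cases nonempty_fintype α
  have hfac : (N ! : ℂ) ≠ 0 := Nat.cast_ne_zero.2 N.factorial_ne_zero
  have hproj (f : Fin N → Fin N) : joinOp e (antisymProj N α) (antisymProj N α) *ᵥ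
      joinKet e (prodKet fun j => (b (f j)).ofLp) (prodKet fun j => (b (f j)).ofLp) =
      (N ! : ℂ)⁻¹ • joinKet e (slaterKet (b ∘ f)) (slaterKet (b ∘ f)) := by
    rw [joinOp_mulVec_joinKet, antisymProj_mulVec_prodKet, joinKet_smul_left, joinKet_smul_right,
      smul_smul, ← mul_inv, ofReal_sqrt_natCast_mul_self]
    rfl
  have hperm (π : Equiv.Perm (Fin N)) :
      joinKet e (slaterKet (b ∘ π)) (slaterKet (b ∘ π)) =
        joinKet e (slaterKet b) (slaterKet b) := by
    rw [slaterKet_comp_perm, joinKet_smul_left, joinKet_smul_right, smul_smul, intUnit_mul_self,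
      one_smul]
  rw [prodKet_pairKet, Matrix.mulVec_smul, Matrix.mulVec_sum]
  simp only [hproj]
  rw [← Finset.smul_sum, sum_eq_sum_perm_of_not_injective fun f hf => by
    rw [slaterKet_comp_eq_zero b hf, ← zero_smul ℂ 0, joinKet_smul_left, zero_smul]]
  simp only [hperm, Finset.sum_const, Finset.card_univ, Fintype.card_perm, Fintype.card_fin]
  rw [← Nat.cast_smul_eq_nsmul ℂ, inv_smul_smul₀ hfac]

variable [Fintype α] {ρ : Matrix (Fin N → α) (Fin N → α) ℂ}

lemma star_prodKet_dotProduct_mulVec_prodKet [DecidableEq α] (hρ : ρ.IsHermitian)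
    (hPρ : antisymProj N α * ρ = ρ) (v : Fin N → α → ℂ) :
    star (prodKet v) ⬝ᵥ ρ *ᵥ prodKet v = (N ! : ℂ)⁻¹ *
      (star (slaterKet fun j => WithLp.toLp 2 (v j)) ⬝ᵥ
        ρ *ᵥ slaterKet fun j => WithLp.toLp 2 (v j)) := by
  rw [star_dotProduct_mulVec_of_mul_eq isHermitian_antisymProj hρ hPρ,
    antisymProj_mulVec_prodKet, star_smul_dotProduct_mulVec_smul, norm_inv, inv_pow,
    norm_ofReal_sqrt_natCast_sq, Complex.ofReal_inv, Complex.ofReal_natCast]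

lemma norm_le_one_of_slaterKet_eq_smul {v : Fin N → α → ℂ} (hv : ∀ j, IsUnitKet (v j))
    {b : Fin N → EuclideanSpace ℂ α} (hb : Orthonormal ℂ b) {c : ℂ}
    (hvb : slaterKet (fun j => WithLp.toLp 2 (v j)) = c • slaterKet b) : ‖c‖ ≤ 1 := by
  classical
  have hle := antisymProj_overlap_le hv
  rw [star_prodKet_dotProduct_mulVec_prodKet isHermitian_antisymProj antisymProj_mul_self, hvb,
    star_smul_dotProduct_mulVec_smul, (isAntisymmetric_slaterKet b).antisymProj_mulVec,
    (isUnitKet_iff _).1 (isUnitKet_slaterKet hb), mul_one, ← Complex.ofReal_natCast,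
    ← Complex.ofReal_inv, ← Complex.ofReal_mul, Complex.ofReal_re,
    mul_le_iff_le_one_right (inv_pos.2 (mod_cast N.factorial_pos))] at hle
  exact (sq_le_one_iff₀ (norm_nonneg c)).1 hle

variable [DecidableEq α]

lemma sq_slaterKet_overlap_le (hρ : IsDensityMatrix ρ) (hPρ : antisymProj N α * ρ = ρ)
    {b : Fin N → EuclideanSpace ℂ α} (hb : Orthonormal ℂ b) :
    (star (slaterKet b) ⬝ᵥ ρ *ᵥ slaterKet b).re ^ 2 ≤
      (N : ℝ) ^ N * maxOverlapSq (joinOp e ρ ρ) := by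
  set m := star (slaterKet b) ⬝ᵥ ρ *ᵥ slaterKet b
  have him : m.im = 0 :=
    (Complex.le_def.1 (hρ.1.dotProduct_mulVec_nonneg (slaterKet b))).2.symm
  have hle := (hρ.joinOp e hρ).le_maxOverlapSq (ketBra_prodKet_mem_separableStates
    (v := fun _ : Fin N => pairKet e b b) fun j => isUnitKet_pairKet e j.pos.ne' hb hb)
  rw [trace_mul_ketBra, star_dotProduct_mulVec_of_mul_eq (isHermitian_joinOp e
    isHermitian_antisymProj isHermitian_antisymProj) (hρ.joinOp e hρ).1.isHermitian
    (by rw [joinOp_mul_joinOp, hPρ]), joinOp_antisymProj_mulVec_prodKet_pairKet,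
    star_smul_dotProduct_mulVec_smul, joinOp_mulVec_joinKet, star_joinKet_dotProduct,
    Complex.re_ofReal_mul, Complex.mul_re, him, mul_zero, sub_zero, norm_pow, norm_inv,
    pow_right_comm, inv_pow, norm_ofReal_sqrt_natCast_sq, inv_pow,
    inv_mul_le_iff₀ (mod_cast Nat.pow_self_pos)] at hle
  rwa [pow_two]

lemma factorial_mul_maxOverlapSq_le (hρ : IsDensityMatrix ρ) (hPρ : antisymProj N α * ρ = ρ) :
    N ! * maxOverlapSq ρ ≤ √((N : ℝ) ^ N * maxOverlapSq (joinOp e ρ ρ)) := by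
  have hfac : (0 : ℝ) < N ! := mod_cast N.factorial_pos
  rw [mul_comm, ← le_div_iff₀ hfac]
  refine hρ.maxOverlapSq_le fun v hv => ?_
  rw [star_prodKet_dotProduct_mulVec_prodKet hρ.1.isHermitian hPρ, ← Complex.ofReal_natCast,
    ← Complex.ofReal_inv, Complex.re_ofReal_mul, le_div_iff₀' hfac, mul_inv_cancel_left₀ hfac.ne']
  rcases slaterKet_eq_zero_or_exists_orthonormal fun j => WithLp.toLp 2 (v j) with
    hzero | ⟨b, c, hb, hvb⟩
  · rw [hzero, Matrix.mulVec_zero, dotProduct_zero, Complex.zero_re]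
    exact Real.sqrt_nonneg _
  rw [hvb, star_smul_dotProduct_mulVec_smul, Complex.re_ofReal_mul]
  calc ‖c‖ ^ 2 * (star (slaterKet b) ⬝ᵥ ρ *ᵥ slaterKet b).re
      ≤ (star (slaterKet b) ⬝ᵥ ρ *ᵥ slaterKet b).re :=
        mul_le_of_le_one_left (Complex.le_def.1 (hρ.1.dotProduct_mulVec_nonneg _)).1
          (pow_le_one₀ (norm_nonneg c) (norm_le_one_of_slaterKet_eq_smul hv hb hvb))
    _ ≤ √((N : ℝ) ^ N * maxOverlapSq (joinOp e ρ ρ)) :=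
        Real.le_sqrt_of_sq_le (sq_slaterKet_overlap_le e hρ hPρ hb)

lemma pow_self_lt_factorial_sq {N : ℕ} (hN : 3 ≤ N) : N ^ N < N ! ^ 2 := by
  have hfac : N ! ^ 2 = ∏ i ∈ Finset.range N, (i + 1) * (N - i) := by
    rw [Finset.prod_mul_distrib, Finset.prod_range_add_one_eq_factorial, sq,
      ← Finset.prod_range_add_one_eq_factorial, ← Finset.prod_range_reflect]
    congr 1
    refine Finset.prod_congr rfl fun i hi => ?_
    have := Finset.mem_range.1 hi
    omega
  have hfactor (i : ℕ) (hi : i ∈ Finset.range N) : N ≤ (i + 1) * (N - i) := by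
    obtain ⟨k, rfl⟩ := Nat.exists_eq_add_of_lt (Finset.mem_range.1 hi)
    rw [add_assoc, Nat.add_sub_cancel_left]
    nlinarith
  rw [hfac, ← Finset.card_range N, ← Finset.prod_const, Finset.card_range]
  exact Finset.prod_lt_prod (fun i _ => by omega) hfactor
    ⟨1, Finset.mem_range.2 (by omega), by omega⟩

lemma geometricMeasure_joinOp_self_lt (hN : 3 ≤ N) (hρ : IsDensityMatrix ρ)
    (hPρ : antisymProj N α * ρ = ρ) :
    geometricMeasure (joinOp e ρ ρ) < 2 * geometricMeasure ρ := by
  have hpos := hρ.maxOverlapSq_pos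
  have hpos₂ := (hρ.joinOp e hρ).maxOverlapSq_pos
  have hlt : maxOverlapSq ρ ^ 2 < maxOverlapSq (joinOp e ρ ρ) := by
    refine lt_of_mul_lt_mul_left ?_ (sq_nonneg (N ! : ℝ))
    calc (N ! : ℝ) ^ 2 * maxOverlapSq ρ ^ 2 = (N ! * maxOverlapSq ρ) ^ 2 := (mul_pow _ _ _).symm
      _ ≤ √((N : ℝ) ^ N * maxOverlapSq (joinOp e ρ ρ)) ^ 2 := by
          gcongr
          exact factorial_mul_maxOverlapSq_le e hρ hPρ
      _ = (N : ℝ) ^ N * maxOverlapSq (joinOp e ρ ρ) := Real.sq_sqrt (by positivity)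
      _ < (N ! : ℝ) ^ 2 * maxOverlapSq (joinOp e ρ ρ) := by
          gcongr
          exact_mod_cast pow_self_lt_factorial_sq hN
  have hlog := Real.logb_lt_logb one_lt_two (by positivity) hlt
  rw [Real.logb_pow, Nat.cast_ofNat] at hlog
  rw [hρ.geometricMeasure_eq, (hρ.joinOp e hρ).geometricMeasure_eq]
  linarith

end GeometricMeasure

section SlaterMixture

variable {N : ℕ} {α γ : Type*} [Fintype α] {ρ : Matrix (Fin N → α) (Fin N → α) ℂ}

lemma logb_factorial_le_relEntropyEntanglement [DecidableEq α] (hρ : IsDensityMatrix ρ)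
    (hPρ : antisymProj N α * ρ = ρ) :
    ((Real.logb 2 (N ! : ℝ) : ℝ) : EReal) ≤ relEntropyEntanglement ρ := by
  have hle := hρ.neg_logb_le_relEntropyEntanglement isHermitian_antisymProj antisymProj_mul_self
    hPρ (inv_pos.2 (mod_cast N.factorial_pos)) fun _ => antisymProj_overlap_le
  rwa [Real.logb_inv, neg_neg] at hle

lemma logb_le_relEntropyEntanglement_joinOp_self [DecidableEq α] [Fintype γ] [DecidableEq γ]
    (e : γ ≃ α × α) (hN : N ≤ Fintype.card α) (hρ : IsDensityMatrix ρ)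
    (hPρ : antisymProj N α * ρ = ρ) :
    ((Real.logb 2 ((Fintype.card α : ℝ) ^ N * (N ! : ℝ) * ((Fintype.card α - N)! : ℝ) /
      ((Fintype.card α)! : ℝ)) : ℝ) : EReal) ≤ relEntropyEntanglement (joinOp e ρ ρ) := by
  set d := Fintype.card α
  have hdesc : ((d - N)! : ℝ) * d.descFactorial N = d ! :=
    mod_cast Nat.factorial_mul_descFactorial hN
  have hfac : (0 : ℝ) < N ! := mod_cast N.factorial_pos
  have hfac' : (0 : ℝ) < (d - N)! := mod_cast (d - N).factorial_pos
  have hdescpos : (0 : ℝ) < d.descFactorial N := mod_cast Nat.descFactorial_pos.2 hN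
  have hpow : (0 : ℝ) < (d : ℝ) ^ N := by
    rcases N.eq_zero_or_pos with rfl | hpos
    · simp
    · exact pow_pos (mod_cast hpos.trans_le hN) N
  have hle := (hρ.joinOp e hρ).neg_logb_le_relEntropyEntanglement
    (isHermitian_joinOp e isHermitian_antisymProj isHermitian_antisymProj)
    (by rw [joinOp_mul_joinOp, antisymProj_mul_self]) (by rw [joinOp_mul_joinOp, hPρ])
    (div_pos hdescpos (mul_pos hfac hpow)) fun v hv =>
      (le_div_iff₀' (mul_pos hfac hpow)).2 (joinOp_antisymProj_overlap_le e hN hv)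
  rwa [← Real.logb_inv, inv_div, mul_comm (N ! : ℝ), ← mul_div_mul_right _ _ hfac'.ne',
    mul_comm (d.descFactorial N : ℝ), hdesc] at hle

lemma mul_logb_self_lt (hN : 3 ≤ N) :
    (N : ℝ) * Real.logb 2 (N : ℝ) < 2 * Real.logb 2 (N ! : ℝ) := by
  have hlog := Real.logb_lt_logb one_lt_two (mod_cast Nat.pow_self_pos)
    (mod_cast pow_self_lt_factorial_sq hN : (N : ℝ) ^ N < (N ! : ℝ) ^ 2)
  rwa [Real.logb_pow, Real.logb_pow, Nat.cast_ofNat] at hlog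

variable {ι : Type*} [Fintype ι] {p : ι → ℝ} {a : ι → Fin N → EuclideanSpace ℂ α}

lemma antisymProj_mul_slaterMixture [DecidableEq α] :
    antisymProj N α * ∑ i, p i • ketBra (slaterKet (a i)) =
      ∑ i, p i • ketBra (slaterKet (a i)) := by
  simp only [Matrix.mul_sum, Matrix.mul_smul, ketBra, Matrix.mul_vecMulVec,
    (isAntisymmetric_slaterKet _).antisymProj_mulVec]

lemma isDensityMatrix_slaterMixture (hp : ∀ i, 0 ≤ p i) (hp1 : ∑ i, p i = 1)
    (ha : ∀ i, Orthonormal ℂ (a i)) :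
    IsDensityMatrix (∑ i, p i • ketBra (slaterKet (a i))) :=
  convex_isDensityMatrix.sum_mem (fun i _ => hp i) hp1 fun i _ =>
    isDensityMatrix_ketBra (isUnitKet_slaterKet (ha i))

lemma logGlobalRobustness_slaterMixture_le (hp : ∀ i, 0 ≤ p i) (hp1 : ∑ i, p i = 1)
    (ha : ∀ i, Orthonormal ℂ (a i)) :
    logGlobalRobustness (∑ i, p i • ketBra (slaterKet (a i))) ≤ Real.logb 2 (N ! : ℝ) := by
  obtain ⟨σ, hσ, h⟩ := exists_separable_of_mixture hp hp1 fun i => exists_separable_slaterKet (ha i)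
  exact (isDensityMatrix_slaterMixture hp hp1 ha).logGlobalRobustness_le
    (mod_cast N.factorial_pos) hσ h

lemma logGlobalRobustness_joinOp_slaterMixture_le [Fintype γ] (e : γ ≃ α × α)
    (hp : ∀ i, 0 ≤ p i) (hp1 : ∑ i, p i = 1) (ha : ∀ i, Orthonormal ℂ (a i)) :
    logGlobalRobustness (joinOp e (∑ i, p i • ketBra (slaterKet (a i)))
      (∑ i, p i • ketBra (slaterKet (a i)))) ≤ N * Real.logb 2 (N : ℝ) := by
  have hρ := isDensityMatrix_slaterMixture hp hp1 ha
  obtain ⟨σ, hσ, h⟩ := exists_separable_of_mixture (p := fun q : ι × ι => p q.1 * p q.2)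
    (fun q => mul_nonneg (hp _) (hp _))
    (by rw [Fintype.sum_prod_type, ← Fintype.sum_mul_sum, hp1, one_mul])
    fun q => exists_separable_joinKet_slaterKet e (ha q.1) (ha q.2)
  rw [← joinOp_sum_smul_ketBra e (fun i => slaterKet (a i)) fun i => slaterKet (a i)] at h
  rw [← Real.logb_pow]
  exact (hρ.joinOp e hρ).logGlobalRobustness_le (mod_cast Nat.pow_self_pos) hσ h

lemma relEntropyEntanglement_slaterMixture_eq [DecidableEq α] (hp : ∀ i, 0 ≤ p i)
    (hp1 : ∑ i, p i = 1) (ha : ∀ i, Orthonormal ℂ (a i)) :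
    relEntropyEntanglement (∑ i, p i • ketBra (slaterKet (a i))) =
      ((Real.logb 2 (N ! : ℝ) : ℝ) : EReal) :=
  have hρ := isDensityMatrix_slaterMixture hp hp1 ha
  le_antisymm (hρ.relEntropyEntanglement_le_logGlobalRobustness.trans
      (EReal.coe_le_coe_iff.2 (logGlobalRobustness_slaterMixture_le hp hp1 ha)))
    (logb_factorial_le_relEntropyEntanglement hρ antisymProj_mul_slaterMixture)

lemma logGlobalRobustness_slaterMixture_eq (hp : ∀ i, 0 ≤ p i) (hp1 : ∑ i, p i = 1)
    (ha : ∀ i, Orthonormal ℂ (a i)) :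
    logGlobalRobustness (∑ i, p i • ketBra (slaterKet (a i))) = Real.logb 2 (N ! : ℝ) := by
  classical
  refine le_antisymm (logGlobalRobustness_slaterMixture_le hp hp1 ha) (EReal.coe_le_coe_iff.1 ?_)
  rw [← relEntropyEntanglement_slaterMixture_eq hp hp1 ha]
  exact (isDensityMatrix_slaterMixture hp hp1 ha).relEntropyEntanglement_le_logGlobalRobustness

end SlaterMixture

end MultipartiteEntanglement

theorem mainTheorem12 {N d : ℕ} (hNd : N ≤ d) {ι : Type*} [Fintype ι]
    (p : ι → ℝ) (hp_nonneg : ∀ i, 0 ≤ p i) (hp_sum : ∑ i, p i = 1)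
    (a : ι → Fin N → EuclideanSpace ℂ (Fin d)) (ha : ∀ i, Orthonormal ℂ (a i))
    (ρ : Matrix (Fin N → Fin d) (Fin N → Fin d) ℂ)
    (hρ : ρ = ∑ i, p i •
      ketBra (slaterKet (a i))) :
    (relEntropyEntanglement ρ = ((Real.logb 2 (N ! : ℝ) : ℝ) : EReal) ∧
      logGlobalRobustness ρ = Real.logb 2 (N ! : ℝ)) ∧
    (((Real.logb 2 ((d : ℝ) ^ N * (N ! : ℝ) * ((d - N)! : ℝ) / (d ! : ℝ)) : ℝ) : EReal) ≤
        relEntropyEntanglement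
          (tensorPower ρ 2) ∧
      relEntropyEntanglement
          (tensorPower ρ 2) ≤
        ((logGlobalRobustness
          (tensorPower ρ 2) : ℝ) : EReal) ∧
      logGlobalRobustness
          (tensorPower ρ 2) ≤ (N : ℝ) * Real.logb 2 (N : ℝ)) ∧
    (3 ≤ N →
      (geometricMeasure (tensorPower ρ 2) <
          2 * geometricMeasure ρ ∧
        IsNonadditive
          (fun _ _ _ τ => ((geometricMeasure τ : ℝ) : EReal)) ρ) ∧
      (relEntropyEntanglement
          (tensorPower ρ 2) <
          2 * relEntropyEntanglement ρ ∧
        IsNonadditive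
          (fun _ _ _ τ => relEntropyEntanglement τ) ρ) ∧
      (logGlobalRobustness
          (tensorPower ρ 2) <
          2 * logGlobalRobustness ρ ∧
        IsNonadditive
          (fun _ _ _ τ => ((logGlobalRobustness τ : ℝ) : EReal)) ρ)) := by
  subst hρ
  have hρd := isDensityMatrix_slaterMixture hp_nonneg hp_sum ha
  have hER := relEntropyEntanglement_slaterMixture_eq hp_nonneg hp_sum ha
  have hRL := logGlobalRobustness_slaterMixture_eq hp_nonneg hp_sum ha
  set ρ := ∑ i, p i • ketBra (slaterKet (a i))
  have hPρ : antisymProj N (Fin d) * ρ = ρ := antisymProj_mul_slaterMixture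
  have hER2 : _ ≤ relEntropyEntanglement (tensorPower ρ 2) := tensorPower_two ρ ▸
    logb_le_relEntropyEntanglement_joinOp_self (finTwoArrowEquiv (Fin d)) (by simpa) hρd hPρ
  have hER2_le := (hρd.tensorPower 2).relEntropyEntanglement_le_logGlobalRobustness
  have hRL2 : logGlobalRobustness (tensorPower ρ 2) ≤ N * Real.logb 2 (N : ℝ) :=
    tensorPower_two ρ ▸ logGlobalRobustness_joinOp_slaterMixture_le _ hp_nonneg hp_sum ha
  rw [Fintype.card_fin] at hER2
  refine ⟨⟨hER, hRL⟩, ⟨hER2, hER2_le, hRL2⟩, fun hN => ?_⟩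
  have hG : geometricMeasure (tensorPower ρ 2) < 2 * geometricMeasure ρ :=
    tensorPower_two ρ ▸ geometricMeasure_joinOp_self_lt _ hN hρd hPρ
  have hRL_lt : logGlobalRobustness (tensorPower ρ 2) < 2 * logGlobalRobustness ρ :=
    hRL ▸ hRL2.trans_lt (mul_logb_self_lt hN)
  have hER_lt : relEntropyEntanglement (tensorPower ρ 2) < 2 * relEntropyEntanglement ρ := by
    rw [hER, ← hRL]
    exact hER2_le.trans_lt (EReal.coe_lt_coe_iff.2 hRL_lt)
  exact ⟨⟨hG, isNonadditive_geometricMeasure hρd hG⟩,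
    ⟨hER_lt, isNonadditive_relEntropyEntanglement hρd hER_lt⟩,
    ⟨hRL_lt, isNonadditive_logGlobalRobustness hρd hRL_lt⟩⟩
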